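/- **Learning problem.** Let $F:\mathbb{R}^q\to\mathbb{R}$ be differentiable with $F(\mathbf w)\ge F^*$ for all $\mathbf w$, and suppose there are $L_1,\dots,L_q\ge 0$, not all zero, with $$\Big|F(\mathbf w')-\big(F(\mathbf w)+\nabla F(\mathbf w)^{\rm T}(\mathbf w'-\mathbf w)\big)\Big|\le \tfrac12\sum_{i=1}^q L_i(w_i'-w_i)^2\qquad\text{for all }\mathbf w,\mathbf w'.$$ Write $\|\mathbf L\|_1=\sum_i L_i$. Let $K\ge1$ devices and $N\ge 1$ communication rounds be given, let $\gamma>0$ be such that $n_{\rm b}=N/\gamma$ is an integer (the batch size), and let $\eta=1/\sqrt{\|\mathbf L\|_1 n_{\rm b}}$. At a parameter vector $\mathbf w$, device $k$ computes a local stochastic gradient $\tilde{\mathbf g}_k$ from fresh random data. For each $\mathbf w$ these are independent over the devices, $\mathbb E[\tilde{\mathbf g}_k]=\nabla F(\mathbf w)$, $\mathbb E[(\tilde g_{k,i}-\partial_iF(\mathbf w))^2]\le\sigma_i^2/n_{\rm b}$ with constants $\sigma_i\ge0$, and each coordinate $\tilde g_{k,i}$ has a unimodal distribution that is symmetric around its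 mean. Put $\|\boldsymbol\sigma\|_1=\sum_i\sigma_i$ and $\operatorname{sign}(x)=1$ for $x\ge0$, $-1$ for $x<0$. **Transmitters.** A round uses $S$ DFT-spread-OFDM blocks with $M$ bins and $N_{\rm d}$ samples each. Let $\mathbf X=\mathbf F_{N_{\rm d}}^{\rm H}\mathbf M_{\rm f}\,\mathrm{diag}(\mathbf f)\,\mathbf D_M$, where $\mathbf F_{N_{\rm d}},\mathbf D_M$ are the orthonormal DFT matrices, $\mathbf M_{\rm f}$ maps the $M$ DFT outputs to distinct subcarriers and $\sum_u|f_u|^2=M$. The columns of $\mathbf X$ are the circularly-shifted chirps (CSCs). With a guard parameter $M_{\rm g}\ge0$ there are $2\lfloor M/(2+2M_{\rm g})\rfloor$ slots per block, and slot $l$ consists of the bins $l(1+M_{\rm g}),\dots,(l+1)(1+M_{\rm g})-1$. Each gradient $i$ is assigned two (block, slot) pairs, one for each vote $\pm1$, and all $2q$ pairs are distinct. Device $k$ puts a random symbol $s_{k,i}$ with $|s_{k,i}|=1$ on the first bin of the slot of gradient $i$ that belongs to its vote $\operatorname{sign}(\tilde g_{k,i})$. All other bins are zero. Let $\mathbf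 d_{k,m}\in\mathbb{C}^M$ be the resulting vector of symbols on the bins of block $m$. **Channel and receiver.** The server receives $\mathbf r_m=\sum_k\sqrt{E_{\rm s}}\,\mathbf H_k\mathbf X\mathbf d_{k,m}+\mathbf n_m$, where $E_{\rm s}>0$ is the common received chirp energy, $\mathbf H_k$ is the circular convolution with the impulse response of device $k$, and $\mathbf n_m$ has independent $\mathcal{CN}(0,\sigma_{\rm n}^2)$ entries, $\sigma_{\rm n}^2>0$. The channels are Rayleigh fading: all taps are independent, the tap of delay $\tau$ has law $\mathcal{CN}(0,\rho_\tau)$ for every device, and $\sum_\tau\rho_\tau=1$. The server forms the bin symbols $\mathbf X^{\rm H}\mathbf r_m$, computes for each gradient $i$ the energies $m_i^+,m_i^-$ in the $1+M_{\rm g}$ bins of its two slots, and detects $v_i=\operatorname{sign}(m_i^+-m_i^-)$. The CSCs are orthogonal: distinct CSCs are orthogonal, and after a circular delay by any $\tau$ with $\rho_\tau\ne0$ the CSC of index $j$ is orthogonal to every CSC whose index is not in $\{j,\dots,j+M_{\rm g}\}$ modulo $M$. Data, symbols, channels and noise are independent of each other, and they are independent and identically distributed over the rounds. **Claim.** Let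 $\mathbf w^{(0)}$ be deterministic, $\mathbf w^{(n+1)}=\mathbf w^{(n)}-\eta\,\mathbf v^{(n)}$ with the detected vote vector $\mathbf v^{(n)}$ of round $n$, and $\mathbf g^{(n)}=\nabla F(\mathbf w^{(n)})$. Then $\frac1N\sum_{n=0}^{N-1}\|\mathbf g^{(n)}\|_1$ is integrable and $$\mathbb E\Big[\frac1N\sum_{n=0}^{N-1}\|\mathbf g^{(n)}\|_1\Big]\le\frac1{\sqrt N}\Big(a\sqrt{\|\mathbf L\|_1}\Big(F(\mathbf w^{(0)})-F^*+\frac\gamma2\Big)+\frac{2\sqrt{2\gamma}}3\|\boldsymbol\sigma\|_1\Big),$$ where $a=\big(1+\frac{2}{\xi K}\big)\frac1{\sqrt\gamma}$ and $\xi=\frac{E_{\rm s}}{(1+M_{\rm g})\sigma_{\rm n}^2}$. -/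

import Mathlib

open MeasureTheory ProbabilityTheory
open scoped NNReal Matrix

noncomputable section

/-- The sign convention for votes: `1` for a non-negative argument, `-1` for a negative one. -/
def sgn (x : ℝ) : ℝ := if 0 ≤ x then 1 else -1

/-- The circularly symmetric complex Gaussian law `CN(0, v)`: independent real and imaginary parts,
each of variance `v / 2`. -/
def complexGaussian (v : ℝ≥0) : Measure ℂ :=
  ((gaussianReal 0 (v / 2)).prod (gaussianReal 0 (v / 2))).map
    Complex.measurableEquivRealProd.symm

/-- A law on `ℝ` that is symmetric around `m` and unimodal: its distribution function is convex to
the left of `m` and concave to the right of `m`. (A symmetric unimodal law always has its centre of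
symmetry among its modes; an atom at `m` is allowed.) -/
def IsSymmetricUnimodal (ν : Measure ℝ) (m : ℝ) : Prop :=
  ν.map (fun x => 2 * m - x) = ν ∧
  ConvexOn ℝ (Set.Iic m) (fun x => ν.real (Set.Iic x)) ∧
  ConcaveOn ℝ (Set.Ici m) (fun x => ν.real (Set.Iic x))

/-- The orthonormal `n`-point DFT matrix; its conjugate transpose is the orthonormal IDFT matrix. -/
def dftMatrix (n : ℕ) : Matrix (Fin n) (Fin n) ℂ :=
  Matrix.of fun a b =>
    ((1 / Real.sqrt n : ℝ) : ℂ) *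
      Complex.exp (-(2 * Real.pi * Complex.I * ((a : ℕ) : ℂ) * ((b : ℕ) : ℂ) / (n : ℂ)))

/-- Parameters of the CSC-MV air interface for `q` gradients. -/
structure CSCSystem (q : ℕ) where
  /-- number of DFT-s-OFDM blocks per communication round -/
  S : ℕ
  /-- number of bins (circularly-shifted chirps) per block -/
  M : ℕ
  /-- IDFT size, the number of samples of a block -/
  Nd : ℕ
  /-- number of guard bins after each chirp position -/
  Mg : ℕ
  /-- the subcarriers onto which the DFT precoder output is mapped -/
  sub : Fin M ↪ Fin Nd
  /-- the frequency-domain spectral shaping vector -/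
  fdss : Fin M → ℂ
  fdss_norm : ∑ u, ‖fdss u‖ ^ 2 = (M : ℝ)
  /-- the vote mapping: gradient `i` uses the (block, slot) pair `loc (i, true)` for the vote `1`
  and `loc (i, false)` for the vote `-1`; there are `2 M_v` slots, `M_v = ⌊M / (2 + 2 M_g)⌋`,
  and slot `l` begins at bin `l (1 + M_g)` -/
  loc : Fin q × Bool ↪ Fin S × Fin (2 * (M / (2 + 2 * Mg)))
  /-- received energy of an active chirp of one device -/
  Es : ℝ
  Es_pos : 0 < Es
  /-- noise variance -/
  noiseVar : ℝ≥0
  noiseVar_pos : 0 < noiseVar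
  /-- power delay profile of the channel, normalized to unit power -/
  pdp : Fin Nd → ℝ≥0
  pdp_sum : ∑ τ, pdp τ = 1

namespace CSCSystem

variable {q : ℕ} (C : CSCSystem q)

/-- The subcarrier mapping matrix. -/
def mappingMatrix : Matrix (Fin C.Nd) (Fin C.M) ℂ :=
  Matrix.of fun t u => if t = C.sub u then 1 else 0

/-- The DFT-s-OFDM synthesis matrix (IDFT · mapping · spectral shaping · DFT);
column `j` is the chirp with circular shift `j`. -/
def chirpMatrix : Matrix (Fin C.Nd) (Fin C.M) ℂ :=
  (dftMatrix C.Nd)ᴴ * C.mappingMatrix * Matrix.diagonal C.fdss * dftMatrix C.M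

/-- Orthogonality of the chirps: distinct chirps are orthogonal, and a chirp that has gone through
any path delay of the channel does not interfere with any chirp outside its own guard window, that
is, it is orthogonal to the chirp `j'` unless `j' ∈ {j, …, j + M_g}` (cyclically). -/
def OrthogonalChirps : Prop :=
  (∀ j j', j ≠ j' → (C.chirpMatrixᴴ * C.chirpMatrix) j' j = 0) ∧
  ∀ τ, C.pdp τ ≠ 0 → ∀ j j' : Fin C.M, C.Mg < (j' - j).val →
    (C.chirpMatrixᴴ * Matrix.circulant (Pi.single τ (1 : ℂ)) * C.chirpMatrix) j' j = 0

variable {K : ℕ}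

/-- The symbols on the bins of block `m` of device `k`, for the votes `v` and the random
unit-modulus symbols `s`. -/
def symbolVector (v : Fin K → Fin q → ℝ) (s : Fin K → Fin q → ℂ) (k : Fin K) (m : Fin C.S) :
    Fin C.M → ℂ := fun b =>
  ∑ i : Fin q, ∑ e : Bool,
    if (C.loc (i, e)).1 = m ∧ b.val = (C.loc (i, e)).2.val * (1 + C.Mg) ∧
        v k i = (if e then 1 else -1)
    then s k i else 0

/-- The received baseband block `m`: superposition of the transmitted blocks after circular
convolution with the channel impulse responses `h`, plus the noise `z`. -/
def received (v : Fin K → Fin q → ℝ) (s : Fin K → Fin q → ℂ) (h : Fin K → Fin C.Nd → ℂ)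
    (z : Fin C.S → Fin C.Nd → ℂ) (m : Fin C.S) : Fin C.Nd → ℂ :=
  (∑ k, (Real.sqrt C.Es : ℂ) •
    (Matrix.circulant (h k) *ᵥ (C.chirpMatrix *ᵥ C.symbolVector v s k m))) + z m

/-- The aggregated symbols on the bins at the receiver. -/
def receivedSymbols (r : Fin C.S → Fin C.Nd → ℂ) (m : Fin C.S) : Fin C.M → ℂ :=
  ((dftMatrix C.M)ᴴ * Matrix.diagonal (star C.fdss) * C.mappingMatrixᴴ * dftMatrix C.Nd) *ᵥ r m

/-- The energy in the `1 + M_g` bins of the slot of gradient `i` and vote `e`. -/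
def slotEnergy (d : Fin C.S → Fin C.M → ℂ) (i : Fin q) (e : Bool) : ℝ :=
  ∑ b : Fin C.M,
    if (C.loc (i, e)).2.val * (1 + C.Mg) ≤ b.val ∧
        b.val < ((C.loc (i, e)).2.val + 1) * (1 + C.Mg)
    then ‖d (C.loc (i, e)).1 b‖ ^ 2 else 0

/-- The majority vote obtained by the energy detector from the votes `v`. -/
def majorityVote (v : Fin K → Fin q → ℝ) (s : Fin K → Fin q → ℂ) (h : Fin K → Fin C.Nd → ℂ)
    (z : Fin C.S → Fin C.Nd → ℂ) : EuclideanSpace ℝ (Fin q) :=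
  WithLp.toLp 2 fun i =>
    sgn (C.slotEnergy (C.receivedSymbols (C.received v s h z)) i true
      - C.slotEnergy (C.receivedSymbols (C.received v s h z)) i false)

/-- Everything that is random in one communication round: the data used by each device for its
stochastic gradient, the random unit-modulus symbols, the channel impulse responses, and the
receiver noise. -/
abbrev Round (K : ℕ) (Θ : Type*) : Type _ :=
  (Fin K → Θ) × (Fin K → Fin q → ℂ) × (Fin K → Fin C.Nd → ℂ) × (Fin C.S → Fin C.Nd → ℂ)

/-- The joint law of one round: data independent over the devices with laws `P k`, random symbols
with law `Q`, independent Rayleigh-fading taps with the given power delay profile, and white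
Gaussian noise, all independent of each other. -/
def roundLaw {Θ : Type*} [MeasurableSpace Θ] (P : Fin K → Measure Θ)
    (Q : Measure (Fin K → Fin q → ℂ)) : Measure (C.Round K Θ) :=
  (Measure.pi P).prod (Q.prod
    ((Measure.pi fun _ => Measure.pi fun τ => complexGaussian (C.pdp τ)).prod
      (Measure.pi fun _ => Measure.pi fun _ => complexGaussian C.noiseVar)))

/-- The model parameters along the communication rounds: starting from `w₀`, device `k` votes with
the signs of its local stochastic gradient `G k w θ`, the votes are aggregated over the air, and
the parameters move by the learning rate `η` against the detected majority vote. -/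
def params {Θ : Type*} (G : Fin K → EuclideanSpace ℝ (Fin q) → Θ → EuclideanSpace ℝ (Fin q))
    (η : ℝ) (w₀ : EuclideanSpace ℝ (Fin q)) (x : ℕ → C.Round K Θ) :
    ℕ → EuclideanSpace ℝ (Fin q)
  | 0 => w₀
  | n + 1 =>
    params G η w₀ x n - η •
      C.majorityVote (fun k i => sgn (G k (params G η w₀ x n) ((x n).1 k) i))
        (x n).2.1 (x n).2.2.1 (x n).2.2.2

/-- The effective signal-to-noise ratio `ξ = E_s / ((1 + M_g) σ_n²)`. -/
def effectiveSNR : ℝ := C.Es / ((1 + C.Mg) * C.noiseVar)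

end CSCSystem

end

/-! Smoothness and `v_i ^ 2 = 1` give F(w') ≤ F(w) - η⟨g, v⟩ + η²‖L‖₁/2 in every round. The theorem
therefore rests on one drift estimate, `le_integral_mul_roundVote`: |g_i| - (2√2/3) σ_i/√n_b ≤ (1 +
2/(ξK)) E[g_i v_i]. Summed over coordinates and rounds, and telescoped in F, it yields the claim.

For the drift, fix the number z of correct votes on one gradient. A unitary change of the bins of a
slot diagonalises the channel covariance there. The energy of the correct slot minus that of the
wrong one is then a difference of sums of independent exponentials with means l_j = E_s z a_j + σ_n²
and m_j = E_s (K - z) a_j + σ_n², where a_j ≥ 0 and Σ a_j = 1. The powers a_j depend on the channel,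
but for z ≥ K/2 the error probability is at most Σm / (Σl + Σm) = ((K - z)ξ + 1)/(Kξ + 2) in every
case (`real_Iic_zero_le_of_charFun`). To see this, split each exponential of mean l_j into one of
mean m_j and a non-negative excess. What remains without the excesses is a sum of Laplace variables,
whose tail is at most exp(-x/M)/2 with M = Σm; each excess multiplies this bound by (M + m_j)/(M +
l_j).

For z < K/2 only the symmetry f(z) + f(K - z) ≤ 1 of the error probability f is used. It suffices
because each device is right with probability at least 1/2, so the number of correct votes leans
upwards (`coeff_prod_le_coeff_prod`). Reflected pairs can then be compared, and the mean error is at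
most the mean of the affine bound, ((Σ p_k)ξ + 1)/(Kξ + 2), with p_k the probability that device k
is wrong (`integral_pi_detection_error_le`). A Gauss-type inequality for symmetric unimodal laws
gives 2 p_k |g_i| ≤ (2√2/3) σ_i/√n_b. -/

/-! ### Exponential laws and convolutions -/

/-- The law of `m` times a standard exponential random variable. -/
noncomputable def expoLaw (m : ℝ) : Measure ℝ := expMeasure m⁻¹

lemma isProbabilityMeasure_expoLaw {m : ℝ} (hm : 0 < m) : IsProbabilityMeasure (expoLaw m) :=
  isProbabilityMeasure_expMeasure (inv_pos.2 hm)

lemma integral_expoLaw {E : Type*} [NormedAddCommGroup E] [NormedSpace ℝ E] {m : ℝ} (hm : 0 < m)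
    (f : ℝ → E) :
    ∫ x, f x ∂(expoLaw m) = ∫ x in Set.Ioi 0, (m⁻¹ * Real.exp (-x / m)) • f x := by
  have h : expoLaw m = volume.withDensity
    (fun x => ENNReal.ofReal (exponentialPDFReal m⁻¹ x)) := rfl
  rw [h, integral_withDensity_eq_integral_toReal_smul
    (measurable_exponentialPDFReal m⁻¹).ennreal_ofReal (by simp),
    ← integral_Ici_eq_integral_Ioi, ← integral_indicator measurableSet_Ici]
  congr 1 with x
  by_cases hx : 0 ≤ x
  · have : 0 ≤ m⁻¹ * Real.exp (-(m⁻¹ * x)) := by positivity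
    have h2 := exponentialPDF_of_nonneg (r := m⁻¹) hx
    rw [exponentialPDF] at h2
    rw [Set.indicator_of_mem (by simpa using hx), h2, ENNReal.toReal_ofReal this]
    congr 3; ring
  · have h2 := exponentialPDF_of_neg (r := m⁻¹) (not_le.1 hx)
    rw [exponentialPDF] at h2
    rw [Set.indicator_of_notMem (by simpa using hx), h2]
    simp

lemma noAtoms_expoLaw (m : ℝ) : NullSingletonClass (expoLaw m) := by
  have h : expoLaw m = volume.withDensity (exponentialPDF m⁻¹) := rfl
  rw [h]; infer_instance

lemma expoLaw_real_Iic {m : ℝ} (hm : 0 < m) (x : ℝ) :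
    (expoLaw m).real (Set.Iic x) = if 0 ≤ x then 1 - Real.exp (-x / m) else 0 := by
  have := isProbabilityMeasure_expoLaw hm
  rw [← cdf_eq_real, expoLaw, cdf_expMeasure_eq (inv_pos.2 hm)]
  congr 3; ring_nf

lemma charFun_expoLaw {m : ℝ} (hm : 0 < m) (t : ℝ) :
    charFun (expoLaw m) t = (1 - m * t * Complex.I)⁻¹ := by
  rw [charFun_apply_real, integral_expoLaw hm]
  have hm' : (m : ℂ) ≠ 0 := by exact_mod_cast hm.ne'
  have : ∀ x : ℝ, (m⁻¹ * Real.exp (-x / m)) • Complex.exp (t * x * Complex.I)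
      = (m : ℂ)⁻¹ * Complex.exp ((-1 / m + t * Complex.I) * x) := by
    intro x
    rw [Complex.real_smul]
    push_cast
    rw [mul_assoc, ← Complex.exp_add]
    congr 2; ring
  simp_rw [this]
  have hre : (-1 / (m : ℂ) + t * Complex.I).re < 0 := by
    have : (-1 / (m : ℂ)) = ((-1 / m : ℝ) : ℂ) := by push_cast; rfl
    rw [this]
    simp
    exact div_neg_of_neg_of_pos (by norm_num) hm
  have h1 : (1 - m * t * Complex.I) ≠ 0 := by
    intro h
    have := congrArg Complex.re h
    simp at this
  have h0 : (-1 / (m : ℂ) + t * Complex.I) ≠ 0 := by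
    intro h; rw [h] at hre; simp at hre
  rw [integral_const_mul, integral_exp_mul_complex_Ioi hre]
  simp only [Complex.ofReal_zero, mul_zero, Complex.exp_zero]
  rw [eq_comm, inv_eq_iff_eq_inv, ]
  field_simp
  ring

lemma conv_real_apply (ν ρ : Measure ℝ) [IsProbabilityMeasure ν] [IsProbabilityMeasure ρ]
    {s : Set ℝ} (hs : MeasurableSet s) :
    (ν.conv ρ).real s = ∫ x, ρ.real ((fun y => x + y) ⁻¹' s) ∂ν := by
  rw [← integral_indicator_one hs, integral_conv]
  · congr 1 with x
    rw [← integral_indicator_one (hs.preimage (by fun_prop))]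
    rfl
  · exact (integrable_const (1 : ℝ)).indicator hs

lemma conv_real_apply' (ν ρ : Measure ℝ) [IsProbabilityMeasure ν] [IsProbabilityMeasure ρ]
    {s : Set ℝ} (hs : MeasurableSet s) :
    (ν.conv ρ).real s = ∫ x, ν.real ((fun y => x + y) ⁻¹' s) ∂ρ := by
  rw [Measure.conv_comm, conv_real_apply _ _ hs]

/-- Translates of an atomless law are atomless, so one atomless factor is enough. Ties of the two
energies thereby have probability zero. -/
lemma noAtoms_conv_right (ν ρ : Measure ℝ) [IsProbabilityMeasure ν] [IsProbabilityMeasure ρ]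
    (h : NullSingletonClass ρ) : NullSingletonClass (ν.conv ρ) := by
  constructor
  intro x
  rw [← measureReal_eq_zero_iff, conv_real_apply _ _ (measurableSet_singleton x)]
  have : ∀ z : ℝ, ρ.real ((fun y => z + y) ⁻¹' {x}) = 0 := by
    intro z
    rw [measureReal_eq_zero_iff]
    have : (fun y => z + y) ⁻¹' {x} = {x - z} := by
      ext y; simp only [Set.mem_preimage, Set.mem_singleton_iff]
      constructor <;> intro h <;> linarith
    rw [this]; exact measure_singleton _
  simp only [this, integral_zero]

/-! ### Laplace laws -/

/-- The symmetric Laplace law with scale `b`. -/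
noncomputable def laplaceLaw (b : ℝ) : Measure ℝ :=
  (2⁻¹ : ℝ≥0) • expoLaw b + (2⁻¹ : ℝ≥0) • (expoLaw b).map (fun x => -x)

lemma laplaceLaw_real_apply {b : ℝ} (hb : 0 < b) {s : Set ℝ} (hs : MeasurableSet s) :
    (laplaceLaw b).real s
      = 2⁻¹ * (expoLaw b).real s + 2⁻¹ * (expoLaw b).real ((fun x => -x) ⁻¹' s) := by
  have := isProbabilityMeasure_expoLaw hb
  have := Measure.isProbabilityMeasure_map (μ := expoLaw b) (f := fun x : ℝ => -x) (by fun_prop)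
  rw [laplaceLaw, measureReal_add_apply, measureReal_nnreal_smul_apply,
    measureReal_nnreal_smul_apply, map_measureReal_apply (by fun_prop) hs]
  simp

lemma isProbabilityMeasure_laplaceLaw {b : ℝ} (hb : 0 < b) :
    IsProbabilityMeasure (laplaceLaw b) := by
  have := isProbabilityMeasure_expoLaw hb
  have : IsFiniteMeasure (laplaceLaw b) := by
    unfold laplaceLaw; infer_instance
  have h := laplaceLaw_real_apply hb MeasurableSet.univ
  simp at h
  rw [isProbabilityMeasure_iff_real, h]; norm_num

lemma noAtoms_laplaceLaw {b : ℝ} (hb : 0 < b) : NullSingletonClass (laplaceLaw b) := by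
  have := isProbabilityMeasure_laplaceLaw hb
  have := isProbabilityMeasure_expoLaw hb
  have := noAtoms_expoLaw b
  constructor
  intro x
  rw [← measureReal_eq_zero_iff, laplaceLaw_real_apply hb (measurableSet_singleton x)]
  have : (fun x : ℝ => -x) ⁻¹' {x} = {-x} := by
    ext y; simp only [Set.mem_preimage, Set.mem_singleton_iff]
    constructor <;> intro h <;> linarith
  simp [measureReal_def]

lemma map_neg_laplaceLaw (b : ℝ) : (laplaceLaw b).map (fun x => -x) = laplaceLaw b := by
  rw [laplaceLaw, Measure.map_add _ _ (by fun_prop), Measure.map_smul, Measure.map_smul,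
    Measure.map_map (by fun_prop) (by fun_prop), add_comm]
  simp

lemma charFun_laplaceLaw {b : ℝ} (hb : 0 < b) (t : ℝ) :
    charFun (laplaceLaw b) t = ((1 - b * t * Complex.I) * (1 + b * t * Complex.I))⁻¹ := by
  have := isProbabilityMeasure_expoLaw hb
  have hmap : charFun ((expoLaw b).map (fun x => -x)) t = charFun (expoLaw b) (-t) := by
    have := charFun_map_mul (μ := expoLaw b) (-1) t
    simpa using this
  have hi : ∀ ν : Measure ℝ, IsFiniteMeasure ν →
      Integrable (fun x : ℝ => Complex.exp (t * x * Complex.I)) ν := by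
    intro ν _
    refine (integrable_const (1 : ℝ)).mono' (by fun_prop) (ae_of_all _ fun x => ?_)
    rw [← Complex.ofReal_mul, Complex.norm_exp_ofReal_mul_I]
  have hlin : charFun (laplaceLaw b) t = 2⁻¹ * charFun (expoLaw b) t
      + 2⁻¹ * charFun ((expoLaw b).map (fun x => -x)) t := by
    simp only [charFun_apply_real]
    rw [laplaceLaw, integral_add_measure (hi _ inferInstance) (hi _ inferInstance),
      integral_smul_nnreal_measure, integral_smul_nnreal_measure]
    simp [NNReal.smul_def]
  rw [hlin, hmap, charFun_expoLaw hb, charFun_expoLaw hb]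
  have h1 : (1 - b * t * Complex.I) ≠ 0 := by
    intro h; have := congrArg Complex.re h; simp at this
  have h2 : (1 + b * t * Complex.I) ≠ 0 := by
    intro h; have := congrArg Complex.re h; simp at this
  push_cast
  have h3 : (1 - b * -t * Complex.I) = (1 + b * t * Complex.I) := by ring
  rw [h3]
  field_simp
  ring

lemma laplaceLaw_real_Iic {b : ℝ} (hb : 0 < b) (x : ℝ) :
    (laplaceLaw b).real (Set.Iic x)
      = if x ≤ 0 then 2⁻¹ * Real.exp (x / b) else 1 - 2⁻¹ * Real.exp (-x / b) := by
  have := isProbabilityMeasure_expoLaw hb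
  have := noAtoms_expoLaw b
  have hpre : (fun x : ℝ => -x) ⁻¹' Set.Iic x = Set.Ici (-x) := by
    ext y; simp only [Set.mem_preimage, Set.mem_Iic, Set.mem_Ici]
    constructor <;> intro h <;> linarith
  have hIci : (expoLaw b).real (Set.Ici (-x)) = 1 - (expoLaw b).real (Set.Iic (-x)) := by
    have h1 : (expoLaw b).real (Set.Iic (-x))ᶜ = (expoLaw b).real (Set.Ici (-x)) := by
      rw [Set.compl_Iic]
      exact measureReal_congr Ioi_ae_eq_Ici
    rw [← h1, probReal_compl_eq_one_sub measurableSet_Iic]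
  rw [laplaceLaw_real_apply hb measurableSet_Iic, hpre, hIci, expoLaw_real_Iic hb,
    expoLaw_real_Iic hb]
  rcases lt_trichotomy x 0 with h | h | h
  · simp [h.le, not_le.2 h]
  · subst h; simp
  · simp [h.le, not_le.2 h]; ring

/-- If `|Y|` under `ν` is stochastically dominated by `|Y|` under `ρ`, then bounded functions that
are increasing in `|y|` have the smaller integral under `ν`. -/
lemma integral_le_of_abs_dominated (ν ρ : Measure ℝ) [IsProbabilityMeasure ν]
    [IsProbabilityMeasure ρ] (k : ℝ → ℝ) (hk : Measurable k) (B : ℝ) (hk0 : ∀ y, 0 ≤ k y)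
    (hkB : ∀ y, k y ≤ B) (hmono : ∀ x y, |x| ≤ |y| → k x ≤ k y)
    (hdom : ∀ t, 0 ≤ t → ν.real {y | t ≤ |y|} ≤ ρ.real {y | t < |y|}) :
    ∫ y, k y ∂ν ≤ ∫ y, k y ∂ρ := by
  have hint : ∀ τ : Measure ℝ, IsProbabilityMeasure τ → Integrable k τ := fun τ _ =>
    (integrable_const B).mono' hk.aestronglyMeasurable
      (ae_of_all _ fun y => by rw [Real.norm_of_nonneg (hk0 y)]; exact hkB y)
  have hlint : ∀ τ : Measure ℝ, IsProbabilityMeasure τ →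
      ∫ y, k y ∂τ = (∫⁻ t in Set.Ioi (0 : ℝ), τ {y | t < k y}).toReal := by
    intro τ _
    rw [integral_eq_lintegral_of_nonneg_ae (ae_of_all _ hk0) hk.aestronglyMeasurable,
      lintegral_eq_lintegral_meas_lt τ (ae_of_all _ hk0) hk.aemeasurable]
  have hfin : ∫⁻ t in Set.Ioi (0 : ℝ), ρ {y | t < k y} ≠ ⊤ := by
    rw [← lintegral_eq_lintegral_meas_lt ρ (ae_of_all _ hk0) hk.aemeasurable]
    have := (hint ρ inferInstance).lintegral_lt_top
    exact this.ne
  rw [hlint ν inferInstance, hlint ρ inferInstance]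
  refine ENNReal.toReal_mono hfin (lintegral_mono fun s => ?_)
  rcases Set.eq_empty_or_nonempty {y | s < k y} with he | ⟨y₀, hy₀⟩
  · rw [he]; simp
  have hne : ((fun y : ℝ => |y|) '' {y | s < k y}).Nonempty := ⟨_, y₀, hy₀, rfl⟩
  have hbdd : BddBelow ((fun y : ℝ => |y|) '' {y | s < k y}) :=
    ⟨0, by rintro _ ⟨y, -, rfl⟩; exact abs_nonneg y⟩
  -- A superlevel set of `k` is a set `t ≤ |y|` or `t < |y|`, and which of the two is unknown. This
  -- is why `hdom` compares a closed tail with an open one.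
  set t := sInf ((fun y : ℝ => |y|) '' {y | s < k y})
  have ht : 0 ≤ t := le_csInf hne (by rintro _ ⟨y, -, rfl⟩; exact abs_nonneg y)
  have h1 : {y | s < k y} ⊆ {y | t ≤ |y|} := fun y hy => csInf_le hbdd ⟨y, hy, rfl⟩
  have h2 : {y | t < |y|} ⊆ {y | s < k y} := by
    intro y hy
    obtain ⟨_, ⟨z, hz, rfl⟩, hzy⟩ := exists_lt_of_csInf_lt hne hy
    exact lt_of_lt_of_le hz (hmono _ _ hzy.le)
  calc ν {y | s < k y} ≤ ν {y | t ≤ |y|} := measure_mono h1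
    _ ≤ ρ {y | t < |y|} := by
        have := hdom t ht
        rw [measureReal_def, measureReal_def,
          ENNReal.toReal_le_toReal (measure_ne_top _ _) (measure_ne_top _ _)] at this
        exact this
    _ ≤ ρ {y | s < k y} := measure_mono h2

/-! ### Tails of sums of Laplace variables -/

/-- Symmetric atomless probability laws on `ℝ` whose tail is at most that of the Laplace law with
scale `M`. -/
structure SymmetricTailBound (ν : Measure ℝ) (M : ℝ) : Prop where
  prob : IsProbabilityMeasure ν
  noAtoms : NullSingletonClass ν
  symm : ν.map (fun x => -x) = ν
  tail : ∀ x, 0 ≤ x → ν.real (Set.Iic (-x)) ≤ 2⁻¹ * Real.exp (-x / M)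

lemma real_abs_ge_of_symm (ν : Measure ℝ) [IsProbabilityMeasure ν]
    (hs : ν.map (fun x => -x) = ν) {t : ℝ} (ht : 0 < t) :
    ν.real {y | t ≤ |y|} = 2 * ν.real (Set.Iic (-t)) := by
  have h1 : {y : ℝ | t ≤ |y|} = Set.Iic (-t) ∪ Set.Ici t := by
    ext y; simp only [Set.mem_ofPred_eq, Set.mem_union, Set.mem_Iic, Set.mem_Ici, le_abs]
    constructor <;> rintro (h | h) <;> first | (left; linarith) | (right; linarith)
  have h2 : ν.real (Set.Ici t) = ν.real (Set.Iic (-t)) := by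
    conv_lhs => rw [← hs]
    rw [map_measureReal_apply (by fun_prop) measurableSet_Ici]
    congr 1; ext y; simp only [Set.mem_preimage, Set.mem_Iic, Set.mem_Ici]
    constructor <;> intro h <;> linarith
  rw [h1, measureReal_union _ measurableSet_Ici, h2]
  · ring
  · rw [Set.disjoint_left]; intro y hy hy'
    simp only [Set.mem_Iic, Set.mem_Ici] at hy hy'; linarith

lemma symmetricTailBound_laplaceLaw {b : ℝ} (hb : 0 < b) :
    SymmetricTailBound (laplaceLaw b) b where
  prob := isProbabilityMeasure_laplaceLaw hb
  noAtoms := noAtoms_laplaceLaw hb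
  symm := map_neg_laplaceLaw b
  tail x hx := by rw [laplaceLaw_real_Iic hb, if_pos (by linarith)]

lemma laplaceLaw_real_abs_gt {a : ℝ} (ha : 0 < a) {t : ℝ} (ht : 0 ≤ t) :
    (laplaceLaw a).real {y | t < |y|} = Real.exp (-t / a) := by
  have := isProbabilityMeasure_laplaceLaw ha
  have := noAtoms_laplaceLaw ha
  have h0 : (laplaceLaw a).real {y | t < |y|} = (laplaceLaw a).real {y | t ≤ |y|} := by
    refine measureReal_congr ?_
    have : ∀ᵐ y ∂(laplaceLaw a), y ≠ t ∧ y ≠ -t := by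
      refine (ae_iff.2 ?_ : ∀ᵐ y ∂(laplaceLaw a), y ≠ t).and
        (ae_iff.2 ?_ : ∀ᵐ y ∂(laplaceLaw a), y ≠ -t) <;> simp
    filter_upwards [this] with y hy
    refine propext ⟨fun h => le_of_lt h, fun h => lt_of_le_of_ne h ?_⟩
    rintro h'
    rcases abs_choice y with h2 | h2
    · exact hy.1 (by rw [h', h2])
    · exact hy.2 (by rw [h', h2]; ring)
  rw [h0]
  rcases ht.eq_or_lt with h | h
  · subst h; simp
  · rw [real_abs_ge_of_symm _ (map_neg_laplaceLaw a) h, laplaceLaw_real_Iic ha,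
      if_pos (by linarith)]
    ring

/-- The kernel `P(x + Y ≤ -y) + P(x + Y ≤ y)` for a Laplace variable `Y`. -/
noncomputable def laplaceKernel (b x y : ℝ) : ℝ :=
  (laplaceLaw b).real (Set.Iic (-x - y)) + (laplaceLaw b).real (Set.Iic (-x + y))

/-- For 0 ≤ y ≤ x the kernel is exp(-x/b) cosh(y/b), and for y ≥ x it is 1 - exp(-y/b) sinh(x/b);
both increase in y. -/
lemma laplaceKernel_mono {b x : ℝ} (hb : 0 < b) (hx : 0 ≤ x) {y z : ℝ} (hyz : |y| ≤ |z|) :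
    laplaceKernel b x y ≤ laplaceKernel b x z := by
  have habs : ∀ y, laplaceKernel b x y = laplaceKernel b x |y| := by
    intro y
    rcases abs_choice y with h | h
    · rw [h]
    · rw [h]; simp only [laplaceKernel, sub_neg_eq_add]; rw [add_comm, sub_eq_add_neg]
  rw [habs y, habs z]
  generalize |y| = y, |z| = z, abs_nonneg y = hy at *
  have hz : 0 ≤ z := hy.trans hyz
  have hlow : ∀ w, 0 ≤ w → w ≤ x → laplaceKernel b x w
      = Real.exp (-x / b) * Real.cosh (w / b) := by
    intro w hw hwx
    rw [laplaceKernel, laplaceLaw_real_Iic hb, laplaceLaw_real_Iic hb, if_pos (by linarith),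
      if_pos (by linarith), Real.cosh_eq, sub_div, add_div, sub_eq_add_neg, Real.exp_add,
      Real.exp_add]
    ring
  have hhigh : ∀ w, x ≤ w → laplaceKernel b x w
      = 1 - Real.exp (-w / b) * Real.sinh (x / b) := by
    intro w hw
    have h1 : (laplaceLaw b).real (Set.Iic (-x + w)) = 1 - 2⁻¹ * Real.exp (-(-x + w) / b) := by
      rw [laplaceLaw_real_Iic hb]
      split_ifs with h
      · have : -x + w = 0 := by linarith
        rw [this]; norm_num
      · rfl
    rw [laplaceKernel, h1, laplaceLaw_real_Iic hb, if_pos (by linarith), Real.sinh_eq]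
    have e1 : (-x - w) / b = -w / b + -(x / b) := by ring
    have e2 : -(-x + w) / b = -w / b + x / b := by ring
    rw [e1, e2, Real.exp_add, Real.exp_add]
    ring
  have mlow : ∀ v w, 0 ≤ v → v ≤ w → w ≤ x → laplaceKernel b x v ≤ laplaceKernel b x w := by
    intro v w hv hvw hwx
    rw [hlow v hv (hvw.trans hwx), hlow w (hv.trans hvw) hwx]
    refine mul_le_mul_of_nonneg_left (Real.cosh_le_cosh.2 ?_) (Real.exp_nonneg _)
    rw [abs_of_nonneg (by positivity), abs_of_nonneg (div_nonneg (hv.trans hvw) hb.le)]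
    gcongr
  have mhigh : ∀ v w, x ≤ v → v ≤ w → laplaceKernel b x v ≤ laplaceKernel b x w := by
    intro v w hv hvw
    rw [hhigh v hv, hhigh w (hv.trans hvw)]
    have : 0 ≤ Real.sinh (x / b) := Real.sinh_nonneg_iff.2 (by positivity)
    gcongr
  rcases le_total z x with h | h
  · exact mlow _ _ hy hyz h
  · rcases le_total y x with h' | h'
    · exact (mlow _ _ hy h' le_rfl).trans (mhigh _ _ le_rfl h)
    · exact mhigh _ _ h' hyz

/-- Averaging the integrand over y and -y, which the symmetry of `ν` allows, makes it a function of
|y|. Only then can stochastic domination of |y| be applied. -/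
lemma conv_laplaceLaw_real_Iic (ν : Measure ℝ) [IsProbabilityMeasure ν]
    (hs : ν.map (fun x => -x) = ν) {b : ℝ} (hb : 0 < b) (x : ℝ) :
    (ν.conv (laplaceLaw b)).real (Set.Iic (-x)) = 2⁻¹ * ∫ y, laplaceKernel b x y ∂ν := by
  have := isProbabilityMeasure_laplaceLaw hb
  have hmeas : Measurable fun y : ℝ => (laplaceLaw b).real (Set.Iic (-x - y)) := by
    simp_rw [laplaceLaw_real_Iic hb]
    exact Measurable.ite (measurableSet_le (by fun_prop) (by fun_prop)) (by fun_prop)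
      (by fun_prop)
  have hmeas' : Measurable fun y : ℝ => (laplaceLaw b).real (Set.Iic (-x + y)) := by
    simp_rw [laplaceLaw_real_Iic hb]
    exact Measurable.ite (measurableSet_le (by fun_prop) (by fun_prop)) (by fun_prop)
      (by fun_prop)
  have h1 : (ν.conv (laplaceLaw b)).real (Set.Iic (-x))
      = ∫ y, (laplaceLaw b).real (Set.Iic (-x - y)) ∂ν := by
    rw [conv_real_apply _ _ measurableSet_Iic]
    congr 1 with y
    congr 1; ext z; simp only [Set.mem_preimage, Set.mem_Iic]
    constructor <;> intro h <;> linarith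
  have h2 : ∫ y, (laplaceLaw b).real (Set.Iic (-x - y)) ∂ν
      = ∫ y, (laplaceLaw b).real (Set.Iic (-x + y)) ∂ν := by
    conv_lhs => rw [← hs]
    rw [integral_map (by fun_prop) hmeas.aestronglyMeasurable]
    simp [sub_neg_eq_add]
  have hi : ∀ f : ℝ → ℝ, Measurable f → (∀ y, 0 ≤ f y ∧ f y ≤ 1) → Integrable f ν := by
    intro f hf h
    refine (integrable_const (1 : ℝ)).mono' hf.aestronglyMeasurable (ae_of_all _ fun y => ?_)
    rw [Real.norm_of_nonneg (h y).1]; exact (h y).2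
  unfold laplaceKernel
  rw [integral_add (hi _ hmeas fun y => ⟨measureReal_nonneg, measureReal_le_one⟩)
    (hi _ hmeas' fun y => ⟨measureReal_nonneg, measureReal_le_one⟩), ← h2, h1]
  ring

lemma charFun_inv_ne {b t : ℝ} :
    (1 - b * t * Complex.I) ≠ 0 ∧ (1 + b * t * Complex.I) ≠ 0 := by
  constructor <;> intro h <;> have := congrArg Complex.re h <;> simp at this

/-- Partial fractions: the characteristic functions are 1/(1 + a²t²) and 1/(1 + b²t²), and a²/(1 +
a²t²) - b²/(1 + b²t²) = (a² - b²)/((1 + a²t²)(1 + b²t²)). -/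
lemma laplaceLaw_conv_real_Iic {a b : ℝ} (ha : 0 < a) (hb : 0 < b) (x : ℝ) :
    a ^ 2 * (laplaceLaw a).real (Set.Iic x) - b ^ 2 * (laplaceLaw b).real (Set.Iic x)
      = (a ^ 2 - b ^ 2) * ((laplaceLaw a).conv (laplaceLaw b)).real (Set.Iic x) := by
  wlog hab : b ≤ a generalizing a b
  · have := this hb ha (le_of_not_ge hab)
    have := isProbabilityMeasure_laplaceLaw ha
    have := isProbabilityMeasure_laplaceLaw hb
    rw [Measure.conv_comm]; linarith
  have := isProbabilityMeasure_laplaceLaw ha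
  have := isProbabilityMeasure_laplaceLaw hb
  have hd : 0 ≤ a ^ 2 - b ^ 2 := by nlinarith
  have hi : ∀ (ν : Measure ℝ) (t : ℝ), IsFiniteMeasure ν →
      Integrable (fun x : ℝ => Complex.exp (t * x * Complex.I)) ν := by
    intro ν t _
    refine (integrable_const (1 : ℝ)).mono' (by fun_prop) (ae_of_all _ fun x => ?_)
    rw [← Complex.ofReal_mul, Complex.norm_exp_ofReal_mul_I]
  obtain ⟨d, hd'⟩ : ∃ d : ℝ≥0, (d : ℝ) = a ^ 2 - b ^ 2 := ⟨⟨_, hd⟩, rfl⟩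
  obtain ⟨a2, ha2⟩ : ∃ d : ℝ≥0, (d : ℝ) = a ^ 2 := ⟨⟨_, sq_nonneg a⟩, rfl⟩
  obtain ⟨b2, hb2⟩ : ∃ d : ℝ≥0, (d : ℝ) = b ^ 2 := ⟨⟨_, sq_nonneg b⟩, rfl⟩
  -- The negative term is moved to the left, so that both sides are positive measures and uniqueness
  -- of characteristic functions applies.
  have key : d • ((laplaceLaw a).conv (laplaceLaw b))
      + b2 • laplaceLaw b
      = a2 • laplaceLaw a := by
    apply Measure.ext_of_charFun
    ext t
    have e : ∀ (u : ℝ≥0) (ν : Measure ℝ), charFun (u • ν) t = u * charFun ν t := by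
      intro u ν
      simp only [charFun_apply_real, integral_smul_nnreal_measure]
      rfl
    have e2 : ∀ (ν ρ : Measure ℝ), IsFiniteMeasure ν → IsFiniteMeasure ρ →
        charFun (ν + ρ) t = charFun ν t + charFun ρ t := by
      intro ν ρ _ _
      simp only [charFun_apply_real]
      exact integral_add_measure (hi _ _ inferInstance) (hi _ _ inferInstance)
    rw [e2 _ _ inferInstance inferInstance, e, e, e, charFun_conv, charFun_laplaceLaw ha,
      charFun_laplaceLaw hb]
    obtain ⟨h1, h2⟩ := charFun_inv_ne (b := a) (t := t)
    obtain ⟨h3, h4⟩ := charFun_inv_ne (b := b) (t := t)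
    have c1 : ((d : ℝ) : ℂ) = (a : ℂ) ^ 2 - (b : ℂ) ^ 2 := by rw [hd']; push_cast; rfl
    have c2 : ((a2 : ℝ) : ℂ) = (a : ℂ) ^ 2 := by rw [ha2]; push_cast; rfl
    have c3 : ((b2 : ℝ) : ℂ) = (b : ℂ) ^ 2 := by rw [hb2]; push_cast; rfl
    rw [c1, c2, c3]
    field_simp
    ring_nf
  have := congrArg (fun ν : Measure ℝ => ν.real (Set.Iic x)) key
  have hp : IsProbabilityMeasure ((laplaceLaw a).conv (laplaceLaw b)) := inferInstance
  generalize (laplaceLaw a).conv (laplaceLaw b) = τ at *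
  rw [measureReal_add_apply, measureReal_nnreal_smul_apply, measureReal_nnreal_smul_apply,
    measureReal_nnreal_smul_apply] at this
  rw [hd', ha2, hb2] at this
  linarith

/-- The comparison of the two-term Laplace tail with the exponential tail. -/
lemma sq_mul_exp_sub_le {a b x : ℝ} (ha : 0 < a) (hb : 0 < b) (hab : b < a) (hx : 0 ≤ x) :
    a ^ 2 * Real.exp (-x / a) - b ^ 2 * Real.exp (-x / b)
      ≤ (a ^ 2 - b ^ 2) * Real.exp (-x / (a + b)) := by
  -- With this scaling 1/a and 1/b exceed 1/(a + b) by b² and a² times the common factor 1/(ab(a +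
  -- b)). Once exp(-x/(a + b)) is divided out, convexity of exp between -a²y and 0 with weight b²/a²
  -- is all that is needed.
  set y := x / (a * b * (a + b)) with hy
  have hy0 : 0 ≤ y := by positivity
  have e1 : -x / a = -x / (a + b) + -(b ^ 2 * y) := by rw [hy]; field_simp; ring
  have e2 : -x / b = -x / (a + b) + -(a ^ 2 * y) := by rw [hy]; field_simp; ring
  rw [e1, e2, Real.exp_add, Real.exp_add]
  have hE := Real.exp_pos (-x / (a + b))
  suffices h : a ^ 2 * Real.exp (-(b ^ 2 * y)) - b ^ 2 * Real.exp (-(a ^ 2 * y)) ≤ a ^ 2 - b ^ 2 by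
    nlinarith
  have hconv : Real.exp ((b ^ 2 / a ^ 2) • (-(a ^ 2 * y)) + (1 - b ^ 2 / a ^ 2) • 0)
      ≤ (b ^ 2 / a ^ 2) • Real.exp (-(a ^ 2 * y)) + (1 - b ^ 2 / a ^ 2) • Real.exp 0 := by
    refine convexOn_exp.2 (Set.mem_univ _) (Set.mem_univ _) (by positivity) ?_ (by ring)
    rw [sub_nonneg, div_le_one (by positivity)]; nlinarith
  have e3 : (b ^ 2 / a ^ 2) • (-(a ^ 2 * y)) + (1 - b ^ 2 / a ^ 2) • (0 : ℝ) = -(b ^ 2 * y) := by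
    simp only [smul_eq_mul]; field_simp; ring
  rw [e3] at hconv
  simp only [smul_eq_mul, Real.exp_zero, mul_one] at hconv
  have := mul_le_mul_of_nonneg_left hconv (sq_nonneg a)
  have e4 : a ^ 2 * (b ^ 2 / a ^ 2 * Real.exp (-(a ^ 2 * y)) + (1 - b ^ 2 / a ^ 2))
      = b ^ 2 * Real.exp (-(a ^ 2 * y)) + (a ^ 2 - b ^ 2) := by field_simp
  linarith

lemma laplaceLaw_conv_tail {a b x : ℝ} (ha : 0 < a) (hb : 0 < b) (hab : a ≠ b) (hx : 0 ≤ x) :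
    ((laplaceLaw a).conv (laplaceLaw b)).real (Set.Iic (-x)) ≤ 2⁻¹ * Real.exp (-x / (a + b)) := by
  wlog h : b < a generalizing a b
  · have h1 := this hb ha hab.symm (lt_of_le_of_ne (le_of_not_gt h) hab)
    have := isProbabilityMeasure_laplaceLaw ha
    have := isProbabilityMeasure_laplaceLaw hb
    rw [Measure.conv_comm, add_comm a b]; exact h1
  have h1 := laplaceLaw_conv_real_Iic ha hb (-x)
  rw [laplaceLaw_real_Iic ha, laplaceLaw_real_Iic hb, if_pos (by linarith),
    if_pos (by linarith)] at h1
  have h2 := sq_mul_exp_sub_le ha hb h hx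
  have hd : 0 < a ^ 2 - b ^ 2 := by nlinarith
  refine le_of_mul_le_mul_left (a := a ^ 2 - b ^ 2) ?_ hd
  linarith

/-- The tail bound says that |Y| under `ν` is dominated by |Y| under the Laplace law of scale `a`.
Since the kernel increases in |y|, `ν` can be replaced by that law, for which the partial fractions
give the tail. -/
lemma SymmetricTailBound.conv_tail_of_ne {ν : Measure ℝ} {a b : ℝ} (h : SymmetricTailBound ν a)
    (ha : 0 < a) (hb : 0 < b) (hab : a ≠ b) {x : ℝ} (hx : 0 ≤ x) :
    (ν.conv (laplaceLaw b)).real (Set.Iic (-x)) ≤ 2⁻¹ * Real.exp (-x / (a + b)) := by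
  have := h.prob
  have := isProbabilityMeasure_laplaceLaw ha
  have := isProbabilityMeasure_laplaceLaw hb
  refine le_trans ?_ (laplaceLaw_conv_tail ha hb hab hx)
  rw [conv_laplaceLaw_real_Iic ν h.symm hb, conv_laplaceLaw_real_Iic _ (map_neg_laplaceLaw a) hb]
  refine mul_le_mul_of_nonneg_left ?_ (by norm_num)
  refine integral_le_of_abs_dominated _ _ _ ?_ 2 (fun y => ?_) (fun y => ?_)
    (fun y z hyz => laplaceKernel_mono hb hx hyz) (fun t ht => ?_)
  · unfold laplaceKernel
    simp_rw [laplaceLaw_real_Iic hb]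
    exact (Measurable.ite (measurableSet_le (by fun_prop) (by fun_prop)) (by fun_prop)
      (by fun_prop)).add (Measurable.ite (measurableSet_le (by fun_prop) (by fun_prop))
      (by fun_prop) (by fun_prop))
  · exact add_nonneg measureReal_nonneg measureReal_nonneg
  · have h1 : (laplaceLaw b).real (Set.Iic (-x - y)) ≤ 1 := measureReal_le_one
    have h2 : (laplaceLaw b).real (Set.Iic (-x + y)) ≤ 1 := measureReal_le_one
    unfold laplaceKernel; linarith
  · rw [laplaceLaw_real_abs_gt ha ht]
    rcases ht.eq_or_lt with h0 | h0
    · subst h0; simp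
    · rw [real_abs_ge_of_symm ν h.symm h0]
      have := h.tail t ht; linarith

/-- Scales add under convolution. Equal scales, where the partial fractions degenerate, are reached
as a limit: the tail bound at `a` implies the one at every c > a, and c decreases to `a`. -/
lemma SymmetricTailBound.conv_laplaceLaw {ν : Measure ℝ} {a b : ℝ} (h : SymmetricTailBound ν a)
    (ha : 0 < a) (hb : 0 < b) : SymmetricTailBound (ν.conv (laplaceLaw b)) (a + b) where
  prob := by
    have := h.prob; have := isProbabilityMeasure_laplaceLaw hb; infer_instance
  noAtoms := by
    have := h.prob; have := isProbabilityMeasure_laplaceLaw hb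
    exact noAtoms_conv_right _ _ (noAtoms_laplaceLaw hb)
  symm := by
    have := h.prob; have := isProbabilityMeasure_laplaceLaw hb
    have e := Measure.map_conv_continuousLinearMap (μ := ν) (ν := laplaceLaw b)
      (-ContinuousLinearMap.id ℝ ℝ)
    have e' : (⇑(-ContinuousLinearMap.id ℝ ℝ) : ℝ → ℝ) = fun x => -x := by ext; simp
    rw [e', h.symm, map_neg_laplaceLaw] at e
    exact e
  tail x hx := by
    have hlim : Filter.Tendsto (fun c : ℝ => 2⁻¹ * Real.exp (-x / (c + b)))
        (nhdsWithin a (Set.Ioi a)) (nhds (2⁻¹ * Real.exp (-x / (a + b)))) := by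
      have : ContinuousAt (fun c : ℝ => 2⁻¹ * Real.exp (-x / (c + b))) a := by
        refine ContinuousAt.mul continuousAt_const (Real.continuous_exp.continuousAt.comp ?_)
        exact ContinuousAt.div continuousAt_const (by fun_prop) (by positivity)
      exact this.tendsto.mono_left nhdsWithin_le_nhds
    refine ge_of_tendsto hlim ?_
    have hne : ∀ᶠ c in nhdsWithin a (Set.Ioi a), c ≠ b := by
      rcases eq_or_ne a b with e | e
      · filter_upwards [self_mem_nhdsWithin] with c hc
        rw [← e]; exact (ne_of_gt hc)
      · exact nhdsWithin_le_nhds (isOpen_ne.mem_nhds e)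
    filter_upwards [self_mem_nhdsWithin, hne] with c hc hcb
    have hca : a < c := hc
    refine SymmetricTailBound.conv_tail_of_ne (a := c) ⟨h.prob, h.noAtoms, h.symm, ?_⟩
      (ha.trans hca) hb hcb hx
    intro y hy
    refine (h.tail y hy).trans ?_
    have : -y / a ≤ -y / c := by
      rw [neg_div, neg_div, neg_le_neg_iff]; gcongr
    gcongr

/-! ### The sign of a difference of sums of exponentials -/

/-- The mixture of a point mass at `0` and an exponential law whose convolution with the law of
mean `a` is the exponential law of mean `l`. -/
noncomputable def expoExcess (a l : ℝ) : Measure ℝ :=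
  (a / l).toNNReal • Measure.dirac 0 + (1 - a / l).toNNReal • expoLaw l

lemma isProbabilityMeasure_expoExcess {a l : ℝ} (ha : 0 < a) (hal : a ≤ l) :
    IsProbabilityMeasure (expoExcess a l) := by
  have hl := ha.trans_le hal
  have := isProbabilityMeasure_expoLaw hl
  have h1 : a / l ≤ 1 := (div_le_one hl).2 hal
  have h0 : 0 ≤ a / l := by positivity
  rw [isProbabilityMeasure_iff_real, expoExcess, measureReal_add_apply,
    measureReal_nnreal_smul_apply, measureReal_nnreal_smul_apply, Real.coe_toNNReal _ h0,
    Real.coe_toNNReal _ (by linarith)]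
  simp

lemma integral_expoExcess {E : Type*} [NormedAddCommGroup E] [NormedSpace ℝ E] [CompleteSpace E]
    {a l : ℝ} (ha : 0 < a) (hal : a ≤ l) (f : ℝ → E) (hfm : StronglyMeasurable f) (B : ℝ) (hB : ∀ x, ‖f x‖ ≤ B) :
    ∫ x, f x ∂(expoExcess a l) = (a / l) • f 0 + (1 - a / l) • ∫ x, f x ∂(expoLaw l) := by
  have hl := ha.trans_le hal
  have := isProbabilityMeasure_expoLaw hl
  have h1 : a / l ≤ 1 := (div_le_one hl).2 hal
  have h0 : 0 ≤ a / l := by positivity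
  have hi : ∀ ν : Measure ℝ, IsFiniteMeasure ν → Integrable f ν := fun ν _ =>
    (integrable_const B).mono' hfm.aestronglyMeasurable (ae_of_all _ hB)
  rw [expoExcess, integral_add_measure (hi _ inferInstance) (hi _ inferInstance),
    integral_smul_nnreal_measure, integral_smul_nnreal_measure, integral_dirac,
    NNReal.smul_def, NNReal.smul_def, Real.coe_toNNReal _ h0, Real.coe_toNNReal _ (by linarith)]

lemma charFun_expoExcess {a l : ℝ} (ha : 0 < a) (hal : a ≤ l) (t : ℝ) :
    charFun (expoExcess a l) t = (1 - a * t * Complex.I) * (1 - l * t * Complex.I)⁻¹ := by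
  have hl := ha.trans_le hal
  have hn : ∀ x : ℝ, ‖Complex.exp (t * x * Complex.I)‖ = 1 := fun x => by
    rw [← Complex.ofReal_mul, Complex.norm_exp_ofReal_mul_I]
  rw [charFun_apply_real, integral_expoExcess ha hal _
    (Continuous.stronglyMeasurable (by fun_prop)) 1 (fun x => (hn x).le), ← charFun_apply_real,
    charFun_expoLaw hl, Complex.real_smul, Complex.real_smul]
  obtain ⟨h1, -⟩ := charFun_inv_ne (b := l) (t := t)
  have hl' : (l : ℂ) ≠ 0 := by exact_mod_cast hl.ne'
  push_cast
  simp only [mul_zero, zero_mul, Complex.exp_zero]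
  field_simp
  ring

lemma integral_exp_neg_div_expoLaw {l C : ℝ} (hl : 0 < l) (hC : 0 < C) :
    IntegrableOn (fun x => (l⁻¹ * Real.exp (-x / l)) • Real.exp (-x / C)) (Set.Ioi 0) ∧
    ∫ x in Set.Ioi 0, (l⁻¹ * Real.exp (-x / l)) • Real.exp (-x / C) = C / (C + l) := by
  have e : ∀ x : ℝ, (l⁻¹ * Real.exp (-x / l)) • Real.exp (-x / C)
      = l⁻¹ * Real.exp (-(l⁻¹ + C⁻¹) * x) := by
    intro x
    rw [smul_eq_mul, mul_assoc, ← Real.exp_add]; congr 2; field_simp; ring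
  have hneg : -(l⁻¹ + C⁻¹) < 0 := by
    have : 0 < l⁻¹ + C⁻¹ := by positivity
    linarith
  simp_rw [e]
  refine ⟨(integrableOn_exp_mul_Ioi hneg 0).const_mul _, ?_⟩
  rw [integral_const_mul, integral_exp_mul_Ioi hneg]
  simp only [mul_zero, Real.exp_zero]
  field_simp

/-- The bound A exp(-x/C) is averaged over the excess: the point mass leaves it unchanged, the
exponential part multiplies it by C/(C + l), and a/l + (1 - a/l) C/(C + l) = (C + a)/(C + l). -/
lemma conv_expoExcess_tail (ν : Measure ℝ) [IsProbabilityMeasure ν] {a l C A : ℝ} (ha : 0 < a)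
    (hal : a ≤ l) (hC : 0 < C)
    (h : ∀ x, 0 ≤ x → ν.real (Set.Iic (-x)) ≤ A * Real.exp (-x / C)) {x : ℝ} (hx : 0 ≤ x) :
    (ν.conv (expoExcess a l)).real (Set.Iic (-x))
      ≤ A * ((C + a) / (C + l)) * Real.exp (-x / C) := by
  have hl := ha.trans_le hal
  have := isProbabilityMeasure_expoLaw hl
  have := isProbabilityMeasure_expoExcess ha hal
  have h1 : a / l ≤ 1 := (div_le_one hl).2 hal
  have h0 : 0 ≤ a / l := by positivity
  have hpre : ∀ y : ℝ, (fun z => y + z) ⁻¹' Set.Iic (-x) = Set.Iic (-(x + y)) := by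
    intro y; ext z; simp only [Set.mem_preimage, Set.mem_Iic]
    constructor <;> intro h <;> linarith
  have hanti : Antitone fun y : ℝ => ν.real (Set.Iic (-(x + y))) := by
    intro y z hyz
    exact measureReal_mono (Set.Iic_subset_Iic.2 (by linarith)) (by finiteness)
  have hmeas := hanti.measurable
  rw [conv_real_apply' _ _ measurableSet_Iic]
  simp_rw [hpre]
  rw [integral_expoExcess ha hal _ hmeas.stronglyMeasurable 1
    (fun y => by rw [Real.norm_of_nonneg measureReal_nonneg]; exact measureReal_le_one)]
  simp only [add_zero, smul_eq_mul]
  have hint : ∫ y, ν.real (Set.Iic (-(x + y))) ∂(expoLaw l)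
      ≤ A * Real.exp (-x / C) * (C / (C + l)) := by
    obtain ⟨hI, hE⟩ := integral_exp_neg_div_expoLaw hl hC
    rw [integral_expoLaw hl, ← hE, ← integral_const_mul]
    refine integral_mono_of_nonneg (ae_of_all _ fun y => ?_) (hI.const_mul _) ?_
    · simp only [smul_eq_mul]; positivity
    · filter_upwards [ae_restrict_mem measurableSet_Ioi] with y hy
      have hy' : 0 < y := hy
      have := h (x + y) (by linarith)
      have e : -(x + y) / C = -x / C + -y / C := by ring
      rw [e, Real.exp_add] at this
      have hp : 0 ≤ l⁻¹ * Real.exp (-y / l) := by positivity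
      simp only [smul_eq_mul]
      nlinarith [mul_le_mul_of_nonneg_left this hp]
  have h2 := h x hx
  have h3 : A * ((C + a) / (C + l)) * Real.exp (-x / C)
      = a / l * (A * Real.exp (-x / C))
        + (1 - a / l) * (A * Real.exp (-x / C) * (C / (C + l))) := by
    field_simp; ring
  rw [h3]
  exact add_le_add (mul_le_mul_of_nonneg_left h2 h0)
    (mul_le_mul_of_nonneg_left hint (by linarith))

/-- The sum of independent Laplace variables is built as an iterated convolution and is remembered
only through its characteristic function, by which it is identified later. -/
lemma exists_symmetricTailBound {ι : Type*} [DecidableEq ι] (s : Finset ι) (hs : s.Nonempty)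
    (m : ι → ℝ) (hm : ∀ i ∈ s, 0 < m i) :
    ∃ ν : Measure ℝ, SymmetricTailBound ν (∑ i ∈ s, m i) ∧
      ∀ t, charFun ν t = ∏ i ∈ s, ((1 - m i * t * Complex.I) * (1 + m i * t * Complex.I))⁻¹ := by
  induction hs using Finset.Nonempty.cons_induction with
  | singleton i =>
    exact ⟨laplaceLaw (m i), by simpa using symmetricTailBound_laplaceLaw (hm i (by simp)),
      fun t => by simpa using charFun_laplaceLaw (hm i (by simp)) t⟩
  | cons i s hi hs ih =>
    obtain ⟨ν, h1, h2⟩ := ih fun j hj => hm j (by simp [hj])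
    have hmi := hm i (by simp)
    have := h1.prob
    have := isProbabilityMeasure_laplaceLaw hmi
    refine ⟨ν.conv (laplaceLaw (m i)), ?_, fun t => ?_⟩
    · rw [Finset.sum_cons, add_comm]
      exact h1.conv_laplaceLaw (Finset.sum_pos (fun j hj => hm j (by simp [hj])) hs) hmi
    · rw [charFun_conv, h2, charFun_laplaceLaw hmi, Finset.prod_cons, mul_comm]

lemma exists_conv_expoExcess_tail {ι : Type*} [DecidableEq ι] (s : Finset ι) (l m : ι → ℝ)
    (hm : ∀ i ∈ s, 0 < m i) (hml : ∀ i ∈ s, m i ≤ l i) {C : ℝ} (hC : 0 < C)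
    (ν : Measure ℝ) (hν : SymmetricTailBound ν C) :
    ∃ ρ : Measure ℝ, IsProbabilityMeasure ρ ∧ NullSingletonClass ρ ∧
      (∀ t, charFun ρ t = charFun ν t *
        ∏ i ∈ s, ((1 - m i * t * Complex.I) * (1 - l i * t * Complex.I)⁻¹)) ∧
      ∀ x, 0 ≤ x → ρ.real (Set.Iic (-x))
        ≤ 2⁻¹ * (∏ i ∈ s, (C + m i) / (C + l i)) * Real.exp (-x / C) := by
  induction s using Finset.induction_on with
  | empty => exact ⟨ν, hν.prob, hν.noAtoms, by simp, by simpa using hν.tail⟩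
  | insert i s hi ih =>
    obtain ⟨ρ, h1, h2, h3, h4⟩ := ih (fun j hj => hm j (by simp [hj]))
      (fun j hj => hml j (by simp [hj]))
    have hmi := hm i (by simp)
    have hli := hml i (by simp)
    have := isProbabilityMeasure_expoExcess hmi hli
    refine ⟨ρ.conv (expoExcess (m i) (l i)), inferInstance, ?_, fun t => ?_, fun x hx => ?_⟩
    · rw [Measure.conv_comm]; exact noAtoms_conv_right _ _ h2
    · rw [charFun_conv, h3, charFun_expoExcess hmi hli, Finset.prod_insert hi]; ring
    · rw [Finset.prod_insert hi]
      have := conv_expoExcess_tail ρ hmi hli hC h4 hx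
      refine this.trans (le_of_eq ?_); ring

lemma one_add_sum_le_prod_one_add {ι : Type*} (s : Finset ι) (f : ι → ℝ)
    (hf : ∀ i ∈ s, 0 ≤ f i) : 1 + ∑ i ∈ s, f i ≤ ∏ i ∈ s, (1 + f i) := by
  induction s using Finset.cons_induction with
  | empty => simp
  | cons i s hi ih =>
    have h0 := hf i (by simp)
    have h1 := ih fun j hj => hf j (by simp [hj])
    have h2 : 0 ≤ ∑ j ∈ s, f j := Finset.sum_nonneg fun j hj => hf j (by simp [hj])
    rw [Finset.sum_cons, Finset.prod_cons]
    nlinarith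

/-- The difference of sums of independent exponential variables with means `l i` and `m i ≤ l i`
is atomless, and it is non-positive with probability at most `∑ m / (∑ l + ∑ m)`. -/
theorem real_Iic_zero_le_of_charFun {ι : Type*} [DecidableEq ι] (s : Finset ι) (hs : s.Nonempty)
    (l m : ι → ℝ) (hm : ∀ i ∈ s, 0 < m i) (hml : ∀ i ∈ s, m i ≤ l i)
    (τ : Measure ℝ) [IsProbabilityMeasure τ]
    (hτ : ∀ t, charFun τ t
      = ∏ i ∈ s, ((1 - l i * t * Complex.I) * (1 + m i * t * Complex.I))⁻¹) :
    NullSingletonClass τ ∧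
      τ.real (Set.Iic 0) ≤ (∑ i ∈ s, m i) / (∑ i ∈ s, l i + ∑ i ∈ s, m i) := by
  set M := ∑ i ∈ s, m i with hM
  have hM0 : 0 < M := Finset.sum_pos hm hs
  obtain ⟨ν, hν, hνc⟩ := exists_symmetricTailBound s hs m hm
  obtain ⟨ρ, h1, h2, h3, h4⟩ := exists_conv_expoExcess_tail s l m hm hml hM0 ν hν
  -- In each factor, the term 1 - m i t of the excess cancels against the one of the Laplace law.
  have hτρ : τ = ρ := by
    apply Measure.ext_of_charFun
    ext t
    rw [hτ, h3, hνc, ← Finset.prod_mul_distrib]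
    refine Finset.prod_congr rfl fun i _ => ?_
    obtain ⟨e1, e2⟩ := charFun_inv_ne (b := m i) (t := t)
    obtain ⟨e3, -⟩ := charFun_inv_ne (b := l i) (t := t)
    generalize (m i : ℂ) * t * Complex.I = p at *
    generalize (l i : ℂ) * t * Complex.I = r at *
    field_simp
  rw [hτρ]
  refine ⟨h2, ?_⟩
  have h5 := h4 0 le_rfl
  simp only [neg_zero, zero_div, Real.exp_zero, mul_one] at h5
  refine h5.trans ?_
  have hmM : ∀ i ∈ s, m i ≤ M := fun i hi =>
    Finset.single_le_sum (fun j hj => (hm j hj).le) hi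
  -- As m_i ≤ M, the denominators M + m_i are at most 2M. Bernoulli's inequality then turns the
  -- product into a sum, which only involves Σl and Σm.
  have hprod : 1 + ∑ i ∈ s, (l i - m i) / (2 * M) ≤ ∏ i ∈ s, (M + l i) / (M + m i) := by
    have hq : ∀ i ∈ s, 1 + (l i - m i) / (2 * M) ≤ (M + l i) / (M + m i) := by
      intro i hi
      have h1 := hm i hi
      have h2 := hml i hi
      have h3 := hmM i hi
      have : (M + l i) / (M + m i) = 1 + (l i - m i) / (M + m i) := by field_simp; ring
      rw [this]
      have : (l i - m i) / (2 * M) ≤ (l i - m i) / (M + m i) := by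
        apply div_le_div_of_nonneg_left <;> linarith
      linarith
    refine le_trans ?_ (Finset.prod_le_prod (fun i hi => ?_) hq)
    · exact one_add_sum_le_prod_one_add s _ (fun i hi =>
        div_nonneg (sub_nonneg.2 (hml i hi)) (by linarith))
    · have := div_nonneg (sub_nonneg.2 (hml i hi)) (by linarith : 0 ≤ 2 * M)
      linarith
  have hinv : ∏ i ∈ s, (M + m i) / (M + l i) = (∏ i ∈ s, (M + l i) / (M + m i))⁻¹ := by
    rw [← Finset.prod_inv_distrib]
    exact Finset.prod_congr rfl fun i _ => (inv_div _ _).symm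
  have hpos : 0 < 1 + ∑ i ∈ s, (l i - m i) / (2 * M) := by
    have : 0 ≤ ∑ i ∈ s, (l i - m i) / (2 * M) := Finset.sum_nonneg fun i hi =>
      div_nonneg (sub_nonneg.2 (hml i hi)) (by linarith)
    linarith
  rw [hinv]
  calc 2⁻¹ * (∏ i ∈ s, (M + l i) / (M + m i))⁻¹
      ≤ 2⁻¹ * (1 + ∑ i ∈ s, (l i - m i) / (2 * M))⁻¹ := by gcongr
    _ = M / (∑ i ∈ s, l i + M) := by
        have hL : 0 < ∑ i ∈ s, l i := Finset.sum_pos (fun i hi => (hm i hi).trans_le (hml i hi)) hs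
        rw [← Finset.sum_div, Finset.sum_sub_distrib, ← hM]
        have h6 : 1 + (∑ i ∈ s, l i - M) / (2 * M) = (∑ i ∈ s, l i + M) / (2 * M) := by
          field_simp; ring
        rw [h6, inv_div, mul_div_assoc', inv_mul_cancel_left₀ two_ne_zero]

/-! ### Circularly symmetric Gaussian vectors -/

instance isProbabilityMeasure_complexGaussian (v : ℝ≥0) :
    IsProbabilityMeasure (complexGaussian v) :=
  Measure.isProbabilityMeasure_map (by fun_prop)

lemma integral_complexGaussian_mul (v : ℝ≥0) (f g : ℝ → ℂ) :
    ∫ z, f z.re * g z.im ∂(complexGaussian v)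
      = (∫ x, f x ∂(gaussianReal 0 (v / 2))) * ∫ x, g x ∂(gaussianReal 0 (v / 2)) := by
  rw [complexGaussian, integral_map_equiv, ← integral_prod_mul]
  rfl

/-- The characteristic functional of the circularly symmetric complex Gaussian law. -/
lemma integral_exp_re_conj_mul_complexGaussian (v : ℝ≥0) (c : ℂ) :
    ∫ z, Complex.exp ((((star c * z).re : ℝ) : ℂ) * Complex.I) ∂(complexGaussian v)
      = Complex.exp (-(v * ‖c‖ ^ 2 / 4 : ℝ)) := by
  have h : ∀ z : ℂ, Complex.exp ((((star c * z).re : ℝ) : ℂ) * Complex.I)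
      = Complex.exp (c.re * z.re * Complex.I) * Complex.exp (c.im * z.im * Complex.I) := by
    intro z
    rw [← Complex.exp_add]
    congr 1
    simp [Complex.mul_re]
    ring
  simp_rw [h]
  rw [integral_complexGaussian_mul v (fun x => Complex.exp (c.re * x * Complex.I))
    (fun x => Complex.exp (c.im * x * Complex.I)), ← charFun_apply_real, ← charFun_apply_real,
    charFun_gaussianReal, charFun_gaussianReal, ← Complex.exp_add]
  congr 1
  rw [Complex.sq_norm, Complex.normSq_apply]
  push_cast
  ring

/-- Stated for the square, which is rational in t and needs no choice of a complex square root. Real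
and imaginary parts of a complex Gaussian contribute equal factors, so the square is what occurs. -/
lemma integral_exp_sq_gaussianReal {v : ℝ≥0} (hv : 0 < v) (t : ℝ) :
    (∫ x, Complex.exp (t * (x : ℂ) ^ 2 * Complex.I) ∂(gaussianReal 0 (v / 2))) ^ 2
      = (1 - v * t * Complex.I)⁻¹ := by
  have hv2 : v / 2 ≠ 0 := by positivity
  have hvr : (0 : ℝ) < v := hv
  have hvc : ((v : ℝ) : ℂ) ≠ 0 := by exact_mod_cast hvr.ne'
  rw [integral_gaussianReal_eq_integral_smul hv2]
  have h : ∀ x : ℝ, gaussianPDFReal 0 (v / 2) x • Complex.exp (t * (x : ℂ) ^ 2 * Complex.I)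
      = ((Real.sqrt (Real.pi * v))⁻¹ : ℝ)
        * Complex.exp (-((v : ℂ)⁻¹ - t * Complex.I) * (x : ℂ) ^ 2) := by
    intro x
    rw [gaussianPDFReal, Complex.real_smul]
    have e1 : 2 * Real.pi * ((v / 2 : ℝ≥0) : ℝ) = Real.pi * v := by push_cast; ring
    have e2 : 2 * ((v / 2 : ℝ≥0) : ℝ) = v := by push_cast; ring
    rw [e1, e2]
    push_cast
    rw [mul_assoc, ← Complex.exp_add]
    congr 2
    field_simp
    ring
  simp_rw [h]
  have hre : 0 < ((v : ℂ)⁻¹ - t * Complex.I).re := by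
    have : ((v : ℂ)⁻¹) = ((v⁻¹ : ℝ) : ℂ) := by push_cast; rfl
    rw [this]; simp [hv]
  have h0 : (v : ℂ)⁻¹ - t * Complex.I ≠ 0 := by
    intro h; rw [h] at hre; simp at hre
  rw [integral_const_mul, integral_gaussian_complex hre, mul_pow, ← Complex.ofReal_pow,
    inv_pow, Real.sq_sqrt (by positivity)]
  have hp : (((Real.pi : ℂ) / ((v : ℂ)⁻¹ - t * Complex.I)) ^ (1 / 2 : ℂ)) ^ 2
      = Real.pi / ((v : ℂ)⁻¹ - t * Complex.I) := by
    have := Complex.cpow_nat_inv_pow ((Real.pi : ℂ) / ((v : ℂ)⁻¹ - t * Complex.I)) (n := 2)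
      (by norm_num)
    rw [one_div]
    exact_mod_cast this
  rw [hp]
  have hpi : (Real.pi : ℂ) ≠ 0 := by exact_mod_cast Real.pi_ne_zero
  have e3 : (1 - v * t * Complex.I) = v * ((v : ℂ)⁻¹ - t * Complex.I) := by
    rw [mul_sub, mul_inv_cancel₀ hvc]; ring
  rw [e3]
  push_cast
  generalize (v : ℂ)⁻¹ - t * Complex.I = w at *
  field_simp

/-- The squared modulus of a circularly symmetric complex Gaussian variable is exponential. -/
lemma integral_exp_normSq_complexGaussian {v : ℝ≥0} (hv : 0 < v) (t : ℝ) :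
    ∫ z, Complex.exp (t * (‖z‖ ^ 2 : ℝ) * Complex.I) ∂(complexGaussian v)
      = (1 - v * t * Complex.I)⁻¹ := by
  have h : ∀ z : ℂ, Complex.exp (t * (‖z‖ ^ 2 : ℝ) * Complex.I)
      = Complex.exp (t * (z.re : ℂ) ^ 2 * Complex.I)
        * Complex.exp (t * (z.im : ℂ) ^ 2 * Complex.I) := by
    intro z
    rw [← Complex.exp_add, Complex.sq_norm, Complex.normSq_apply]
    congr 1
    push_cast
    ring
  simp_rw [h]
  rw [integral_complexGaussian_mul v (fun x => Complex.exp (t * (x : ℂ) ^ 2 * Complex.I))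
    (fun x => Complex.exp (t * (x : ℂ) ^ 2 * Complex.I)), ← sq, integral_exp_sq_gaussianReal hv]

/-- The joint law of channel taps (with power delay profile `ρ`) and noise (of variance `n`). -/
noncomputable def tapNoiseLaw (A T B U : Type*) [Fintype A] [Fintype T] [Fintype B] [Fintype U]
    (ρ : T → ℝ≥0) (n : ℝ≥0) : Measure ((A → T → ℂ) × (B → U → ℂ)) :=
  (Measure.pi fun _ => Measure.pi fun τ => complexGaussian (ρ τ)).prod
    (Measure.pi fun _ => Measure.pi fun _ => complexGaussian n)

section

variable {A T B U : Type*} [Fintype A] [Fintype T] [Fintype B] [Fintype U]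

instance (ρ : T → ℝ≥0) (n : ℝ≥0) : IsProbabilityMeasure (tapNoiseLaw A T B U ρ n) := by
  unfold tapNoiseLaw; infer_instance

lemma integral_exp_pi_pi (ρ : A → T → ℝ≥0) (c : A → T → ℂ) :
    ∫ h, Complex.exp ((((∑ k, ∑ τ, star (c k τ) * h k τ).re : ℝ) : ℂ) * Complex.I)
        ∂(Measure.pi fun k => Measure.pi fun τ => complexGaussian (ρ k τ))
      = Complex.exp (-(∑ k, ∑ τ, ρ k τ * ‖c k τ‖ ^ 2 / 4 : ℝ)) := by
  have h : ∀ h : A → T → ℂ,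
      Complex.exp ((((∑ k, ∑ τ, star (c k τ) * h k τ).re : ℝ) : ℂ) * Complex.I)
      = ∏ k, ∏ τ, Complex.exp ((((star (c k τ) * h k τ).re : ℝ) : ℂ) * Complex.I) := by
    intro h
    simp_rw [← Complex.exp_sum, Complex.re_sum, Complex.ofReal_sum, Finset.sum_mul]
  simp_rw [h]
  rw [integral_fintype_prod_eq_prod
    (f := fun k (h : T → ℂ) => ∏ τ, Complex.exp ((((star (c k τ) * h τ).re : ℝ) : ℂ) * Complex.I))]
  have : ∀ k, ∫ h, ∏ τ, Complex.exp ((((star (c k τ) * h τ).re : ℝ) : ℂ) * Complex.I)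
      ∂(Measure.pi fun τ => complexGaussian (ρ k τ))
      = ∏ τ, Complex.exp (-(ρ k τ * ‖c k τ‖ ^ 2 / 4 : ℝ)) := by
    intro k
    rw [integral_fintype_prod_eq_prod
      (f := fun τ (z : ℂ) => Complex.exp ((((star (c k τ) * z).re : ℝ) : ℂ) * Complex.I))]
    simp_rw [integral_exp_re_conj_mul_complexGaussian]
  simp_rw [this, ← Complex.exp_sum]
  push_cast
  simp_rw [Finset.sum_neg_distrib]

lemma integral_exp_tapNoiseLaw (ρ : T → ℝ≥0) (n : ℝ≥0) (c : A → T → ℂ) (d : B → U → ℂ) :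
    ∫ x, Complex.exp ((((∑ k, ∑ τ, star (c k τ) * x.1 k τ
        + ∑ m, ∑ u, star (d m u) * x.2 m u).re : ℝ) : ℂ) * Complex.I) ∂(tapNoiseLaw A T B U ρ n)
      = Complex.exp (-((∑ k, ∑ τ, ρ τ * ‖c k τ‖ ^ 2 + ∑ m, ∑ u, n * ‖d m u‖ ^ 2) / 4 : ℝ)) := by
  simp_rw [Complex.add_re, Complex.ofReal_add, add_mul, Complex.exp_add]
  rw [tapNoiseLaw, integral_prod_mul
    (f := fun x : A → T → ℂ =>
      Complex.exp ((((∑ k, ∑ τ, star (c k τ) * x k τ).re : ℝ) : ℂ) * Complex.I))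
    (g := fun x : B → U → ℂ =>
      Complex.exp ((((∑ m, ∑ u, star (d m u) * x m u).re : ℝ) : ℂ) * Complex.I)),
    integral_exp_pi_pi, integral_exp_pi_pi, ← Complex.exp_add]
  congr 1
  push_cast
  simp_rw [add_div, Finset.sum_div]
  ring

/-- A complex linear image of the taps and the noise with diagonal covariance matrix has
independent circularly symmetric Gaussian components. -/
lemma map_tapNoiseLaw_eq_pi {J : Type*} [Fintype J] [DecidableEq J] (ρ : T → ℝ≥0) (n : ℝ≥0)
    (a : J → A → T → ℂ) (b : J → B → U → ℂ) (v : J → ℝ≥0)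
    (hcov : ∀ i j, ∑ k, ∑ τ, (ρ τ : ℂ) * (a i k τ * star (a j k τ))
      + ∑ m, ∑ u, (n : ℂ) * (b i m u * star (b j m u)) = if i = j then (v i : ℂ) else 0) :
    (tapNoiseLaw A T B U ρ n).map
        (fun x j => ∑ k, ∑ τ, a j k τ * x.1 k τ + ∑ m, ∑ u, b j m u * x.2 m u)
      = Measure.pi fun j => complexGaussian (v j) := by
  have hmeas : Measurable fun (x : (A → T → ℂ) × (B → U → ℂ)) (j : J) =>
      ∑ k, ∑ τ, a j k τ * x.1 k τ + ∑ m, ∑ u, b j m u * x.2 m u := by fun_prop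
  have := Measure.isProbabilityMeasure_map (μ := tapNoiseLaw A T B U ρ n) hmeas.aemeasurable
  symm
  rw [eq_comm, ← charFun_eq_pi_iff]
  intro t
  rw [charFun_apply, integral_map (by fun_prop) (by fun_prop), integral_map (by fun_prop)
    (by fun_prop)]
  have hc : ∀ j, charFun (complexGaussian (v j)) (t j)
      = Complex.exp (-(v j * ‖t j‖ ^ 2 / 4 : ℝ)) := by
    intro j
    rw [charFun_apply, ← integral_exp_re_conj_mul_complexGaussian]
    congr 1 with z
    congr 3
    rw [Complex.inner]
    simp [Complex.mul_re]
  simp_rw [hc]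
  -- The adjoint of the coefficient arrays applied to `t`: pairing the image with `t` is the same as
  -- pairing taps and noise with `c` and `d`.
  set c : A → T → ℂ := fun k τ => ∑ j, t j * star (a j k τ) with hcdef
  set d : B → U → ℂ := fun m u => ∑ j, t j * star (b j m u) with hddef
  have hexp : ∀ x : (A → T → ℂ) × (B → U → ℂ),
      ((inner ℝ (WithLp.toLp 2 fun j => ∑ k, ∑ τ, a j k τ * x.1 k τ
        + ∑ m, ∑ u, b j m u * x.2 m u) t : ℝ))
      = (∑ k, ∑ τ, star (c k τ) * x.1 k τ + ∑ m, ∑ u, star (d m u) * x.2 m u).re := by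
    intro x
    rw [PiLp.inner_apply]
    have h1 : ∀ z w : ℂ, inner ℝ z w = (star w * z).re := by
      intro z w; rw [Complex.inner]; simp [Complex.mul_re]
    simp_rw [h1, ← Complex.re_sum]
    congr 1
    simp only [hcdef, hddef, star_sum, star_mul', star_star, mul_add, Finset.sum_add_distrib,
      Finset.mul_sum, Finset.sum_mul]
    congr 1
    · rw [Finset.sum_comm]
      refine Finset.sum_congr rfl fun k _ => ?_
      rw [Finset.sum_comm]
      exact Finset.sum_congr rfl fun τ _ => Finset.sum_congr rfl fun j _ => by ring
    · rw [Finset.sum_comm]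
      refine Finset.sum_congr rfl fun k _ => ?_
      rw [Finset.sum_comm]
      exact Finset.sum_congr rfl fun τ _ => Finset.sum_congr rfl fun j _ => by ring
  simp_rw [hexp]
  rw [integral_exp_tapNoiseLaw, ← Complex.exp_sum]
  congr 1
  rw [Finset.sum_neg_distrib, ← Complex.ofReal_sum, ← Finset.sum_div]
  congr 3
  have hsq : ∀ z : ℂ, ((‖z‖ ^ 2 : ℝ) : ℂ) = star z * z := by
    intro z
    rw [Complex.sq_norm, Complex.normSq_eq_conj_mul_self]; rfl
  apply Complex.ofReal_injective
  push_cast [← Complex.ofReal_pow]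
  simp_rw [hsq]
  -- The diagonal form is written as a full Hermitian form in `t`, so that the covariance hypothesis
  -- can be inserted entry by entry. The rest is interchange of sums.
  have hR : ∑ j, (v j : ℂ) * (star (t j) * t j) = ∑ i, ∑ j, star (t i) * t j *
      (if i = j then (v i : ℂ) else 0) := by
    refine Finset.sum_congr rfl fun i _ => ?_
    simp; ring
  rw [hR]
  simp_rw [← hcov]
  simp only [hcdef, hddef, star_sum, star_mul', star_star, Finset.sum_mul, Finset.mul_sum,
    mul_add, Finset.sum_add_distrib]
  congr 1
  · calc _ = ∑ k, ∑ τ, ∑ i, ∑ j, (ρ τ : ℂ) * (star (t i) * a i k τ * (t j * star (a j k τ))) :=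
          Finset.sum_congr rfl fun k _ => Finset.sum_congr rfl fun τ _ => Finset.sum_comm
      _ = ∑ k, ∑ i, ∑ τ, ∑ j, (ρ τ : ℂ) * (star (t i) * a i k τ * (t j * star (a j k τ))) :=
          Finset.sum_congr rfl fun k _ => Finset.sum_comm
      _ = ∑ i, ∑ k, ∑ τ, ∑ j, (ρ τ : ℂ) * (star (t i) * a i k τ * (t j * star (a j k τ))) :=
          Finset.sum_comm
      _ = ∑ i, ∑ k, ∑ j, ∑ τ, (ρ τ : ℂ) * (star (t i) * a i k τ * (t j * star (a j k τ))) :=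
          Finset.sum_congr rfl fun i _ => Finset.sum_congr rfl fun k _ => Finset.sum_comm
      _ = ∑ i, ∑ j, ∑ k, ∑ τ, (ρ τ : ℂ) * (star (t i) * a i k τ * (t j * star (a j k τ))) :=
          Finset.sum_congr rfl fun i _ => Finset.sum_comm
      _ = _ := by
          refine Finset.sum_congr rfl fun i _ => Finset.sum_congr rfl fun j _ =>
            Finset.sum_congr rfl fun k _ => Finset.sum_congr rfl fun τ _ => by ring
  · calc _ = ∑ k, ∑ τ, ∑ i, ∑ j, (n : ℂ) * (star (t i) * b i k τ * (t j * star (b j k τ))) :=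
          Finset.sum_congr rfl fun k _ => Finset.sum_congr rfl fun τ _ => Finset.sum_comm
      _ = ∑ k, ∑ i, ∑ τ, ∑ j, (n : ℂ) * (star (t i) * b i k τ * (t j * star (b j k τ))) :=
          Finset.sum_congr rfl fun k _ => Finset.sum_comm
      _ = ∑ i, ∑ k, ∑ τ, ∑ j, (n : ℂ) * (star (t i) * b i k τ * (t j * star (b j k τ))) :=
          Finset.sum_comm
      _ = ∑ i, ∑ k, ∑ j, ∑ τ, (n : ℂ) * (star (t i) * b i k τ * (t j * star (b j k τ))) :=
          Finset.sum_congr rfl fun i _ => Finset.sum_congr rfl fun k _ => Finset.sum_comm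
      _ = ∑ i, ∑ j, ∑ k, ∑ τ, (n : ℂ) * (star (t i) * b i k τ * (t j * star (b j k τ))) :=
          Finset.sum_congr rfl fun i _ => Finset.sum_comm
      _ = _ := by
          refine Finset.sum_congr rfl fun i _ => Finset.sum_congr rfl fun j _ =>
            Finset.sum_congr rfl fun k _ => Finset.sum_congr rfl fun τ _ => by ring

end

/-- The characteristic function of a difference of two energies of independent circularly
symmetric Gaussian vectors. -/
lemma charFun_map_energy_sub {J : Type*} [Fintype J] (v : Bool × J → ℝ≥0) (hv : ∀ x, 0 < v x)
    (t : ℝ) :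
    charFun ((Measure.pi fun x => complexGaussian (v x)).map
        (fun y : Bool × J → ℂ => ∑ j, ‖y (true, j)‖ ^ 2 - ∑ j, ‖y (false, j)‖ ^ 2)) t
      = ∏ j, ((1 - (v (true, j) : ℝ) * t * Complex.I)
          * (1 + (v (false, j) : ℝ) * t * Complex.I))⁻¹ := by
  rw [charFun_apply_real, integral_map (by fun_prop) (by fun_prop)]
  have h : ∀ y : Bool × J → ℂ,
      Complex.exp (t * ((∑ j, ‖y (true, j)‖ ^ 2 - ∑ j, ‖y (false, j)‖ ^ 2 : ℝ) : ℂ) * Complex.I)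
      = ∏ x : Bool × J, Complex.exp (((if x.1 then t else -t : ℝ) : ℂ)
          * (‖y x‖ ^ 2 : ℝ) * Complex.I) := by
    intro y
    rw [Fintype.prod_prod_type, Fintype.prod_bool, ← Complex.exp_sum, ← Complex.exp_sum,
      ← Complex.exp_add]
    congr 1
    push_cast
    simp only [if_true]
    simp_rw [mul_sub, sub_mul, Finset.mul_sum, Finset.sum_mul]
    simp
    ring
  simp_rw [h]
  rw [integral_fintype_prod_eq_prod (f := fun (x : Bool × J) (z : ℂ) =>
    Complex.exp (((if x.1 then t else -t : ℝ) : ℂ) * (‖z‖ ^ 2 : ℝ) * Complex.I))]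
  simp_rw [integral_exp_normSq_complexGaussian (hv _)]
  rw [Fintype.prod_prod_type, Fintype.prod_bool, ← Finset.prod_mul_distrib]
  refine Finset.prod_congr rfl fun j _ => ?_
  rw [mul_inv]
  simp

/-! ### The discrete Fourier transform -/

/-- The root of unity `exp(2πi k / n)`. -/
noncomputable def unitRoot (n : ℕ) (k : ℤ) : ℂ := Complex.exp (2 * Real.pi * Complex.I * k / n)

lemma unitRoot_add (n : ℕ) (k l : ℤ) : unitRoot n (k + l) = unitRoot n k * unitRoot n l := by
  rw [unitRoot, unitRoot, unitRoot, ← Complex.exp_add]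
  congr 1; push_cast; ring

lemma star_unitRoot (n : ℕ) (k : ℤ) : star (unitRoot n k) = unitRoot n (-k) := by
  rw [unitRoot, unitRoot, Complex.star_def, ← Complex.exp_conj]
  congr 1
  have : (starRingEnd ℂ) 2 = 2 := map_ofNat _ 2
  simp [Complex.conj_ofReal, this]

lemma unitRoot_mul_self {n : ℕ} (k : ℤ) : unitRoot n (n * k) = 1 := by
  rcases eq_or_ne n 0 with h | h
  · subst h; simp [unitRoot]
  · rw [unitRoot, Complex.exp_eq_one_iff]
    refine ⟨k, ?_⟩
    have : (n : ℂ) ≠ 0 := by exact_mod_cast h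
    push_cast
    field_simp

lemma unitRoot_pow (n : ℕ) (k : ℤ) (t : ℕ) : unitRoot n k ^ t = unitRoot n (t * k) := by
  rw [unitRoot, unitRoot, ← Complex.exp_nat_mul]
  congr 1; push_cast; ring

lemma unitRoot_ne_one {n : ℕ} (hn : 0 < n) {k : ℤ} (hk : ¬ (n : ℤ) ∣ k) : unitRoot n k ≠ 1 := by
  intro h
  rw [unitRoot, Complex.exp_eq_one_iff] at h
  obtain ⟨l, hl⟩ := h
  apply hk
  refine ⟨l, ?_⟩
  have hn' : (n : ℂ) ≠ 0 := by exact_mod_cast hn.ne'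
  have hpi := Complex.two_pi_I_ne_zero
  rw [div_eq_iff hn'] at hl
  have : (k : ℂ) = n * l := by
    apply mul_left_cancel₀ hpi
    rw [hl]; ring
  exact_mod_cast this

lemma sum_unitRoot {n : ℕ} (a b : Fin n) :
    ∑ t : Fin n, unitRoot n (t * ((a : ℕ) - (b : ℕ) : ℤ)) = if a = b then (n : ℂ) else 0 := by
  have hn : 0 < n := Fin.pos a
  split_ifs with h
  · subst h; simp [unitRoot]
  · have hk : ¬ (n : ℤ) ∣ ((a : ℕ) - (b : ℕ) : ℤ) := by
      intro hd
      have h1 := a.isLt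
      have h2 := b.isLt
      have h3 : ((a : ℕ) : ℤ) ≠ (b : ℕ) := by
        intro e; exact h (Fin.ext (by exact_mod_cast e))
      have := Int.eq_zero_of_abs_lt_dvd hd (by rw [abs_lt]; constructor <;> omega)
      omega
    simp_rw [← unitRoot_pow]
    rw [Fin.sum_univ_eq_sum_range (fun t => unitRoot n ((a : ℕ) - (b : ℕ) : ℤ) ^ t)]
    have h1 := mul_geom_sum (unitRoot n ((a : ℕ) - (b : ℕ) : ℤ)) n
    rw [unitRoot_pow, unitRoot_mul_self, sub_self] at h1
    exact (mul_eq_zero.1 h1).resolve_left (sub_ne_zero.2 (unitRoot_ne_one hn hk))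

lemma dftMatrix_apply (n : ℕ) (a b : Fin n) :
    dftMatrix n a b = ((1 / Real.sqrt n : ℝ) : ℂ) * unitRoot n (-((a : ℕ) * (b : ℕ) : ℤ)) := by
  simp only [dftMatrix, Matrix.of_apply, unitRoot]
  congr 2; push_cast; ring

lemma star_dftMatrix_apply (n : ℕ) (a b : Fin n) :
    star (dftMatrix n a b) = ((1 / Real.sqrt n : ℝ) : ℂ) * unitRoot n ((a : ℕ) * (b : ℕ) : ℤ) := by
  rw [dftMatrix_apply, star_mul', star_unitRoot, neg_neg, Complex.star_def, Complex.conj_ofReal]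

lemma one_div_sqrt_mul_self (n : ℕ) :
    ((1 / Real.sqrt n : ℝ) : ℂ) * ((1 / Real.sqrt n : ℝ) : ℂ) = (n : ℂ)⁻¹ := by
  rw [← Complex.ofReal_mul, div_mul_div_comm, Real.mul_self_sqrt (Nat.cast_nonneg n)]
  push_cast; simp

lemma dft_diagonal_dft_apply {n : ℕ} (g : Fin n → ℂ) (a b : Fin n) :
    ((dftMatrix n)ᴴ * Matrix.diagonal g * dftMatrix n) a b
      = (n : ℂ)⁻¹ * ∑ u, g u * unitRoot n (u * ((a : ℕ) - (b : ℕ) : ℤ)) := by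
  rw [Matrix.mul_apply, Finset.mul_sum]
  refine Finset.sum_congr rfl fun u _ => ?_
  rw [Matrix.mul_diagonal, Matrix.conjTranspose_apply, star_dftMatrix_apply, dftMatrix_apply,
    ← one_div_sqrt_mul_self]
  have : unitRoot n (u * ((a : ℕ) - (b : ℕ) : ℤ))
      = unitRoot n ((u : ℕ) * (a : ℕ) : ℤ) * unitRoot n (-((u : ℕ) * (b : ℕ) : ℤ)) := by
    rw [← unitRoot_add]; congr 1; ring
  rw [this]; ring

lemma dftMatrix_conjTranspose_mul_self (n : ℕ) : (dftMatrix n)ᴴ * dftMatrix n = 1 := by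
  ext a b
  have h := dft_diagonal_dft_apply (fun _ => (1 : ℂ)) a b
  rw [Matrix.diagonal_one, Matrix.mul_one] at h
  simp only [one_mul] at h
  have hn : (n : ℂ) ≠ 0 := by exact_mod_cast (Fin.pos a).ne'
  rw [h, sum_unitRoot, Matrix.one_apply]
  split_ifs <;> simp [hn]

lemma dftMatrix_mul_conjTranspose_self (n : ℕ) : dftMatrix n * (dftMatrix n)ᴴ = 1 :=
  mul_eq_one_comm.1 (dftMatrix_conjTranspose_mul_self n)

/-- A circular shift is diagonalised by the inverse DFT. -/
lemma circulant_single_mul_dft {n : ℕ} (τ : Fin n) :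
    Matrix.circulant (Pi.single τ (1 : ℂ)) * (dftMatrix n)ᴴ
      = (dftMatrix n)ᴴ * Matrix.diagonal fun v : Fin n => unitRoot n (-((v : ℕ) * (τ : ℕ) : ℤ)) := by
  have : NeZero n := ⟨(Fin.pos τ).ne'⟩
  ext t v
  rw [Matrix.mul_apply, Matrix.mul_diagonal, Finset.sum_eq_single (t - τ)]
  · rw [Matrix.circulant_apply, sub_sub_cancel, Pi.single_eq_same, one_mul,
      Matrix.conjTranspose_apply, Matrix.conjTranspose_apply, star_dftMatrix_apply,
      star_dftMatrix_apply, mul_assoc, ← unitRoot_add]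
    congr 1
    -- Subtraction in `Fin n` wraps around; the multiple of `n` by which it differs from integer
    -- subtraction does not change the root of unity.
    obtain ⟨c, hc⟩ : ∃ c : ℤ, (((t - τ : Fin n) : ℕ) : ℤ) = (t : ℕ) - (τ : ℕ) + n * c := by
      rw [Fin.val_sub]
      refine ⟨1 - ((n - (τ : ℕ) + t) / n : ℕ), ?_⟩
      have h1 := Nat.mod_add_div (n - (τ : ℕ) + t) n
      have h2 : (τ : ℕ) ≤ n := τ.isLt.le
      zify [h2] at h1 ⊢
      linarith
    rw [hc]
    have : ((v : ℕ) : ℤ) * ((t : ℕ) - (τ : ℕ) + n * c)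
        = ((v : ℕ) * (t : ℕ) + -((v : ℕ) * (τ : ℕ))) + n * ((v : ℕ) * c) := by ring
    rw [this, unitRoot_add, unitRoot_mul_self, mul_one]
  · intro j _ hj
    rw [Matrix.circulant_apply, Pi.single_eq_of_ne, zero_mul]
    intro h; apply hj; rw [← h, sub_sub_cancel]
  · simp

/-- Splitting the channel into pure delays makes the received symbols explicitly linear in the
Gaussian taps. -/
lemma circulant_mulVec_eq_sum {n : ℕ} (h x : Fin n → ℂ) :
    Matrix.circulant h *ᵥ x = ∑ τ, h τ • (Matrix.circulant (Pi.single τ (1 : ℂ)) *ᵥ x) := by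
  ext t
  have : NeZero n := ⟨(Fin.pos t).ne'⟩
  simp only [Matrix.mulVec, dotProduct, Finset.sum_apply, Pi.smul_apply, smul_eq_mul,
    Matrix.circulant_apply, Finset.mul_sum]
  rw [Finset.sum_comm]
  refine Finset.sum_congr rfl fun j _ => ?_
  rw [Finset.sum_eq_single (t - j)]
  · simp
  · intro b _ hb; rw [Pi.single_eq_of_ne hb.symm]; simp
  · simp

/-! ### Correlations of delayed chirps -/

namespace CSCSystem

variable {q : ℕ} (C : CSCSystem q)

lemma mappingMatrix_diagonal (g : Fin C.Nd → ℂ) :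
    C.mappingMatrixᴴ * Matrix.diagonal g * C.mappingMatrix
      = Matrix.diagonal fun u => g (C.sub u) := by
  ext u u'
  rw [Matrix.mul_apply]
  simp only [Matrix.mul_diagonal, Matrix.conjTranspose_apply, mappingMatrix, Matrix.of_apply]
  rw [Finset.sum_eq_single (C.sub u)]
  · by_cases h : u = u'
    · subst h; simp
    · rw [Matrix.diagonal_apply_ne _ h, if_neg (fun e => h (C.sub.injective e))]; simp
  · intro t _ ht; simp [ht]
  · simp

/-- The matched filter of the chirps is the receiver matrix. -/
lemma conjTranspose_chirpMatrix :
    C.chirpMatrixᴴ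
      = (dftMatrix C.M)ᴴ * Matrix.diagonal (star C.fdss) * C.mappingMatrixᴴ * dftMatrix C.Nd := by
  simp only [chirpMatrix, Matrix.conjTranspose_mul, Matrix.conjTranspose_conjTranspose,
    Matrix.diagonal_conjTranspose, Matrix.mul_assoc]

/-- The correlation of the chirps with the chirps delayed by `τ`. -/
noncomputable def pathMatrix (τ : Fin C.Nd) : Matrix (Fin C.M) (Fin C.M) ℂ :=
  C.chirpMatrixᴴ * Matrix.circulant (Pi.single τ (1 : ℂ)) * C.chirpMatrix

/-- Any operation diagonal in frequency, a delay in particular, acts on the bins as a matrix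
diagonalised by the DFT of size M. Such a matrix is circulant, so correlations depend only on the
distance of the bins. -/
lemma chirp_diagonal (g : Fin C.Nd → ℂ) :
    C.chirpMatrixᴴ * ((dftMatrix C.Nd)ᴴ * Matrix.diagonal g * (C.mappingMatrix
        * Matrix.diagonal C.fdss * dftMatrix C.M))
      = (dftMatrix C.M)ᴴ * Matrix.diagonal (fun u => ((‖C.fdss u‖ ^ 2 : ℝ) : ℂ) * g (C.sub u))
        * dftMatrix C.M := by
  rw [conjTranspose_chirpMatrix]
  calc _ = (dftMatrix C.M)ᴴ * Matrix.diagonal (star C.fdss) * C.mappingMatrixᴴ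
        * (dftMatrix C.Nd * (dftMatrix C.Nd)ᴴ) * Matrix.diagonal g * C.mappingMatrix
        * Matrix.diagonal C.fdss * dftMatrix C.M := by simp only [Matrix.mul_assoc]
    _ = (dftMatrix C.M)ᴴ * (Matrix.diagonal (star C.fdss) * (C.mappingMatrixᴴ
        * Matrix.diagonal g * C.mappingMatrix)
        * Matrix.diagonal C.fdss) * dftMatrix C.M := by
          rw [dftMatrix_mul_conjTranspose_self, Matrix.mul_one]; simp only [Matrix.mul_assoc]
    _ = _ := by
        rw [mappingMatrix_diagonal, Matrix.diagonal_mul_diagonal, Matrix.diagonal_mul_diagonal]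
        congr 3
        ext u
        rw [Complex.sq_norm, Complex.normSq_eq_conj_mul_self, Pi.star_apply, Complex.star_def]
        ring

lemma chirpMatrix_conjTranspose_mul_self_eq :
    C.chirpMatrixᴴ * C.chirpMatrix = (dftMatrix C.M)ᴴ
      * Matrix.diagonal (fun u => ((‖C.fdss u‖ ^ 2 : ℝ) : ℂ)) * dftMatrix C.M := by
  have h := C.chirp_diagonal fun _ => 1
  rw [Matrix.diagonal_one, Matrix.mul_one] at h
  simp only [mul_one] at h
  rw [← h]
  simp only [chirpMatrix, Matrix.mul_assoc]

lemma pathMatrix_eq (τ : Fin C.Nd) :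
    C.pathMatrix τ = (dftMatrix C.M)ᴴ * Matrix.diagonal (fun u => ((‖C.fdss u‖ ^ 2 : ℝ) : ℂ)
      * unitRoot C.Nd (-((C.sub u : ℕ) * (τ : ℕ) : ℤ))) * dftMatrix C.M := by
  rw [← C.chirp_diagonal fun v : Fin C.Nd => unitRoot C.Nd (-((v : ℕ) * (τ : ℕ) : ℤ)),
    ← circulant_single_mul_dft, pathMatrix]
  have : C.chirpMatrix = (dftMatrix C.Nd)ᴴ
      * (C.mappingMatrix * Matrix.diagonal C.fdss * dftMatrix C.M) := by
    simp only [chirpMatrix, Matrix.mul_assoc]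
  conv_lhs => rw [Matrix.mul_assoc]; enter [2]; rw [this]
  simp only [Matrix.mul_assoc]

/-- The correlation of a chirp delayed by `τ` with the chirp `o` bins further. -/
noncomputable def pathGain (τ : Fin C.Nd) (o : ℕ) : ℂ :=
  (C.M : ℂ)⁻¹ * ∑ u, (((‖C.fdss u‖ ^ 2 : ℝ) : ℂ)
    * unitRoot C.Nd (-((C.sub u : ℕ) * (τ : ℕ) : ℤ))) * unitRoot C.M (u * (o : ℤ))

lemma pathMatrix_apply_of_add (τ : Fin C.Nd) (a b : Fin C.M) (o : ℕ) (h : a.val = b.val + o) :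
    C.pathMatrix τ a b = C.pathGain τ o := by
  rw [pathMatrix_eq, dft_diagonal_dft_apply, pathGain]
  congr 2 with u
  congr 3
  rw [h]; push_cast; ring

variable {C}

lemma chirpMatrix_conjTranspose_mul_self (hC : C.OrthogonalChirps) :
    C.chirpMatrixᴴ * C.chirpMatrix = 1 := by
  ext a b
  rcases eq_or_ne a b with h | h
  · subst h
    have hn : (C.M : ℂ) ≠ 0 := by exact_mod_cast (Fin.pos a).ne'
    rw [chirpMatrix_conjTranspose_mul_self_eq, dft_diagonal_dft_apply, Matrix.one_apply_eq]
    have : ∀ u : Fin C.M, unitRoot C.M (u * ((a : ℕ) - (a : ℕ) : ℤ)) = 1 := by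
      intro u; simp [unitRoot]
    simp_rw [this, mul_one]
    rw [← Complex.ofReal_sum, C.fdss_norm]
    push_cast
    exact inv_mul_cancel₀ hn
  · rw [Matrix.one_apply_ne h]; exact hC.1 b a h.symm

/-- The Gram matrix of the chirps is the DFT conjugate of the diagonal of the |f_u|². If it is the
identity, so is the diagonal: orthogonality forces a flat spectrum. -/
lemma fdss_norm_sq_eq_one (hC : C.OrthogonalChirps) (u : Fin C.M) : ‖C.fdss u‖ ^ 2 = 1 := by
  have h := chirpMatrix_conjTranspose_mul_self hC
  rw [chirpMatrix_conjTranspose_mul_self_eq] at h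
  have h2 : Matrix.diagonal (fun u => ((‖C.fdss u‖ ^ 2 : ℝ) : ℂ)) = 1 := by
    calc _ = (dftMatrix C.M * (dftMatrix C.M)ᴴ)
          * Matrix.diagonal (fun u => ((‖C.fdss u‖ ^ 2 : ℝ) : ℂ))
          * (dftMatrix C.M * (dftMatrix C.M)ᴴ) := by
            rw [dftMatrix_mul_conjTranspose_self]; simp
      _ = dftMatrix C.M * ((dftMatrix C.M)ᴴ
          * Matrix.diagonal (fun u => ((‖C.fdss u‖ ^ 2 : ℝ) : ℂ)) * dftMatrix C.M)
          * (dftMatrix C.M)ᴴ := by simp only [Matrix.mul_assoc]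
      _ = 1 := by rw [h, Matrix.mul_one, dftMatrix_mul_conjTranspose_self]
  have h3 := congrFun (congrFun h2 u) u
  rw [Matrix.diagonal_apply_eq, Matrix.one_apply_eq] at h3
  exact_mod_cast h3

/-- With a flat spectrum a delay only multiplies the subcarriers by phases. The path matrix is
therefore unitary, and the bins capture the whole energy of a delayed chirp. -/
lemma pathMatrix_conjTranspose_mul_self (hC : C.OrthogonalChirps) (τ : Fin C.Nd) :
    (C.pathMatrix τ)ᴴ * C.pathMatrix τ = 1 := by
  rw [pathMatrix_eq]
  simp_rw [fdss_norm_sq_eq_one hC]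
  simp only [Matrix.conjTranspose_mul, Matrix.conjTranspose_conjTranspose,
    Matrix.diagonal_conjTranspose]
  set g : Fin C.M → ℂ := fun u => ((1 : ℝ) : ℂ) * unitRoot C.Nd (-((C.sub u : ℕ) * (τ : ℕ) : ℤ))
  calc _ = (dftMatrix C.M)ᴴ * (Matrix.diagonal (star g) * (dftMatrix C.M * (dftMatrix C.M)ᴴ)
        * Matrix.diagonal g) * dftMatrix C.M := by simp only [Matrix.mul_assoc]
    _ = 1 := by
      rw [dftMatrix_mul_conjTranspose_self, Matrix.mul_one, Matrix.diagonal_mul_diagonal]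
      have : (fun u => star g u * g u) = fun _ => 1 := by
        ext u
        simp only [g, Pi.star_apply, star_mul', star_unitRoot, neg_neg]
        simp only [Complex.ofReal_one, star_one, one_mul]
        rw [← unitRoot_add]; simp [unitRoot]
      rw [this, Matrix.diagonal_one, Matrix.mul_one, dftMatrix_conjTranspose_mul_self]

lemma sum_norm_sq_pathMatrix (hC : C.OrthogonalChirps) (τ : Fin C.Nd) (b : Fin C.M) :
    ∑ a, ‖C.pathMatrix τ a b‖ ^ 2 = 1 := by
  have h := congrFun (congrFun (pathMatrix_conjTranspose_mul_self hC τ) b) b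
  rw [Matrix.mul_apply, Matrix.one_apply_eq] at h
  have : ∀ a, (C.pathMatrix τ)ᴴ b a * C.pathMatrix τ a b
      = ((‖C.pathMatrix τ a b‖ ^ 2 : ℝ) : ℂ) := by
    intro a
    rw [Matrix.conjTranspose_apply, Complex.sq_norm, Complex.normSq_eq_conj_mul_self]; rfl
  simp_rw [this, ← Complex.ofReal_sum] at h
  exact_mod_cast h

end CSCSystem

/-! ### Slots and the absence of interference -/

namespace CSCSystem

variable {q : ℕ} (C : CSCSystem q)

lemma slot_end_le (l : Fin (2 * (C.M / (2 + 2 * C.Mg)))) :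
    (l.val + 1) * (1 + C.Mg) ≤ C.M := by
  have h1 : l.val + 1 ≤ 2 * (C.M / (2 + 2 * C.Mg)) := l.isLt
  calc (l.val + 1) * (1 + C.Mg) ≤ 2 * (C.M / (2 + 2 * C.Mg)) * (1 + C.Mg) :=
        Nat.mul_le_mul_right _ h1
    _ = C.M / (2 + 2 * C.Mg) * (2 + 2 * C.Mg) := by ring
    _ ≤ C.M := Nat.div_mul_le_self _ _

/-- The bin at offset `o` in the slot of gradient `i` and vote `e`. -/
def slotBin (i : Fin q) (e : Bool) (o : Fin (1 + C.Mg)) : Fin C.M :=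
  ⟨(C.loc (i, e)).2.val * (1 + C.Mg) + o, by
    have h := C.slot_end_le (C.loc (i, e)).2
    have := o.isLt
    nlinarith⟩

lemma slotBin_injective (i : Fin q) (e : Bool) : Function.Injective (C.slotBin i e) := by
  intro o o' h
  have := congrArg Fin.val h
  simp only [slotBin] at this
  exact Fin.ext (by omega)

lemma mem_range_slotBin {i : Fin q} {e : Bool} {b : Fin C.M} :
    (∃ o, C.slotBin i e o = b) ↔ (C.loc (i, e)).2.val * (1 + C.Mg) ≤ b.val ∧
      b.val < ((C.loc (i, e)).2.val + 1) * (1 + C.Mg) := by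
  constructor
  · rintro ⟨o, rfl⟩
    have := o.isLt
    simp only [slotBin]
    constructor
    · omega
    · nlinarith
  · rintro ⟨h1, h2⟩
    refine ⟨⟨b.val - (C.loc (i, e)).2.val * (1 + C.Mg), ?_⟩, ?_⟩
    · rw [add_mul, one_mul] at h2; omega
    · apply Fin.ext; simp only [slotBin]; omega

lemma slotEnergy_eq (d : Fin C.S → Fin C.M → ℂ) (i : Fin q) (e : Bool) :
    C.slotEnergy d i e = ∑ o, ‖d (C.loc (i, e)).1 (C.slotBin i e o)‖ ^ 2 := by
  rw [slotEnergy, ← Finset.sum_filter]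
  refine Eq.trans ?_ (Finset.sum_map Finset.univ ⟨C.slotBin i e, C.slotBin_injective i e⟩
      (fun b => ‖d (C.loc (i, e)).1 b‖ ^ 2))
  refine Finset.sum_congr ?_ fun _ _ => rfl
  ext b
  simp only [Finset.mem_filter, Finset.mem_univ, true_and, Finset.mem_map,
    Function.Embedding.coeFn_mk]
  exact C.mem_range_slotBin.symm

/-- A chirp that has gone through the channel does not reach the bins of other slots. -/
lemma pathMatrix_slotBin_eq_zero (hC : C.OrthogonalChirps) {τ : Fin C.Nd} (hτ : C.pdp τ ≠ 0)
    {i i' : Fin q} {e e' : Bool} (hl : (C.loc (i, e)).2 ≠ (C.loc (i', e')).2)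
    (o : Fin (1 + C.Mg)) : C.pathMatrix τ (C.slotBin i e o) (C.slotBin i' e' 0) = 0 := by
  apply hC.2 τ hτ
  have h1 := C.slot_end_le (C.loc (i, e)).2
  have h2 := C.slot_end_le (C.loc (i', e')).2
  have ho := o.isLt
  have hl' : (C.loc (i, e)).2.val ≠ (C.loc (i', e')).2.val := fun h => hl (Fin.ext h)
  rw [Fin.val_sub]
  simp only [slotBin, Fin.val_zero, add_zero]
  generalize (C.loc (i, e)).2.val = l, (C.loc (i', e')).2.val = l' at *
  generalize hg : 1 + C.Mg = g at *
  have hg' : C.Mg < g := by omega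
  -- If the receiving slot lies before the sending one, the cyclic distance is M - (l' - l) g + o,
  -- which is at least g because slot l' ends inside the block. Otherwise it is (l - l') g + o ≥ g
  -- without wrapping.
  rcases lt_or_gt_of_ne hl' with h | h
  · have h3 : (l + 1) * g ≤ l' * g := Nat.mul_le_mul_right g h
    have e1 : (l + 1) * g = l * g + g := by ring
    have e2 : (l' + 1) * g = l' * g + g := by ring
    rw [Nat.mod_eq_of_lt (by omega)]
    omega
  · have h3 : (l' + 1) * g ≤ l * g := Nat.mul_le_mul_right g h
    have e1 : (l + 1) * g = l * g + g := by ring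
    have e2 : (l' + 1) * g = l' * g + g := by ring
    rw [show C.M - l' * g + (l * g + o) = (l * g + o - l' * g) + C.M by omega,
      Nat.add_mod_right, Nat.mod_eq_of_lt (by omega)]
    omega

lemma pathMatrix_slotBin_same (τ : Fin C.Nd) (i : Fin q) (e : Bool) (o : Fin (1 + C.Mg)) :
    C.pathMatrix τ (C.slotBin i e o) (C.slotBin i e 0) = C.pathGain τ o :=
  C.pathMatrix_apply_of_add τ _ _ o (by simp [slotBin])

/-- A delayed chirp has unit energy over all bins, by unitarity, and none of it falls outside its
own guard window. Hence its slot collects everything. -/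
lemma sum_norm_sq_pathGain (hC : C.OrthogonalChirps) {τ : Fin C.Nd} (hτ : C.pdp τ ≠ 0)
    (i : Fin q) (e : Bool) : ∑ o : Fin (1 + C.Mg), ‖C.pathGain τ o‖ ^ 2 = 1 := by
  rw [← sum_norm_sq_pathMatrix hC τ (C.slotBin i e 0)]
  simp_rw [← C.pathMatrix_slotBin_same τ i e]
  refine (Finset.sum_map Finset.univ ⟨C.slotBin i e, C.slotBin_injective i e⟩
      (fun b => ‖C.pathMatrix τ b (C.slotBin i e 0)‖ ^ 2)).symm.trans ?_
  refine Finset.sum_subset (Finset.subset_univ _) fun b _ hb => ?_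
  simp only [Finset.mem_map, Finset.mem_univ, true_and, Function.Embedding.coeFn_mk,
    C.mem_range_slotBin] at hb
  suffices hlt : C.Mg < (b - C.slotBin i e 0).val by
    have h0 : C.pathMatrix τ b (C.slotBin i e 0) = 0 := hC.2 τ hτ _ _ hlt
    change ‖C.pathMatrix τ b (C.slotBin i e 0)‖ ^ 2 = 0
    rw [h0]; norm_num
  · have h1 := C.slot_end_le (C.loc (i, e)).2
    have hb' := b.isLt
    rw [Fin.val_sub]
    simp only [slotBin, Fin.val_zero, add_zero]
    generalize (C.loc (i, e)).2.val = l at *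
    generalize hg : 1 + C.Mg = g at *
    have e1 : (l + 1) * g = l * g + g := by ring
    rcases lt_or_ge b.val (l * g) with h | h
    · rw [Nat.mod_eq_of_lt (by omega)]
      omega
    · rw [show C.M - l * g + b.val = (b.val - l * g) + C.M by omega,
        Nat.add_mod_right, Nat.mod_eq_of_lt (by omega)]
      omega

variable {K : ℕ}

lemma symbolVector_eq (v : Fin K → Fin q → ℝ) (s : Fin K → Fin q → ℂ) (k : Fin K) (m : Fin C.S)
    (b : Fin C.M) :
    C.symbolVector v s k m b = ∑ i : Fin q, ∑ e : Bool,
      if (C.loc (i, e)).1 = m ∧ b = C.slotBin i e 0 ∧ v k i = (if e then 1 else -1)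
      then s k i else 0 := by
  rw [symbolVector]
  refine Finset.sum_congr rfl fun i _ => Finset.sum_congr rfl fun e _ => ?_
  have : b.val = (C.loc (i, e)).2.val * (1 + C.Mg) ↔ b = C.slotBin i e 0 := by
    rw [Fin.ext_iff]; simp [slotBin]
  simp only [this]

/-- Distinct (gradient, vote) pairs in the same block have distinct slots, as `loc` is injective.
Their chirps do not reach this slot, and only the own symbol survives. -/
lemma pathMatrix_mulVec_symbolVector (hC : C.OrthogonalChirps) {τ : Fin C.Nd}
    (hτ : C.pdp τ ≠ 0) (v : Fin K → Fin q → ℝ) (s : Fin K → Fin q → ℂ) (k : Fin K)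
    (i : Fin q) (e : Bool) (o : Fin (1 + C.Mg)) :
    (C.pathMatrix τ *ᵥ C.symbolVector v s k (C.loc (i, e)).1) (C.slotBin i e o)
      = if v k i = (if e then 1 else -1) then C.pathGain τ o * s k i else 0 := by
  rw [Matrix.mulVec, dotProduct]
  have h : ∀ b, C.pathMatrix τ (C.slotBin i e o) b * C.symbolVector v s k (C.loc (i, e)).1 b
      = ∑ i' : Fin q, ∑ e' : Bool, if b = C.slotBin i' e' 0 then
        (if (C.loc (i', e')).1 = (C.loc (i, e)).1 ∧ v k i' = (if e' then 1 else -1)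
          then C.pathMatrix τ (C.slotBin i e o) b * s k i' else 0) else 0 := by
    intro b
    rw [symbolVector_eq, Finset.mul_sum]
    refine Finset.sum_congr rfl fun i' _ => ?_
    rw [Finset.mul_sum]
    refine Finset.sum_congr rfl fun e' _ => ?_
    by_cases h1 : b = C.slotBin i' e' 0 <;> simp [h1]
  simp_rw [h]
  rw [Finset.sum_comm]
  simp_rw [Finset.sum_comm (s := (Finset.univ : Finset (Fin C.M)))]
  simp only [Finset.sum_ite_eq', Finset.mem_univ, if_true]
  have h2 : ∀ p : Fin q × Bool, p ≠ (i, e) →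
      (if (C.loc (p.1, p.2)).1 = (C.loc (i, e)).1 ∧ v k p.1 = (if p.2 then 1 else -1)
        then C.pathMatrix τ (C.slotBin i e o) (C.slotBin p.1 p.2 0) * s k p.1 else 0) = 0 := by
    rintro ⟨i', e'⟩ hp
    by_cases h3 : (C.loc (i', e')).1 = (C.loc (i, e)).1 ∧ v k i' = (if e' then 1 else -1)
    · rw [if_pos h3, C.pathMatrix_slotBin_eq_zero hC hτ, zero_mul]
      intro h4
      exact hp (C.loc.injective (Prod.ext h3.1 h4.symm))
    · rw [if_neg h3]
  rw [← Fintype.sum_prod_type' (f := fun i' e' =>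
    if (C.loc (i', e')).1 = (C.loc (i, e)).1 ∧ v k i' = (if e' then 1 else -1)
        then C.pathMatrix τ (C.slotBin i e o) (C.slotBin i' e' 0) * s k i' else 0),
    Finset.sum_eq_single (i, e) (fun p _ hp => h2 p hp) (by simp)]
  simp [C.pathMatrix_slotBin_same]

lemma receivedSymbols_received (v : Fin K → Fin q → ℝ) (s : Fin K → Fin q → ℂ)
    (h : Fin K → Fin C.Nd → ℂ) (z : Fin C.S → Fin C.Nd → ℂ) (m : Fin C.S) (b : Fin C.M) :
    C.receivedSymbols (C.received v s h z) m b
      = ∑ k, ∑ τ, (Real.sqrt C.Es : ℂ) * (C.pathMatrix τ *ᵥ C.symbolVector v s k m) b * h k τ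
        + ∑ u, C.chirpMatrixᴴ b u * z m u := by
  rw [receivedSymbols, ← conjTranspose_chirpMatrix, received, Matrix.mulVec_add, Pi.add_apply,
    Matrix.mulVec_sum, Finset.sum_apply]
  congr 1
  refine Finset.sum_congr rfl fun k _ => ?_
  rw [Matrix.mulVec_smul, Pi.smul_apply, circulant_mulVec_eq_sum, Matrix.mulVec_sum,
    Finset.sum_apply, smul_eq_mul, Finset.mul_sum]
  refine Finset.sum_congr rfl fun τ _ => ?_
  rw [Matrix.mulVec_smul, Pi.smul_apply, pathMatrix, ← Matrix.mulVec_mulVec,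
    ← Matrix.mulVec_mulVec, smul_eq_mul]
  ring

end CSCSystem

/-! ### Fading modes and the law of the energy difference -/

namespace CSCSystem

variable {q : ℕ} (C : CSCSystem q)

lemma ofReal_norm_sq (z : ℂ) : ((‖z‖ ^ 2 : ℝ) : ℂ) = z * star z := by
  rw [Complex.sq_norm, ← Complex.mul_conj]; rfl

open scoped ComplexOrder in
/-- The spatial modes of the channel in one slot: a unitary change of the bins that makes the
signal components uncorrelated, with powers `a`. -/
lemma exists_pathModes (hC : C.OrthogonalChirps) (i : Fin q) :
    ∃ (V : Matrix (Fin (1 + C.Mg)) (Fin (1 + C.Mg)) ℂ) (a : Fin (1 + C.Mg) → ℝ),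
      Vᴴ * V = 1 ∧ V * Vᴴ = 1 ∧
      (∀ j j', ∑ τ, (C.pdp τ : ℂ) * ((∑ o, star (V o j) * C.pathGain τ o)
        * star (∑ o, star (V o j') * C.pathGain τ o)) = if j = j' then (a j : ℂ) else 0) ∧
      (∀ j, 0 ≤ a j) ∧ ∑ j, a j = 1 := by
  -- `W * Wᴴ` is the covariance, over the fading, of the response of a slot to one chirp. Its
  -- eigenvectors give the modes and its eigenvalues their powers.
  set W : Matrix (Fin (1 + C.Mg)) (Fin C.Nd) ℂ :=
    Matrix.of fun o τ => (Real.sqrt (C.pdp τ) : ℂ) * C.pathGain τ o with hW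
  have hpsd : (W * Wᴴ).PosSemidef := Matrix.posSemidef_self_mul_conjTranspose W
  have hA := hpsd.isHermitian
  set V : Matrix (Fin (1 + C.Mg)) (Fin (1 + C.Mg)) ℂ :=
    (hA.eigenvectorUnitary : Matrix (Fin (1 + C.Mg)) (Fin (1 + C.Mg)) ℂ) with hV
  have hV1 : Vᴴ * V = 1 := Unitary.coe_star_mul_self hA.eigenvectorUnitary
  have hV2 : V * Vᴴ = 1 := Unitary.coe_mul_star_self hA.eigenvectorUnitary
  have hsq : ∀ τ, (C.pdp τ : ℂ)
      = (Real.sqrt (C.pdp τ) : ℂ) * (Real.sqrt (C.pdp τ) : ℂ) := by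
    intro τ
    rw [← Complex.ofReal_mul, Real.mul_self_sqrt (NNReal.coe_nonneg _)]
  refine ⟨V, hA.eigenvalues, hV1, hV2, fun j j' => ?_, hpsd.eigenvalues_nonneg, ?_⟩
  · have h1 := hA.conjStarAlgAut_star_eigenvectorUnitary
    rw [Unitary.conjStarAlgAut_star_apply] at h1
    have h2 : (Vᴴ * W) * (Vᴴ * W)ᴴ = Matrix.diagonal (RCLike.ofReal ∘ hA.eigenvalues) := by
      rw [← h1]
      simp only [Matrix.conjTranspose_mul, Matrix.conjTranspose_conjTranspose, Matrix.mul_assoc]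
      rfl
    have h3 := congrFun (congrFun h2 j) j'
    rw [Matrix.mul_apply, Matrix.diagonal_apply] at h3
    have h5 : (if j = j' then ((RCLike.ofReal : ℝ → ℂ) ∘ hA.eigenvalues) j else 0)
        = if j = j' then (hA.eigenvalues j : ℂ) else 0 := rfl
    rw [h5] at h3
    rw [← h3]
    refine Finset.sum_congr rfl fun τ _ => ?_
    have h4 : ∀ j, (Vᴴ * W) j τ
        = (Real.sqrt (C.pdp τ) : ℂ) * ∑ o, star (V o j) * C.pathGain τ o := by
      intro j
      rw [Matrix.mul_apply, Finset.mul_sum]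
      refine Finset.sum_congr rfl fun o _ => ?_
      simp only [hW, Matrix.of_apply, Matrix.conjTranspose_apply]
      ring
    rw [Matrix.conjTranspose_apply, h4, h4, star_mul', Complex.star_def, Complex.conj_ofReal,
      hsq τ]
    ring
  · have h1 := hA.trace_eq_sum_eigenvalues
    -- The trace is the mean captured energy: each path of non-zero power delivers unit energy to
    -- the slot, and the path powers sum to 1.
    have h2 : (W * Wᴴ).trace = 1 := by
      rw [Matrix.trace]
      simp only [Matrix.diag_apply, Matrix.mul_apply, Matrix.conjTranspose_apply]
      rw [Finset.sum_comm]
      have : ∀ τ, ∑ o, W o τ * star (W o τ) = (C.pdp τ : ℂ) := by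
        intro τ
        have e : ∀ o, W o τ * star (W o τ)
            = ((C.pdp τ * ‖C.pathGain τ o‖ ^ 2 : ℝ) : ℂ) := by
          intro o
          rw [Complex.ofReal_mul, ofReal_norm_sq, hsq τ]
          simp only [hW, Matrix.of_apply, star_mul', Complex.star_def, Complex.conj_ofReal]
          ring
        simp_rw [e]
        rw [← Complex.ofReal_sum, ← Finset.mul_sum]
        rcases eq_or_ne (C.pdp τ) 0 with h | h
        · simp [h]
        · rw [C.sum_norm_sq_pathGain hC h i true, mul_one]
      simp_rw [this]
      rw [← Complex.ofReal_sum, ← NNReal.coe_sum, C.pdp_sum]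
      simp
    rw [h2] at h1
    have h3 : ((1 : ℝ) : ℂ) = ((∑ j, hA.eigenvalues j : ℝ) : ℂ) := by
      rw [Complex.ofReal_sum]; simpa using h1
    exact (Complex.ofReal_injective h3).symm

variable {K : ℕ}

/-- The number of devices that vote `e` on gradient `i`. -/
noncomputable def voteCount (v : Fin K → Fin q → ℝ) (i : Fin q) (e : Bool) : ℕ :=
  (Finset.univ.filter fun k => v k i = (if e then 1 else -1)).card

/-- The law of the channel taps and of the receiver noise of one round. -/
noncomputable def linkLaw (K : ℕ) : Measure ((Fin K → Fin C.Nd → ℂ) × (Fin C.S → Fin C.Nd → ℂ)) :=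
  tapNoiseLaw (Fin K) (Fin C.Nd) (Fin C.S) (Fin C.Nd) C.pdp C.noiseVar

instance : IsProbabilityMeasure (C.linkLaw K) := by unfold linkLaw; infer_instance

/-- The difference of the energies for the two votes on gradient `i`. -/
noncomputable def energyDiff (v : Fin K → Fin q → ℝ) (s : Fin K → Fin q → ℂ) (i : Fin q)
    (x : (Fin K → Fin C.Nd → ℂ) × (Fin C.S → Fin C.Nd → ℂ)) : ℝ :=
  C.slotEnergy (C.receivedSymbols (C.received v s x.1 x.2)) i true
    - C.slotEnergy (C.receivedSymbols (C.received v s x.1 x.2)) i false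

section Modes

variable (v : Fin K → Fin q → ℝ) (s : Fin K → Fin q → ℂ) (i : Fin q)
  (V : Matrix (Fin (1 + C.Mg)) (Fin (1 + C.Mg)) ℂ)

/-- The coefficients of the channel taps in the mode `x.2` of the slot for the vote `x.1`. -/
noncomputable def tapCoeff (x : Bool × Fin (1 + C.Mg)) (k : Fin K) (τ : Fin C.Nd) : ℂ :=
  ∑ o, star (V o x.2) * ((Real.sqrt C.Es : ℂ)
    * (C.pathMatrix τ *ᵥ C.symbolVector v s k (C.loc (i, x.1)).1) (C.slotBin i x.1 o))

/-- The coefficients of the noise in the mode `x.2` of the slot for the vote `x.1`. -/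
noncomputable def noiseCoeff (x : Bool × Fin (1 + C.Mg)) (m : Fin C.S) (u : Fin C.Nd) : ℂ :=
  if m = (C.loc (i, x.1)).1 then ∑ o, star (V o x.2) * C.chirpMatrixᴴ (C.slotBin i x.1 o) u else 0

lemma sum_star_mul_receivedSymbols (x : Bool × Fin (1 + C.Mg))
    (w : (Fin K → Fin C.Nd → ℂ) × (Fin C.S → Fin C.Nd → ℂ)) :
    ∑ o, star (V o x.2) * C.receivedSymbols (C.received v s w.1 w.2) (C.loc (i, x.1)).1
        (C.slotBin i x.1 o)
      = ∑ k, ∑ τ, C.tapCoeff v s i V x k τ * w.1 k τ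
        + ∑ m, ∑ u, C.noiseCoeff i V x m u * w.2 m u := by
  simp_rw [receivedSymbols_received, mul_add, Finset.sum_add_distrib]
  congr 1
  · simp_rw [tapCoeff, Finset.sum_mul, Finset.mul_sum]
    rw [Finset.sum_comm]
    refine Finset.sum_congr rfl fun k _ => ?_
    rw [Finset.sum_comm]
    exact Finset.sum_congr rfl fun τ _ => Finset.sum_congr rfl fun o _ => by ring
  · rw [Finset.sum_eq_single (C.loc (i, x.1)).1]
    · simp_rw [noiseCoeff, if_true, Finset.sum_mul, Finset.mul_sum]
      rw [Finset.sum_comm]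
      exact Finset.sum_congr rfl fun u _ => Finset.sum_congr rfl fun o _ => by ring
    · intro m _ hm
      simp [noiseCoeff, hm]
    · simp

/-- The energy detector cannot see the change of basis, so slot energies may be computed from the
modes. -/
lemma sum_norm_sq_unitary (hV : V * Vᴴ = 1) (d : Fin (1 + C.Mg) → ℂ) :
    ∑ j, ‖∑ o, star (V o j) * d o‖ ^ 2 = ∑ o, ‖d o‖ ^ 2 := by
  apply Complex.ofReal_injective
  rw [Complex.ofReal_sum, Complex.ofReal_sum]
  simp_rw [ofReal_norm_sq]
  have h1 : ∀ j, ∑ o, star (V o j) * d o = (Vᴴ *ᵥ d) j := by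
    intro j; simp [Matrix.mulVec, dotProduct, Matrix.conjTranspose_apply]
  simp_rw [h1]
  have h2 : ∀ e : Fin (1 + C.Mg) → ℂ, ∑ j, e j * star (e j) = dotProduct e (star e) :=
    fun e => rfl
  rw [h2, h2, Matrix.star_mulVec, Matrix.conjTranspose_conjTranspose,
    dotProduct_comm, ← Matrix.dotProduct_mulVec, Matrix.mulVec_mulVec, hV, Matrix.one_mulVec,
    dotProduct_comm]

/-- White noise stays white: the chirps are orthonormal, `V` is unitary, and slots of the same block
have no bin in common. -/
lemma sum_noiseCoeff (hC : C.OrthogonalChirps) (hV : Vᴴ * V = 1)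
    (x y : Bool × Fin (1 + C.Mg)) :
    ∑ m, ∑ u, (C.noiseVar : ℂ) * (C.noiseCoeff i V x m u * star (C.noiseCoeff i V y m u))
      = if x = y then (C.noiseVar : ℂ) else 0 := by
  have hloc : x.1 ≠ y.1 → (C.loc (i, x.1)).1 = (C.loc (i, y.1)).1 →
      (C.loc (i, x.1)).2 ≠ (C.loc (i, y.1)).2 := by
    intro h1 h2 h3
    have := C.loc.injective (Prod.ext h2 h3)
    exact h1 (congrArg Prod.snd this)
  by_cases hm : (C.loc (i, x.1)).1 = (C.loc (i, y.1)).1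
  · rw [Finset.sum_eq_single (C.loc (i, x.1)).1]
    · simp_rw [noiseCoeff, if_pos hm, if_true]
      rw [← Finset.mul_sum]
      have h1 : ∑ u, (∑ o, star (V o x.2) * C.chirpMatrixᴴ (C.slotBin i x.1 o) u)
          * star (∑ o, star (V o y.2) * C.chirpMatrixᴴ (C.slotBin i y.1 o) u)
          = ∑ o, ∑ o', star (V o x.2) * V o' y.2
            * (C.chirpMatrixᴴ * C.chirpMatrix) (C.slotBin i x.1 o) (C.slotBin i y.1 o') := by
        simp_rw [star_sum, Finset.sum_mul_sum]
        rw [Finset.sum_comm]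
        refine Finset.sum_congr rfl fun o _ => ?_
        rw [Finset.sum_comm]
        refine Finset.sum_congr rfl fun o' _ => ?_
        rw [Matrix.mul_apply, Finset.mul_sum]
        refine Finset.sum_congr rfl fun u _ => ?_
        simp only [Matrix.conjTranspose_apply, star_mul', star_star]
        ring
      rw [h1, chirpMatrix_conjTranspose_mul_self hC]
      by_cases hxy : x.1 = y.1
      · have h2 : ∀ o o', (1 : Matrix (Fin C.M) (Fin C.M) ℂ) (C.slotBin i x.1 o)
            (C.slotBin i y.1 o') = if o = o' then 1 else 0 := by
          intro o o'
          rw [← hxy, Matrix.one_apply]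
          simp [(C.slotBin_injective i x.1).eq_iff]
        simp_rw [h2]
        simp only [mul_ite, mul_one, mul_zero, Finset.sum_ite_eq, Finset.mem_univ, if_true]
        have h3 := congrFun (congrFun hV x.2) y.2
        rw [Matrix.mul_apply] at h3
        simp only [Matrix.conjTranspose_apply] at h3
        rw [h3, Matrix.one_apply]
        have : x = y ↔ x.2 = y.2 := ⟨fun h => by rw [h], fun h => Prod.ext hxy h⟩
        simp [this]
      · have h2 : ∀ o o', (1 : Matrix (Fin C.M) (Fin C.M) ℂ) (C.slotBin i x.1 o)
            (C.slotBin i y.1 o') = 0 := by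
          intro o o'
          refine Matrix.one_apply_ne fun h => ?_
          apply hloc hxy hm
          have h3 := (C.mem_range_slotBin (i := i) (e := x.1)).1 ⟨o, rfl⟩
          have h4 := (C.mem_range_slotBin (i := i) (e := y.1)).1 ⟨o', rfl⟩
          rw [h] at h3
          have h5 := lt_of_le_of_lt h3.1 h4.2
          have h6 := lt_of_le_of_lt h4.1 h3.2
          have h7 := Nat.lt_of_mul_lt_mul_right h5
          have h8 := Nat.lt_of_mul_lt_mul_right h6
          exact Fin.ext (by omega)
        simp_rw [h2]
        rw [if_neg (fun h => hxy (by rw [h]))]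
        simp
    · intro m _ hmx
      simp [noiseCoeff, hmx]
    · simp
  · rw [if_neg (fun h => hm (by rw [h]))]
    refine Finset.sum_eq_zero fun m _ => Finset.sum_eq_zero fun u _ => ?_
    rw [noiseCoeff, noiseCoeff]
    by_cases h1 : m = (C.loc (i, x.1)).1
    · rw [if_neg (c := m = (C.loc (i, y.1)).1) (fun h2 => hm (h1 ▸ h2))]; simp
    · rw [if_neg h1]; simp

/-- The random symbols drop out of the covariance because |s| = 1. A device votes only once per
gradient, so the two slots are driven by the taps of disjoint sets of devices and are uncorrelated.
Within a slot, `V` diagonalises the covariance. -/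
lemma sum_tapCoeff (hC : C.OrthogonalChirps) (hs : ∀ k i, ‖s k i‖ = 1)
    (a : Fin (1 + C.Mg) → ℝ)
    (hVa : ∀ j j', ∑ τ, (C.pdp τ : ℂ) * ((∑ o, star (V o j) * C.pathGain τ o)
        * star (∑ o, star (V o j') * C.pathGain τ o)) = if j = j' then (a j : ℂ) else 0)
    (x y : Bool × Fin (1 + C.Mg)) :
    ∑ k, ∑ τ, (C.pdp τ : ℂ) * (C.tapCoeff v s i V x k τ * star (C.tapCoeff v s i V y k τ))
      = if x = y then ((C.Es * voteCount v i x.1 * a x.2 : ℝ) : ℂ) else 0 := by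
  have hE : (Real.sqrt C.Es : ℂ) * (Real.sqrt C.Es : ℂ) = C.Es := by
    rw [← Complex.ofReal_mul, Real.mul_self_sqrt C.Es_pos.le]
  have hterm : ∀ k τ, (C.pdp τ : ℂ) * (C.tapCoeff v s i V x k τ * star (C.tapCoeff v s i V y k τ))
      = (if v k i = (if x.1 then 1 else -1) then (if v k i = (if y.1 then 1 else -1)
          then (C.Es : ℂ) else 0) else 0)
        * ((C.pdp τ : ℂ) * ((∑ o, star (V o x.2) * C.pathGain τ o)
        * star (∑ o, star (V o y.2) * C.pathGain τ o))) := by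
    intro k τ
    -- Orthogonality after a delay is only assumed for delays of non-zero power; the others carry
    -- weight 0.
    rcases eq_or_ne (C.pdp τ) 0 with h | h
    · simp [h]
    have hco : ∀ x : Bool × Fin (1 + C.Mg), C.tapCoeff v s i V x k τ
        = (if v k i = (if x.1 then 1 else -1) then 1 else 0)
          * ((Real.sqrt C.Es : ℂ) * s k i * ∑ o, star (V o x.2) * C.pathGain τ o) := by
      intro x
      simp_rw [tapCoeff, C.pathMatrix_mulVec_symbolVector hC h]
      by_cases hv : v k i = (if x.1 then 1 else -1)
      · simp_rw [if_pos hv, one_mul, Finset.mul_sum]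
        exact Finset.sum_congr rfl fun o _ => by ring
      · simp_rw [if_neg hv]; simp
    have hss : s k i * star (s k i) = 1 := by rw [← ofReal_norm_sq, hs]; simp
    rw [hco x, hco y]
    by_cases hvx : v k i = (if x.1 then 1 else -1)
    · by_cases hvy : v k i = (if y.1 then 1 else -1)
      · rw [if_pos hvx, if_pos hvy, if_pos hvx, if_pos hvy]
        simp only [one_mul, star_mul', Complex.star_def, Complex.conj_ofReal]
        simp only [Complex.star_def] at hss
        linear_combination ((C.pdp τ : ℂ) * (∑ o, (starRingEnd ℂ) (V o x.2) * C.pathGain τ o)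
          * (starRingEnd ℂ) (∑ o, (starRingEnd ℂ) (V o y.2) * C.pathGain τ o)) *
          ((Real.sqrt C.Es : ℂ) * (Real.sqrt C.Es : ℂ) * hss + hE)
      · rw [if_pos hvx, if_neg hvy, if_pos hvx, if_neg hvy]; simp
    · rw [if_neg hvx, if_neg hvx]; simp
  simp_rw [hterm]
  simp_rw [← Finset.mul_sum, hVa]
  rw [← Finset.sum_mul]
  by_cases hxy : x.1 = y.1
  · have h1 : ∑ k, (if v k i = (if x.1 then 1 else -1) then (if v k i = (if y.1 then 1 else -1)
          then (C.Es : ℂ) else 0) else 0) = C.Es * voteCount v i x.1 := by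
      rw [← hxy, voteCount, Finset.card_filter]
      push_cast
      rw [Finset.mul_sum]
      refine Finset.sum_congr rfl fun k _ => ?_
      split_ifs <;> simp
    rw [h1]
    have : x = y ↔ x.2 = y.2 := ⟨fun h => by rw [h], fun h => Prod.ext hxy h⟩
    simp only [this]
    split_ifs
    · push_cast; ring
    · simp
  · have h1 : ∀ k, (if v k i = (if x.1 then 1 else -1) then (if v k i = (if y.1 then 1 else -1)
          then (C.Es : ℂ) else 0) else 0) = 0 := by
      intro k
      by_cases h2 : v k i = (if x.1 then 1 else -1)
      · by_cases h3 : v k i = (if y.1 then 1 else -1)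
        · exfalso
          rw [h2] at h3
          apply hxy
          cases hx : x.1 <;> cases hy : y.1 <;> simp [hx, hy] at h3 ⊢ <;> norm_num at h3
        · rw [if_pos h2, if_neg h3]
      · rw [if_neg h2]
    simp_rw [h1]
    rw [Finset.sum_const_zero, zero_mul, if_neg (fun h => hxy (by rw [h]))]

end Modes

/-- The law of the energy difference for given votes and symbols. -/
lemma charFun_map_energyDiff (hC : C.OrthogonalChirps) (v : Fin K → Fin q → ℝ)
    (s : Fin K → Fin q → ℂ) (hs : ∀ k i, ‖s k i‖ = 1) (i : Fin q)
    (V : Matrix (Fin (1 + C.Mg)) (Fin (1 + C.Mg)) ℂ) (a : Fin (1 + C.Mg) → ℝ)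
    (hV1 : Vᴴ * V = 1) (hV2 : V * Vᴴ = 1)
    (hVa : ∀ j j', ∑ τ, (C.pdp τ : ℂ) * ((∑ o, star (V o j) * C.pathGain τ o)
        * star (∑ o, star (V o j') * C.pathGain τ o)) = if j = j' then (a j : ℂ) else 0)
    (ha : ∀ j, 0 ≤ a j) (t : ℝ) :
    charFun ((C.linkLaw K).map (C.energyDiff v s i)) t
      = ∏ j, ((1 - (C.Es * voteCount v i true * a j + C.noiseVar : ℝ) * t * Complex.I)
          * (1 + (C.Es * voteCount v i false * a j + C.noiseVar : ℝ) * t * Complex.I))⁻¹ := by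
  have hEs := C.Es_pos.le
  have hn0 : (0 : ℝ) < C.noiseVar := C.noiseVar_pos
  have hnn : ∀ x : Bool × Fin (1 + C.Mg),
      0 ≤ C.Es * voteCount v i x.1 * a x.2 := fun x =>
    mul_nonneg (mul_nonneg hEs (Nat.cast_nonneg _)) (ha _)
  set w : Bool × Fin (1 + C.Mg) → ℝ≥0 := fun x =>
    ⟨C.Es * voteCount v i x.1 * a x.2 + C.noiseVar, add_nonneg (hnn x) hn0.le⟩ with hw
  have hwr : ∀ x, (w x : ℝ) = C.Es * voteCount v i x.1 * a x.2 + C.noiseVar := fun x => rfl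
  have hlaw := map_tapNoiseLaw_eq_pi C.pdp C.noiseVar (C.tapCoeff v s i V) (C.noiseCoeff i V) w
    (by
      intro x y
      rw [C.sum_tapCoeff v s i V hC hs a hVa, C.sum_noiseCoeff i V hC hV1]
      split_ifs
      · rw [hwr]; push_cast; rfl
      · simp)
  have hdiff : C.energyDiff v s i = (fun y : Bool × Fin (1 + C.Mg) → ℂ =>
      ∑ j, ‖y (true, j)‖ ^ 2 - ∑ j, ‖y (false, j)‖ ^ 2) ∘
      (fun x j => ∑ k, ∑ τ, C.tapCoeff v s i V j k τ * x.1 k τ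
        + ∑ m, ∑ u, C.noiseCoeff i V j m u * x.2 m u) := by
    ext x
    simp only [energyDiff, Function.comp_apply]
    simp_rw [← sum_star_mul_receivedSymbols, slotEnergy_eq]
    rw [C.sum_norm_sq_unitary V hV2, C.sum_norm_sq_unitary V hV2]
  rw [hdiff, ← Measure.map_map (by fun_prop) (by fun_prop), linkLaw, hlaw,
    charFun_map_energy_sub w (fun x => by
      rw [← NNReal.coe_pos, hwr]; exact add_pos_of_nonneg_of_pos (hnn x) hn0)]
  rfl

end CSCSystem

/-! ### Probability of a wrong detection -/

lemma measurable_sgn : Measurable sgn :=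
  Measurable.ite measurableSet_Ici measurable_const measurable_const

namespace CSCSystem

variable {q : ℕ} (C : CSCSystem q) {K : ℕ}

section Measurability

variable {α : Type*} [MeasurableSpace α] {v : α → Fin K → Fin q → ℝ} {s : α → Fin K → Fin q → ℂ}
  {x : α → (Fin K → Fin C.Nd → ℂ) × (Fin C.S → Fin C.Nd → ℂ)}

lemma measurable_symbolVector (hv : ∀ k i, Measurable fun a => v a k i)
    (hs : ∀ k i, Measurable fun a => s a k i) (k : Fin K) (m : Fin C.S) (b : Fin C.M) :
    Measurable fun a => C.symbolVector (v a) (s a) k m b := by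
  unfold symbolVector
  refine Finset.measurable_sum _ fun i _ => Finset.measurable_sum _ fun e _ => ?_
  refine Measurable.ite ?_ (hs k i) measurable_const
  by_cases h : (C.loc (i, e)).1 = m ∧ b.val = (C.loc (i, e)).2.val * (1 + C.Mg)
  · have : {a | (C.loc (i, e)).1 = m ∧ b.val = (C.loc (i, e)).2.val * (1 + C.Mg) ∧
        v a k i = (if e then 1 else -1)} = {a | v a k i = (if e then 1 else -1)} := by
      ext p; simp [h.1, h.2]
    rw [this]
    exact measurableSet_eq_fun (hv k i) measurable_const
  · have : {a | (C.loc (i, e)).1 = m ∧ b.val = (C.loc (i, e)).2.val * (1 + C.Mg) ∧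
        v a k i = (if e then 1 else -1)} = ∅ := by
      ext p
      simp only [Set.mem_ofPred_eq, Set.mem_empty_iff_false, iff_false]
      tauto
    rw [this]
    exact MeasurableSet.empty

lemma measurable_energyDiff (hv : ∀ k i, Measurable fun a => v a k i)
    (hs : ∀ k i, Measurable fun a => s a k i) (hx : Measurable x) (i : Fin q) :
    Measurable fun a => C.energyDiff (v a) (s a) i (x a) := by
  have hd : ∀ m b, Measurable fun a =>
        C.receivedSymbols (C.received (v a) (s a) (x a).1 (x a).2) m b := by
    intro m b
    simp_rw [receivedSymbols_received]
    have hh : ∀ k τ, Measurable fun a => (x a).1 k τ := fun k τ =>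
      (measurable_pi_apply τ).comp ((measurable_pi_apply k).comp hx.fst)
    have hz : ∀ u, Measurable fun a => (x a).2 m u := fun u =>
      (measurable_pi_apply u).comp ((measurable_pi_apply m).comp hx.snd)
    refine Measurable.add (Finset.measurable_sum _ fun k _ => Finset.measurable_sum _ fun τ _ =>
      Measurable.mul (Measurable.mul measurable_const ?_) (hh k τ))
      (Finset.measurable_sum _ fun u _ => Measurable.mul measurable_const (hz u))
    simp only [Matrix.mulVec, dotProduct]
    exact Finset.measurable_sum _ fun b _ =>
      Measurable.mul measurable_const (C.measurable_symbolVector hv hs k m b)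
  unfold energyDiff
  simp_rw [slotEnergy_eq]
  exact (Finset.measurable_sum _ fun o _ => ((hd _ _).norm.pow_const 2)).sub
    (Finset.measurable_sum _ fun o _ => ((hd _ _).norm.pow_const 2))

end Measurability

lemma measurable_energyDiff_apply (v : Fin K → Fin q → ℝ) (s : Fin K → Fin q → ℂ) (i : Fin q) :
    Measurable (C.energyDiff v s i) :=
  C.measurable_energyDiff (v := fun _ => v) (s := fun _ => s) (x := fun x => x)
    (fun _ _ => measurable_const) (fun _ _ => measurable_const) measurable_id i

lemma voteCount_add {v : Fin K → Fin q → ℝ} {i : Fin q} (hv : ∀ k, v k i = 1 ∨ v k i = -1) :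
    voteCount v i true + voteCount v i false = K := by
  have h : (Finset.univ.filter fun k => v k i = (if false = true then 1 else -1))
      = Finset.univ.filter fun k => ¬ v k i = (if true = true then 1 else -1) := by
    ext k
    rcases hv k with h | h <;> simp [h] <;> norm_num
  rw [voteCount, voteCount, h, Finset.card_filter_add_card_filter_not]
  simp

/-- Provides a reference vote pattern for each count, through which the law belonging to that count
is defined. -/
lemma exists_voteCount_eq {z : ℕ} (hz : z ≤ K) (i : Fin q) :
    ∃ v : Fin K → Fin q → ℝ, (∀ k, v k i = 1 ∨ v k i = -1) ∧ voteCount v i true = z ∧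
      voteCount v i false = K - z := by
  have h1 : ∀ k : Fin K, (if k.val < z then (1 : ℝ) else -1) = 1 ∨
      (if k.val < z then (1 : ℝ) else -1) = -1 := by
    intro k; split_ifs <;> simp
  have h2 : voteCount (fun (k : Fin K) (_ : Fin q) => if k.val < z then (1 : ℝ) else -1) i true
      = z := by
    have : (Finset.univ.filter fun k : Fin K =>
        (if k.val < z then (1 : ℝ) else -1) = (if true = true then 1 else -1))
        = Finset.univ.filter fun k : Fin K => k.val < z := by
      ext k
      simp only [Finset.mem_filter, Finset.mem_univ, true_and, if_true]
      split_ifs with h <;> simp [h]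
      norm_num
    rw [voteCount, this, Fin.card_filter_val_lt]
    exact min_eq_right hz
  refine ⟨fun k _ => if k.val < z then 1 else -1, h1, h2, ?_⟩
  have := voteCount_add (i := i)
    (v := fun (k : Fin K) (_ : Fin q) => if k.val < z then (1 : ℝ) else -1) h1
  omega

/-- The law of the energy difference depends only on the number of votes `1`. -/
lemma exists_energyDiff_law (hC : C.OrthogonalChirps) (i : Fin q) :
    ∃ (a : Fin (1 + C.Mg) → ℝ) (ν : ℕ → Measure ℝ), (∀ j, 0 ≤ a j) ∧ ∑ j, a j = 1 ∧
      (∀ z, IsProbabilityMeasure (ν z)) ∧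
      (∀ z ≤ K, ∀ t : ℝ, charFun (ν z) t
        = ∏ j, ((1 - (C.Es * z * a j + C.noiseVar : ℝ) * t * Complex.I)
          * (1 + (C.Es * (K - z : ℕ) * a j + C.noiseVar : ℝ) * t * Complex.I))⁻¹) ∧
      ∀ (v : Fin K → Fin q → ℝ) (s : Fin K → Fin q → ℂ), (∀ k, v k i = 1 ∨ v k i = -1) →
        (∀ k i, ‖s k i‖ = 1) →
        (C.linkLaw K).map (C.energyDiff v s i) = ν (voteCount v i true) := by
  obtain ⟨V, a, hV1, hV2, hVa, ha, hsum⟩ := C.exists_pathModes hC i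
  have hcf : ∀ (v : Fin K → Fin q → ℝ) (s : Fin K → Fin q → ℂ), (∀ k i, ‖s k i‖ = 1) → ∀ t,
      charFun ((C.linkLaw K).map (C.energyDiff v s i)) t
      = ∏ j, ((1 - (C.Es * voteCount v i true * a j + C.noiseVar : ℝ) * t * Complex.I)
          * (1 + (C.Es * voteCount v i false * a j + C.noiseVar : ℝ) * t * Complex.I))⁻¹ :=
    fun v s hs t => C.charFun_map_energyDiff hC v s hs i V a hV1 hV2 hVa ha t
  have hp : ∀ v s, IsProbabilityMeasure ((C.linkLaw K).map (C.energyDiff (K := K) v s i)) :=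
    fun v s => Measure.isProbabilityMeasure_map (C.measurable_energyDiff_apply v s i).aemeasurable
  have hone : ∀ (k : Fin K) (j : Fin q), ‖(fun _ _ => 1 : Fin K → Fin q → ℂ) k j‖ = 1 := by
    intro k j; simp
  choose! vz hvz hvt hvf using fun (z : ℕ) (hz : z ≤ K) => exists_voteCount_eq (K := K) hz i
  have hνcf : ∀ z ≤ K, ∀ t : ℝ,
      charFun ((C.linkLaw K).map (C.energyDiff (vz z) (fun _ _ => 1) i)) t
      = ∏ j, ((1 - (C.Es * z * a j + C.noiseVar : ℝ) * t * Complex.I)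
          * (1 + (C.Es * (K - z : ℕ) * a j + C.noiseVar : ℝ) * t * Complex.I))⁻¹ := by
    intro z hz t
    rw [hcf _ _ hone, hvt z hz, hvf z hz]
  refine ⟨a, fun z => (C.linkLaw K).map (C.energyDiff (vz z) (fun _ _ => 1) i), ha, hsum,
    fun z => hp _ _, hνcf, fun v s hv hs => ?_⟩
  have := hp v s
  have := hp (vz (voteCount v i true)) (fun _ _ => 1)
  refine Measure.ext_of_charFun (funext fun t => ?_)
  have h := voteCount_add hv
  rw [hcf v s hs, hνcf _ (by omega), show K - voteCount v i true = voteCount v i false by omega]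

/-- The probability of a wrong detection, as a function of the number of correct votes. -/
lemma exists_detection_error (hC : C.OrthogonalChirps) (hK : 0 < K) (i : Fin q) :
    ∃ f : ℕ → ℝ,
      (∀ z ≤ K, K ≤ 2 * z →
        f z ≤ ((K - z : ℝ) * C.effectiveSNR + 1) / (K * C.effectiveSNR + 2)) ∧
      (∀ z ≤ K, f z + f (K - z) ≤ 1) ∧
      ∀ (v : Fin K → Fin q → ℝ) (s : Fin K → Fin q → ℂ), (∀ k, v k i = 1 ∨ v k i = -1) →
        (∀ k i, ‖s k i‖ = 1) → ∀ e : Bool,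
        (C.linkLaw K).real {x | sgn (C.energyDiff v s i x) ≠ (if e then 1 else -1)}
          ≤ f (voteCount v i e) := by
  obtain ⟨a, ν, ha, hsum, hpν, hνcf, heq⟩ := C.exists_energyDiff_law (K := K) hC i
  have hn0 : (0 : ℝ) < C.noiseVar := C.noiseVar_pos
  have hmeas : ∀ v s, Measurable (C.energyDiff (K := K) v s i) := fun v s =>
    C.measurable_energyDiff_apply v s i
  -- Negating the energy difference exchanges the two slots, hence the two vote counts.
  have hneg : ∀ z ≤ K, (ν z).map (fun x => -x) = ν (K - z) := by
    intro z hz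
    have : IsProbabilityMeasure ((ν z).map (fun x => -x)) :=
      Measure.isProbabilityMeasure_map (by fun_prop)
    refine Measure.ext_of_charFun (funext fun t => ?_)
    have h1 : charFun ((ν z).map (fun x => -x)) t = charFun (ν z) (-t) := by
      have := charFun_map_mul (μ := ν z) (-1) t
      simpa using this
    rw [h1, hνcf z hz, hνcf _ (Nat.sub_le _ _), Nat.sub_sub_self hz]
    refine Finset.prod_congr rfl fun j _ => ?_
    push_cast
    ring
  have hbound : ∀ z ≤ K, K ≤ 2 * z → NullSingletonClass (ν z) ∧
      (ν z).real (Set.Iic 0)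
        ≤ ((K - z : ℝ) * C.effectiveSNR + 1) / (K * C.effectiveSNR + 2) := by
    intro z hz hz2
    have hcast : ((K - z : ℕ) : ℝ) = (K : ℝ) - z := by rw [Nat.cast_sub hz]
    have hzR : (K : ℝ) - z ≤ z := by
      have : (K : ℝ) ≤ 2 * z := by exact_mod_cast hz2
      linarith
    obtain ⟨h1, h2⟩ := real_Iic_zero_le_of_charFun Finset.univ Finset.univ_nonempty
      (fun j => C.Es * z * a j + C.noiseVar) (fun j => C.Es * (K - z : ℕ) * a j + C.noiseVar)
      (fun j _ => add_pos_of_nonneg_of_pos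
        (mul_nonneg (mul_nonneg C.Es_pos.le (Nat.cast_nonneg _)) (ha j)) hn0)
      (fun j _ => by
        have := mul_le_mul_of_nonneg_right (mul_le_mul_of_nonneg_left hzR C.Es_pos.le) (ha j)
        rw [hcast]; linarith)
      (ν z) (hνcf z hz)
    refine ⟨h1, h2.trans (le_of_eq ?_)⟩
    -- Since Σ a_j = 1, the means of each slot sum to E_s times the count plus (1 + M_g) σ_n².
    -- Dividing by (1 + M_g) σ_n² leaves only ξ.
    simp_rw [Finset.sum_add_distrib, ← Finset.mul_sum, hsum, hcast]
    simp only [mul_one, Finset.sum_const, Finset.card_univ, Fintype.card_fin, nsmul_eq_mul,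
      Nat.cast_add, Nat.cast_one, effectiveSNR]
    have hE := C.Es_pos
    have hM : (0 : ℝ) < 1 + C.Mg := by positivity
    have hKp : (0 : ℝ) < K := by exact_mod_cast hK
    have hd : (0 : ℝ) < C.Es * z + (1 + C.Mg) * C.noiseVar
        + (C.Es * (K - z) + (1 + C.Mg) * C.noiseVar) := by
      have : C.Es * z + (1 + C.Mg) * C.noiseVar
        + (C.Es * (K - z) + (1 + C.Mg) * C.noiseVar)
          = C.Es * K + 2 * ((1 + C.Mg) * C.noiseVar) := by ring
      rw [this]; positivity
    rw [div_eq_div_iff hd.ne' (by positivity)]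
    field_simp
    ring
  refine ⟨fun z => (ν z).real (Set.Iic 0), fun z hz hz2 => (hbound z hz hz2).2, ?_, ?_⟩
  -- The two probabilities are those of D ≤ 0 and D ≥ 0 for one variable D; without an atom at 0
  -- they sum to 1.
  · have main : ∀ z ≤ K, K ≤ 2 * z →
        (ν z).real (Set.Iic 0) + (ν (K - z)).real (Set.Iic 0) ≤ 1 := by
      intro z hz hz2
      have := (hbound z hz hz2).1
      rw [← hneg z hz, map_measureReal_apply (by fun_prop) measurableSet_Iic]
      have h1 : (fun x : ℝ => -x) ⁻¹' Set.Iic 0 = Set.Ici 0 := by ext x; simp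
      have h2 : (ν z).real (Set.Ici 0) = (ν z).real (Set.Ioi 0) :=
        measureReal_congr Ioi_ae_eq_Ici.symm
      rw [h1, h2, ← Set.compl_Iic, probReal_compl_eq_one_sub measurableSet_Iic]
      linarith
    intro z hz
    rcases le_total K (2 * z) with h | h
    · exact main z hz h
    · have := main (K - z) (Nat.sub_le _ _) (by omega)
      rw [Nat.sub_sub_self hz] at this
      linarith
  · intro v s hv hs e
    have hc := voteCount_add hv
    change _ ≤ (ν (voteCount v i _)).real (Set.Iic 0)
    -- A wrong detection means D ≥ 0 for the vote -1, that is -D ≤ 0, and D < 0 for the vote 1.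
    -- Counting the tie as an error in both cases gives one function `f` for both votes.
    cases e
    · have h1 : voteCount v i false = K - voteCount v i true := by omega
      rw [h1, ← hneg (voteCount v i true) (by omega), ← heq v s hv hs, map_measureReal_apply (by fun_prop)
        measurableSet_Iic, map_measureReal_apply (hmeas v s)
        (measurableSet_Iic.preimage (by fun_prop))]
      refine measureReal_mono fun x hx => ?_
      simp only [sgn, ne_eq, Set.mem_ofPred_eq] at hx
      simp only [Set.mem_preimage, Set.mem_Iic]
      by_contra h
      apply hx
      rw [if_neg (by linarith)]
      simp
    · rw [← heq v s hv hs, map_measureReal_apply (hmeas v s) measurableSet_Iic]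
      refine measureReal_mono fun x hx => ?_
      simp only [sgn, ne_eq, Set.mem_ofPred_eq] at hx
      simp only [Set.mem_preimage, Set.mem_Iic]
      by_contra h
      apply hx
      rw [if_pos (by linarith)]
      simp

end CSCSystem

/-! ### The number of correct votes -/

section PoissonBinomial

open Polynomial

lemma coeff_prod_nonneg {ι : Type*} (s : Finset ι) (p : ι → ℝ) (hp0 : ∀ k, 0 ≤ p k)
    (hp : ∀ k, p k ≤ 1) (n : ℕ) : 0 ≤ (∏ k ∈ s, (C (1 - p k) * X + C (p k))).coeff n := by
  classical
  induction s using Finset.induction_on generalizing n with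
  | empty =>
    rw [Finset.prod_empty, coeff_one]
    split_ifs <;> norm_num
  | insert k s hk ih =>
    rw [Finset.prod_insert hk, add_mul, coeff_add, coeff_C_mul, mul_assoc, coeff_C_mul]
    refine add_nonneg (mul_nonneg (sub_nonneg.2 (hp k)) ?_) (mul_nonneg (hp0 k) (ih n))
    cases n with
    | zero => simp
    | succ n => rw [coeff_X_mul]; exact ih n

/-- The distribution of the number of successes in independent trials with failure probabilities
at most `1 / 2` leans to the successes. -/
lemma coeff_prod_le_coeff_prod {ι : Type*} (s : Finset ι) (p : ι → ℝ) (hp0 : ∀ k, 0 ≤ p k)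
    (hp : ∀ k, p k ≤ 1 / 2) {y z : ℕ} (hyz : y ≤ z) (hs : y + z ≤ s.card) :
    (∏ k ∈ s, (C (1 - p k) * X + C (p k))).coeff y
      ≤ (∏ k ∈ s, (C (1 - p k) * X + C (p k))).coeff z := by
  classical
  induction s using Finset.induction_on generalizing y z with
  | empty =>
    simp only [Finset.card_empty, Nat.le_zero, Nat.add_eq_zero_iff] at hs
    rw [hs.1, hs.2]
  | insert k s hk ih =>
    rw [Finset.card_insert_of_notMem hk] at hs
    rw [Finset.prod_insert hk]
    set c := ∏ k ∈ s, (C (1 - p k) * X + C (p k)) with hc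
    rcases hyz.eq_or_lt with rfl | hlt
    · rfl
    have h0 := hp0 k
    have h1 := hp k
    obtain ⟨z, rfl⟩ : ∃ z', z = z' + 1 := ⟨z - 1, by omega⟩
    have h2 : c.coeff y ≤ c.coeff z := ih (by omega) (by omega)
    have hrec : ∀ n, ((C (1 - p k) * X + C (p k)) * c).coeff (n + 1)
        = (1 - p k) * c.coeff n + p k * c.coeff (n + 1) := by
      intro n
      rw [add_mul, coeff_add, coeff_C_mul, mul_assoc, coeff_C_mul, coeff_X_mul]
    rw [hrec]
    rcases y with _ | y
    · have h3 : ((C (1 - p k) * X + C (p k)) * c).coeff 0 = p k * c.coeff 0 := by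
        simp [mul_coeff_zero]
      have hnn : ∀ n, 0 ≤ c.coeff n :=
        coeff_prod_nonneg s p hp0 (fun k => (hp k).trans (by norm_num))
      rw [h3]
      have h4 := mul_le_mul_of_nonneg_left h2 h0
      have h5 := mul_nonneg h0 (hnn (z + 1))
      have h6 := mul_nonneg (sub_nonneg.2 h1) (hnn z)
      linarith
    · rw [hrec]
      have h3 : c.coeff y ≤ c.coeff (z + 1) := ih (by omega) (by omega)
      have h4 : c.coeff y ≤ c.coeff z := ih (by omega) (by omega)
      -- With d the coefficients of the product over `s`, the difference of the two new coefficients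
      -- is (1 - 2p)(d_z - d_y) + p(d_z - d_{y+1}) + p(d_{z+1} - d_y), and every term is
      -- non-negative by induction.
      have h5 := mul_le_mul_of_nonneg_left h2 h0
      have h6 := mul_le_mul_of_nonneg_left h3 h0
      have h7 := mul_le_mul_of_nonneg_left h4 (sub_nonneg.2 h1)
      linarith

/-- The product is the generating function of the number of successes; expanding it sorts the
success sets by their size. -/
lemma coeff_prod_eq_sum {ι : Type*} [Fintype ι] [DecidableEq ι] (p : ι → ℝ) (n : ℕ) :
    (∏ k, (C (1 - p k) * X + C (p k))).coeff n
      = ∑ t : Finset ι, if t.card = n then ∏ k, (if k ∈ t then 1 - p k else p k) else 0 := by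
  rw [Finset.prod_add, Finset.powerset_univ, finsetSum_coeff]
  refine Finset.sum_congr rfl fun t _ => ?_
  rw [Finset.prod_mul_distrib, Finset.prod_const, mul_right_comm, coeff_mul_X_pow', ← map_prod,
    ← map_prod, ← C_mul, coeff_C]
  have h : ∏ k, (if k ∈ t then 1 - p k else p k)
      = (∏ k ∈ t, (1 - p k)) * ∏ k ∈ Finset.univ \ t, p k := by
    rw [Finset.prod_ite]
    congr 1
    · exact Finset.prod_congr (by ext; simp) fun _ _ => rfl
    · exact Finset.prod_congr (by ext; simp) fun _ _ => rfl
  rw [h]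
  by_cases h1 : t.card = n
  · simp [h1]
  · by_cases h2 : t.card ≤ n
    · rw [if_pos h2, if_neg (by omega), if_neg h1]
    · rw [if_neg h2, if_neg h1]

/-- A function of the number of successes that is non-positive when at least half of the trials
succeed, and non-positive on average over reflected pairs, has non-positive expectation. -/
lemma sum_prod_mul_card_nonpos {K : ℕ} (p : Fin K → ℝ) (hp0 : ∀ k, 0 ≤ p k)
    (hp : ∀ k, p k ≤ 1 / 2) (h : ℕ → ℝ) (h1 : ∀ z ≤ K, K ≤ 2 * z → h z ≤ 0)
    (h2 : ∀ z ≤ K, h z + h (K - z) ≤ 0) :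
    ∑ t : Finset (Fin K), (∏ k, (if k ∈ t then 1 - p k else p k)) * h t.card ≤ 0 := by
  set c := ∏ k, (C (1 - p k) * X + C (p k)) with hc
  have e1 : ∑ t : Finset (Fin K), (∏ k, (if k ∈ t then 1 - p k else p k)) * h t.card
      = ∑ z ∈ Finset.range (K + 1), c.coeff z * h z := by
    simp_rw [hc, coeff_prod_eq_sum, Finset.sum_mul]
    rw [Finset.sum_comm]
    refine Finset.sum_congr rfl fun t _ => ?_
    simp only [ite_mul, zero_mul]
    rw [Finset.sum_ite_eq, if_pos]
    rw [Finset.mem_range]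
    exact Nat.lt_succ_of_le ((Finset.card_le_univ t).trans_eq (Fintype.card_fin K))
  have e2 : ∑ z ∈ Finset.range (K + 1), c.coeff z * h z
      = ∑ z ∈ Finset.range (K + 1), c.coeff (K - z) * h (K - z) := by
    rw [← Finset.sum_range_reflect]
    rfl
  have hle : ∀ {y z : ℕ}, y ≤ z → y + z ≤ K → c.coeff y ≤ c.coeff z := fun h3 h4 =>
    coeff_prod_le_coeff_prod _ p hp0 hp h3 (by simpa using h4)
  have hnn : ∀ n, 0 ≤ c.coeff n :=
    coeff_prod_nonneg _ p hp0 (fun k => (hp k).trans (by norm_num))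
  -- Written as (c_z - c_{K-z}) h_z + c_{K-z} (h_z + h_{K-z}), both terms are non-positive.
  have hpair : ∀ z ≤ K, K ≤ 2 * z → c.coeff z * h z + c.coeff (K - z) * h (K - z) ≤ 0 := by
    intro z hz hz2
    have h3 : c.coeff (K - z) ≤ c.coeff z := hle (by omega) (by omega)
    have h4 := mul_nonneg (sub_nonneg.2 h3) (neg_nonneg.2 (h1 z hz hz2))
    have h5 := mul_nonneg (hnn (K - z)) (neg_nonneg.2 (h2 z hz))
    linarith
  -- The sum is added to its reflection, so that every index has a partner and z = K/2 needs no
  -- separate treatment.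
  have h3 : 2 * ∑ z ∈ Finset.range (K + 1), c.coeff z * h z ≤ 0 := by
    rw [two_mul]
    nth_rewrite 2 [e2]
    rw [← Finset.sum_add_distrib]
    refine Finset.sum_nonpos fun z hz => ?_
    have hz' : z ≤ K := Nat.lt_succ_iff.1 (Finset.mem_range.1 hz)
    rcases le_total K (2 * z) with h4 | h4
    · exact hpair z hz' h4
    · have h5 := hpair (K - z) (Nat.sub_le _ _) (by omega)
      rw [Nat.sub_sub_self hz'] at h5
      linarith
  rw [e1]
  linarith

end PoissonBinomial

/-! ### Mean error of the majority vote -/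

section Votes

variable {K : ℕ} {Θ : Type*} [MeasurableSpace Θ] (P : Fin K → Measure Θ)
  [∀ k, IsProbabilityMeasure (P k)] {A : Fin K → Set Θ}

open scoped Classical in
-- The event that exactly the devices of `t` succeed is a box, on which the product measure
-- factorises.
lemma integral_pi_successes (hA : ∀ k, MeasurableSet (A k)) (g : Finset (Fin K) → ℝ) :
    Integrable (fun θ => g (Finset.univ.filter fun k => θ k ∈ A k)) (Measure.pi P) ∧
    ∫ θ, g (Finset.univ.filter fun k => θ k ∈ A k) ∂(Measure.pi P)
      = ∑ t : Finset (Fin K),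
        (∏ k, (if k ∈ t then 1 - (P k).real (A k)ᶜ else (P k).real (A k)ᶜ)) * g t := by
  set B : Finset (Fin K) → Set (Fin K → Θ) := fun t =>
    Set.univ.pi fun k => if k ∈ t then A k else (A k)ᶜ with hB
  have hBm : ∀ t, MeasurableSet (B t) := fun t => MeasurableSet.univ_pi fun k => by
    split_ifs
    · exact hA k
    · exact (hA k).compl
  have hmem : ∀ t θ, θ ∈ B t ↔ (Finset.univ.filter fun k => θ k ∈ A k) = t := by
    intro t θ
    simp only [hB, Set.mem_univ_pi, Finset.ext_iff, Finset.mem_filter, Finset.mem_univ, true_and]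
    refine forall_congr' fun k => ?_
    split_ifs with h <;> simp [h]
  have hfun : (fun θ => g (Finset.univ.filter fun k => θ k ∈ A k))
      = fun θ => ∑ t, (B t).indicator (fun _ => g t) θ := by
    ext θ
    simp only [Set.indicator_apply, hmem]
    simp
  have hint : ∀ t ∈ (Finset.univ : Finset (Finset (Fin K))),
      Integrable ((B t).indicator (fun _ => g t)) (Measure.pi P) := fun t _ =>
    (integrable_const (g t)).indicator (hBm t)
  rw [hfun]
  refine ⟨integrable_finsetSum _ hint, ?_⟩
  rw [integral_finsetSum _ hint]
  refine Finset.sum_congr rfl fun t _ => ?_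
  rw [integral_indicator_const _ (hBm t), smul_eq_mul, hB, measureReal_def, Measure.pi_pi,
    ENNReal.toReal_prod]
  congr 1
  refine Finset.prod_congr rfl fun k _ => ?_
  split_ifs
  · rw [← measureReal_def, probReal_compl_eq_one_sub (hA k)]; ring
  · rfl

open scoped Classical in
/-- The mean error of the majority vote of independent voters. -/
lemma integral_pi_detection_error_le (hA : ∀ k, MeasurableSet (A k))
    (hp : ∀ k, (P k).real (A k)ᶜ ≤ 1 / 2) {ξ : ℝ} (hξ : 0 ≤ ξ) {f : ℕ → ℝ}
    (h1 : ∀ z ≤ K, K ≤ 2 * z → f z ≤ ((K - z : ℝ) * ξ + 1) / (K * ξ + 2))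
    (h2 : ∀ z ≤ K, f z + f (K - z) ≤ 1) :
    ∫ θ, f (Finset.univ.filter fun k => θ k ∈ A k).card ∂(Measure.pi P)
      ≤ ((∑ k, (P k).real (A k)ᶜ) * ξ + 1) / (K * ξ + 2) := by
  set l : ℕ → ℝ := fun z => ((K - z : ℝ) * ξ + 1) / (K * ξ + 2) with hl
  have hpos : 0 < (K : ℝ) * ξ + 2 := by positivity
  -- Only the difference to the affine bound `l` is compared. As l(z) + l(K - z) = 1, f - l is
  -- non-positive on reflected pairs, and the mean of `l` needs only the mean number of failures.
  have hneg : ∫ θ, (f (Finset.univ.filter fun k => θ k ∈ A k).card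
      - l (Finset.univ.filter fun k => θ k ∈ A k).card) ∂(Measure.pi P) ≤ 0 := by
    rw [(integral_pi_successes P hA fun t => f t.card - l t.card).2]
    refine sum_prod_mul_card_nonpos _ (fun k => measureReal_nonneg) hp (fun z => f z - l z)
      (fun z hz hz2 => sub_nonpos.2 (h1 z hz hz2)) fun z hz => ?_
    have h3 : l z + l (K - z) = 1 := by
      simp only [hl]
      rw [Nat.cast_sub hz, ← add_div, div_eq_one_iff_eq hpos.ne']
      ring
    have := h2 z hz
    linarith
  rw [integral_sub (integral_pi_successes P hA fun t => f t.card).1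
    (integral_pi_successes P hA fun t => l t.card).1, sub_nonpos] at hneg
  refine hneg.trans (le_of_eq ?_)
  have hcard : ∀ θ : Fin K → Θ, ((K : ℝ) - (Finset.univ.filter fun k => θ k ∈ A k).card)
      = ∑ k, (A k)ᶜ.indicator (fun _ => (1 : ℝ)) (θ k) := by
    intro θ
    simp only [Set.indicator_apply, Set.mem_compl_iff]
    rw [Finset.sum_boole, sub_eq_iff_eq_add, ← Nat.cast_add, Nat.cast_inj, add_comm,
      Finset.card_filter_add_card_filter_not]
    simp
  have hint : ∀ k ∈ (Finset.univ : Finset (Fin K)),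
      Integrable (fun θ : Fin K → Θ => (A k)ᶜ.indicator (fun _ => (1 : ℝ)) (θ k))
        (Measure.pi P) := fun k _ =>
    (measurePreserving_eval P k).integrable_comp_of_integrable
      ((integrable_const (1 : ℝ)).indicator (hA k).compl)
  simp only [hl, hcard]
  rw [integral_div, integral_add ((integrable_finsetSum _ hint).mul_const ξ)
    (integrable_const _), integral_mul_const, integral_finsetSum _ hint]
  simp only [integral_const, probReal_univ, smul_eq_mul, one_mul]
  congr 3
  refine Finset.sum_congr rfl fun k _ => ?_
  refine (integral_comp_eval (μ := P) (i := k) (f := (A k)ᶜ.indicator (fun _ => (1 : ℝ)))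
    ((measurable_const.indicator (hA k).compl).aestronglyMeasurable)).trans ?_
  rw [integral_indicator_const _ (hA k).compl]
  simp

end Votes

/-! ### Symmetric unimodal laws -/

section Unimodal

variable {ν : Measure ℝ} {m : ℝ}

lemma IsSymmetricUnimodal.real_Ici (h : IsSymmetricUnimodal ν m) (x : ℝ) :
    ν.real (Set.Ici (m + x)) = ν.real (Set.Iic (m - x)) := by
  have hpre : (fun y => 2 * m - y) ⁻¹' Set.Ici (m + x) = Set.Iic (m - x) := by
    ext y
    simp only [Set.mem_preimage, Set.mem_Ici, Set.mem_Iic]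
    constructor <;> intro h <;> linarith
  calc ν.real (Set.Ici (m + x)) = (ν.map fun y => 2 * m - y).real (Set.Ici (m + x)) := by rw [h.1]
    _ = ν.real (Set.Iic (m - x)) := by
        rw [map_measureReal_apply (by fun_prop) measurableSet_Ici, hpre]

lemma IsSymmetricUnimodal.real_le_abs_sub [IsProbabilityMeasure ν] (h : IsSymmetricUnimodal ν m) {r : ℝ} (hr : 0 < r) :
    ν.real {x | r ≤ |x - m|} = 2 * ν.real (Set.Iic (m - r)) := by
  have hset : {x | r ≤ |x - m|} = Set.Iic (m - r) ∪ Set.Ici (m + r) := by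
    ext x
    simp only [Set.mem_ofPred_eq, Set.mem_union, Set.mem_Iic, Set.mem_Ici, le_abs]
    constructor
    · rintro (h | h)
      · right; linarith
      · left; linarith
    · rintro (h | h)
      · right; linarith
      · left; linarith
  rw [hset, measureReal_union _ measurableSet_Ici, h.real_Ici, two_mul]
  rw [Set.disjoint_left]
  intro x hx hx'
  simp only [Set.mem_Iic, Set.mem_Ici] at hx hx'
  linarith

lemma IsSymmetricUnimodal.real_Iic_le_half [IsProbabilityMeasure ν] (h : IsSymmetricUnimodal ν m) {t : ℝ} (ht : 0 < t) :
    ν.real (Set.Iic (m - t)) ≤ 1 / 2 := by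
  have := h.real_le_abs_sub ht
  have h1 : ν.real {x | t ≤ |x - m|} ≤ 1 := measureReal_le_one
  linarith

/-- A tail bound for symmetric unimodal laws of variance at most `s ^ 2`. -/
lemma IsSymmetricUnimodal.real_Iic_mul_le [IsProbabilityMeasure ν] (h : IsSymmetricUnimodal ν m) {t s : ℝ}
    (ht : 0 < t) (hs : 0 ≤ s) (hint : Integrable (fun x => (x - m) ^ 2) ν)
    (hvar : ∫ x, (x - m) ^ 2 ∂ν ≤ s ^ 2) :
    2 * ν.real (Set.Iic (m - t)) * t ≤ 2 * Real.sqrt 2 / 3 * s := by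
  set c : ℝ → ℝ := fun x => ν.real (Set.Iic x) with hc
  -- The midpoint inequality around m - t bounds the tail at t/2 from below by the tails at t and
  -- 3t/2.
  have hconv : 2 * c (m - t) ≤ c (m - t / 2) + c (m - 3 * t / 2) := by
    have h1 := h.2.1.2 (Set.mem_Iic.2 (by linarith : m - t / 2 ≤ m))
      (Set.mem_Iic.2 (by linarith : m - 3 * t / 2 ≤ m)) (by norm_num : (0 : ℝ) ≤ 1 / 2)
      (by norm_num : (0 : ℝ) ≤ 1 / 2) (by norm_num)
    simp only [smul_eq_mul] at h1
    rw [show 1 / 2 * (m - t / 2) + 1 / 2 * (m - 3 * t / 2) = m - t by ring] at h1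
    linarith
  have hB : 0 ≤ c (m - 3 * t / 2) := measureReal_nonneg
  have hu : 0 ≤ c (m - t) := measureReal_nonneg
  have hu2 : c (m - t) ≤ 1 / 2 := h.real_Iic_le_half ht
  have hmeas : ∀ r : ℝ, MeasurableSet {x : ℝ | r ≤ |x - m|} := fun r =>
    measurableSet_le measurable_const (by fun_prop)
  have hI : ∀ r b : ℝ, Integrable ({x : ℝ | r ≤ |x - m|}.indicator fun _ => b) ν := fun r b =>
    (integrable_const b).indicator (hmeas r)
  -- (x - m)² is bounded below by a step function with jumps t²/4, 3t²/4 and 5t²/4 at |x - m| = t/2,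
  -- t and 3t/2, where it takes the values t²/4, t² and 9t²/4.
  have hlow : t ^ 2 / 4 * (2 * c (m - t / 2)) + 3 * t ^ 2 / 4 * (2 * c (m - t))
      + 5 * t ^ 2 / 4 * (2 * c (m - 3 * t / 2)) ≤ s ^ 2 := by
    refine le_trans (le_of_eq ?_) ((integral_mono (((hI (t / 2) (t ^ 2 / 4)).add
      (hI t (3 * t ^ 2 / 4))).add (hI (3 * t / 2) (5 * t ^ 2 / 4))) hint fun x => ?_).trans hvar)
    · simp only [Pi.add_apply]
      rw [integral_add (by exact (hI _ _).add (hI _ _)) (hI _ _), integral_add (hI _ _) (hI _ _),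
        integral_indicator_const _ (hmeas _), integral_indicator_const _ (hmeas _),
        integral_indicator_const _ (hmeas _), h.real_le_abs_sub (by positivity),
        h.real_le_abs_sub ht, h.real_le_abs_sub (by positivity)]
      simp only [smul_eq_mul, hc]
      ring
    · simp only [Pi.add_apply, Set.indicator_apply, Set.mem_ofPred_eq]
      rw [← sq_abs (x - m)]
      have h0 := abs_nonneg (x - m)
      split_ifs <;> nlinarith
  -- Together with `hconv` this leaves the constant 4/5. That is below 8/9, the square of 2√2/3, so
  -- no sharper Gauss inequality is required.
  have h1 : 2 * c (m - t) * t ^ 2 ≤ 4 / 5 * s ^ 2 := by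
    have := mul_le_mul_of_nonneg_left hconv (by positivity : 0 ≤ t ^ 2 / 2)
    have := mul_nonneg (by positivity : 0 ≤ t ^ 2) hB
    linarith
  refine abs_le_of_sq_le_sq' ?_ (by positivity) |>.2
  rw [mul_pow, mul_pow (2 * Real.sqrt 2 / 3), div_pow, mul_pow 2 (Real.sqrt 2),
    Real.sq_sqrt (by norm_num)]
  have h2 := mul_le_mul_of_nonneg_left h1 hu
  have h3 := mul_le_mul_of_nonneg_right hu2 (by positivity : 0 ≤ 4 / 5 * s ^ 2)
  have h4 : (2 * c (m - t)) ^ 2 * t ^ 2 ≤ 4 / 5 * s ^ 2 := by linarith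
  have h5 := sq_nonneg s
  change (2 * c (m - t)) ^ 2 * t ^ 2 ≤ _
  linarith

end Unimodal

lemma sgn_eq_or (x : ℝ) : sgn x = 1 ∨ sgn x = -1 := by
  unfold sgn; split_ifs <;> simp

/-- The probability that a symmetric unimodal variable has the wrong sign. -/
lemma real_wrong_sign_le {Θ : Type*} [MeasurableSpace Θ] {P : Measure Θ} [IsProbabilityMeasure P]
    {X : Θ → ℝ} (hX : Measurable X) {m s : ℝ} (hm : m ≠ 0)
    (h : IsSymmetricUnimodal (P.map X) m) (hs : 0 ≤ s)
    (hint : Integrable (fun θ => (X θ - m) ^ 2) P) (hvar : ∫ θ, (X θ - m) ^ 2 ∂P ≤ s ^ 2) :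
    P.real {θ | sgn (X θ) = sgn m}ᶜ ≤ 1 / 2 ∧
      2 * P.real {θ | sgn (X θ) = sgn m}ᶜ * |m| ≤ 2 * Real.sqrt 2 / 3 * s := by
  have hp : IsProbabilityMeasure (P.map X) := Measure.isProbabilityMeasure_map hX.aemeasurable
  have hsq : AEStronglyMeasurable (fun x : ℝ => (x - m) ^ 2) (P.map X) := by fun_prop
  have hint' : Integrable (fun x => (x - m) ^ 2) (P.map X) :=
    (integrable_map_measure hsq hX.aemeasurable).2 hint
  have hvar' : ∫ x, (x - m) ^ 2 ∂(P.map X) ≤ s ^ 2 := by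
    rwa [integral_map hX.aemeasurable hsq]
  have ht : 0 < |m| := abs_pos.2 hm
  -- A wrong sign puts X on the other side of 0, at distance at least |m| from its centre; the
  -- endpoint 0 is included in the tail.
  have hle : P.real {θ | sgn (X θ) = sgn m}ᶜ ≤ (P.map X).real (Set.Iic (m - |m|)) := by
    rcases hm.lt_or_gt with hneg | hpos
    · rw [← h.real_Ici, abs_of_neg hneg, map_measureReal_apply hX measurableSet_Ici]
      refine measureReal_mono fun θ hθ => ?_
      simp only [Set.mem_compl_iff, Set.mem_ofPred_eq, sgn, if_neg (not_le.2 hneg)] at hθ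
      simp only [Set.mem_preimage, Set.mem_Ici, add_neg_cancel]
      by_contra h1
      exact hθ (if_neg h1)
    · rw [abs_of_pos hpos, map_measureReal_apply hX measurableSet_Iic]
      refine measureReal_mono fun θ hθ => ?_
      simp only [Set.mem_compl_iff, Set.mem_ofPred_eq, sgn, if_pos hpos.le] at hθ
      simp only [Set.mem_preimage, Set.mem_Iic, sub_self]
      by_contra h1
      exact hθ (if_pos (not_le.1 h1).le)
  refine ⟨hle.trans (h.real_Iic_le_half ht), le_trans ?_ (h.real_Iic_mul_le ht hs hint' hvar')⟩
  have := mul_le_mul_of_nonneg_right hle ht.le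
  linarith

/-! ### One communication round -/

namespace CSCSystem

variable {q : ℕ} (C : CSCSystem q) {K : ℕ} {Θ : Type*}

lemma effectiveSNR_pos : 0 < C.effectiveSNR := by
  have h1 := C.Es_pos
  have h2 : (0 : ℝ) < C.noiseVar := C.noiseVar_pos
  unfold effectiveSNR
  positivity

/-- The vote detected in one round, when the devices hold the parameters `w`. -/
noncomputable def roundVote
    (G : Fin K → EuclideanSpace ℝ (Fin q) → Θ → EuclideanSpace ℝ (Fin q))
    (w : EuclideanSpace ℝ (Fin q)) (x : C.Round K Θ) : EuclideanSpace ℝ (Fin q) :=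
  C.majorityVote (fun k i => sgn (G k w (x.1 k) i)) x.2.1 x.2.2.1 x.2.2.2

lemma roundVote_apply (G : Fin K → EuclideanSpace ℝ (Fin q) → Θ → EuclideanSpace ℝ (Fin q))
    (w : EuclideanSpace ℝ (Fin q)) (x : C.Round K Θ) (i : Fin q) :
    C.roundVote G w x i
      = sgn (C.energyDiff (fun k i => sgn (G k w (x.1 k) i)) x.2.1 i x.2.2) := rfl

variable [MeasurableSpace Θ]

lemma roundLaw_eq (P : Fin K → Measure Θ) (Q : Measure (Fin K → Fin q → ℂ)) :
    C.roundLaw P Q = (Measure.pi P).prod (Q.prod (C.linkLaw K)) := rfl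

variable {P : Fin K → Measure Θ} [∀ k, IsProbabilityMeasure (P k)]
  {Q : Measure (Fin K → Fin q → ℂ)} [IsProbabilityMeasure Q]
  {G : Fin K → EuclideanSpace ℝ (Fin q) → Θ → EuclideanSpace ℝ (Fin q)}

instance : IsProbabilityMeasure (C.roundLaw P Q) := by rw [roundLaw_eq]; infer_instance

lemma measurable_roundVote_apply (hG : ∀ k w, Measurable (G k w)) (w : EuclideanSpace ℝ (Fin q))
    (i : Fin q) : Measurable fun x : C.Round K Θ => C.roundVote G w x i := by
  simp_rw [roundVote_apply]
  refine measurable_sgn.comp (C.measurable_energyDiff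
    (v := fun x : C.Round K Θ => fun k i => sgn (G k w (x.1 k) i)) (s := fun x => x.2.1)
    (x := fun x => x.2.2) (fun k i => ?_) (fun k i => ?_) measurable_snd.snd i)
  · have h1 : Measurable fun θ => G k w θ i := by
      have := hG k w
      fun_prop
    exact measurable_sgn.comp (h1.comp ((measurable_pi_apply k).comp measurable_fst))
  · exact (measurable_pi_apply i).comp ((measurable_pi_apply k).comp measurable_snd.fst)

/-- The probability that the vote detected on the gradient `i` is wrong. -/
lemma real_roundVote_ne_le (hC : C.OrthogonalChirps) (hK : 0 < K)
    (hQ : ∀ᵐ s ∂Q, ∀ k i, ‖s k i‖ = 1) (hG : ∀ k w, Measurable (G k w))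
    (w : EuclideanSpace ℝ (Fin q)) (i : Fin q) {m : ℝ}
    (hp : ∀ k, (P k).real {θ | sgn (G k w θ i) = sgn m}ᶜ ≤ 1 / 2) :
    (C.roundLaw P Q).real {x | C.roundVote G w x i ≠ sgn m}
      ≤ ((∑ k, (P k).real {θ | sgn (G k w θ i) = sgn m}ᶜ) * C.effectiveSNR + 1)
        / (K * C.effectiveSNR + 2) := by
  classical
  obtain ⟨f, hf1, hf2, hf3⟩ := C.exists_detection_error (K := K) hC hK i
  obtain ⟨e, he⟩ : ∃ e : Bool, sgn m = if e then 1 else -1 := by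
    rcases sgn_eq_or m with h | h
    · exact ⟨true, by simp [h]⟩
    · exact ⟨false, by simp [h]⟩
  set A : Fin K → Set Θ := fun k => {θ | sgn (G k w θ i) = sgn m} with hA
  have hAm : ∀ k, MeasurableSet (A k) := fun k => by
    have h1 : Measurable fun θ => G k w θ i := by
      have := hG k w
      fun_prop
    exact measurableSet_eq_fun (measurable_sgn.comp h1) measurable_const
  set cnt : (Fin K → Θ) → ℕ := fun θ => (Finset.univ.filter fun k => θ k ∈ A k).card with hcnt
  have hcount : ∀ θ : Fin K → Θ, voteCount (fun k i => sgn (G k w (θ k) i)) i e = cnt θ := by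
    intro θ
    rw [voteCount, hcnt]
    congr 1
    ext k
    simp [hA, he]
  have hlink : ∀ (θ : Fin K → Θ) (s : Fin K → Fin q → ℂ), (∀ k i, ‖s k i‖ = 1) →
      (C.linkLaw K).real {y | C.roundVote G w (θ, s, y) i ≠ sgn m} ≤ f (cnt θ) := by
    intro θ s hs
    have h := hf3 (fun k i => sgn (G k w (θ k) i)) s (fun k => sgn_eq_or _) hs e
    rw [hcount, ← he] at h
    simp only [roundVote_apply]
    exact h
  have hf0 : ∀ θ, 0 ≤ f (cnt θ) := fun θ =>
    measureReal_nonneg.trans (hlink θ (fun _ _ => 1) (by simp))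
  refine le_trans ?_ (integral_pi_detection_error_le P hAm hp C.effectiveSNR_pos.le hf1 hf2)
  have hW : MeasurableSet {x : C.Round K Θ | C.roundVote G w x i ≠ sgn m} :=
    (measurableSet_eq_fun (C.measurable_roundVote_apply hG w i) measurable_const).compl
  rw [measureReal_def]
  refine ENNReal.toReal_le_of_le_ofReal (integral_nonneg hf0) ?_
  rw [ofReal_integral_eq_lintegral_ofReal
    (integral_pi_successes P hAm fun t => f t.card).1 (Filter.Eventually.of_forall hf0),
    roundLaw_eq, Measure.prod_apply hW]
  refine lintegral_mono fun θ => ?_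
  rw [Measure.prod_apply (measurable_prodMk_left hW)]
  calc _ ≤ ∫⁻ _, ENNReal.ofReal (f (cnt θ)) ∂Q := by
        refine lintegral_mono_ae ?_
        filter_upwards [hQ] with s hs
        rw [← ofReal_measureReal]
        exact ENNReal.ofReal_le_ofReal (hlink θ s hs)
    _ = ENNReal.ofReal (f (cnt θ)) := by simp

lemma integrable_roundVote_apply (hG : ∀ k w, Measurable (G k w)) (w : EuclideanSpace ℝ (Fin q))
    (i : Fin q) : Integrable (fun x => C.roundVote G w x i) (C.roundLaw P Q) := by
  refine Integrable.of_bound (C.measurable_roundVote_apply hG w i).aestronglyMeasurable 1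
    (Filter.Eventually.of_forall fun x => ?_)
  rw [roundVote_apply]
  rcases sgn_eq_or (C.energyDiff (fun k i => sgn (G k w (x.1 k) i)) x.2.1 i x.2.2) with h | h <;>
    rw [h] <;> norm_num

/-- The mean correlation of the detected vote with the gradient. -/
lemma le_integral_mul_roundVote (hC : C.OrthogonalChirps) (hK : 0 < K)
    (hQ : ∀ᵐ s ∂Q, ∀ k i, ‖s k i‖ = 1) (hG : ∀ k w, Measurable (G k w))
    (w : EuclideanSpace ℝ (Fin q)) (i : Fin q) {m s : ℝ} (hs : 0 ≤ s)
    (hint : ∀ k, Integrable (fun θ => (G k w θ i - m) ^ 2) (P k))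
    (hvar : ∀ k, ∫ θ, (G k w θ i - m) ^ 2 ∂(P k) ≤ s ^ 2)
    (huni : ∀ k, IsSymmetricUnimodal ((P k).map fun θ => G k w θ i) m) :
    |m| - 2 * Real.sqrt 2 / 3 * s ≤ (1 + 2 / (C.effectiveSNR * K)) *
      ∫ x, m * C.roundVote G w x i ∂(C.roundLaw P Q) := by
  rcases eq_or_ne m 0 with rfl | hm
  · simp only [abs_zero, zero_mul, integral_zero, mul_zero, zero_sub, neg_nonpos]
    positivity
  have hsign := fun k => real_wrong_sign_le (P := P k) (X := fun θ => G k w θ i)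
    (by have := hG k w; fun_prop) hm (huni k) hs (hint k) (hvar k)
  have hξ := C.effectiveSNR_pos
  have hKp : (0 : ℝ) < K := by exact_mod_cast hK
  set ξ := C.effectiveSNR with hξdef
  set p : Fin K → ℝ := fun k => (P k).real {θ | sgn (G k w θ i) = sgn m}ᶜ with hp
  have hwrong := C.real_roundVote_ne_le (P := P) (Q := Q) hC hK hQ hG w i
    (fun k => (hsign k).1)
  set W := {x : C.Round K Θ | C.roundVote G w x i ≠ sgn m} with hWdef
  have hW : MeasurableSet W :=
    (measurableSet_eq_fun (C.measurable_roundVote_apply hG w i) measurable_const).compl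
  -- A correct vote contributes |m| and a wrong one -|m|, also under the convention `sgn 0 = 1`.
  have hfun : (fun x => m * C.roundVote G w x i)
      = fun x => |m| * (1 - W.indicator (fun _ => (2 : ℝ)) x) := by
    ext x
    have hmm : |m| = m * sgn m := by
      unfold sgn
      split_ifs with h
      · rw [abs_of_nonneg h, mul_one]
      · rw [abs_of_neg (not_le.1 h)]; ring
    rw [Set.indicator_apply]
    by_cases h : C.roundVote G w x i = sgn m
    · have hx : x ∉ W := fun hx => hx h
      rw [if_neg hx, h, hmm]; ring
    · have hx : x ∈ W := h
      rw [if_pos hx, hmm]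
      have h1 : C.roundVote G w x i = - sgn m := by
        rw [roundVote_apply] at h ⊢
        rcases sgn_eq_or (C.energyDiff (fun k i => sgn (G k w (x.1 k) i)) x.2.1 i x.2.2)
          with h2 | h2 <;> rcases sgn_eq_or m with h3 | h3 <;> rw [h2, h3] at h ⊢ <;>
          first | exact absurd rfl h | norm_num
      rw [h1]; ring
  rw [hfun, integral_const_mul, integral_sub (integrable_const _)
    ((integrable_const _).indicator hW), integral_indicator_const _ hW]
  simp only [integral_const, probReal_univ, smul_eq_mul, one_mul]
  have hden : 0 < (K : ℝ) * ξ + 2 := by positivity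
  have hsum : 2 * |m| * ∑ k, p k ≤ K * (2 * Real.sqrt 2 / 3 * s) := by
    rw [Finset.mul_sum]
    calc ∑ k, 2 * |m| * p k ≤ ∑ _k : Fin K, 2 * Real.sqrt 2 / 3 * s :=
          Finset.sum_le_sum fun k _ => by have := (hsign k).2; simp only [hp]; linarith
      _ = _ := by simp
  rw [le_div_iff₀ hden] at hwrong
  -- This factor cancels the attenuation Kξ/(Kξ + 2) of |m| exactly. The term with the p_k becomes
  -- 2|m| times their average, so the noise term carries no factor depending on ξ.
  have hfac : 1 + 2 / (ξ * K) = (K * ξ + 2) / (ξ * K) := by field_simp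
  rw [hfac, div_mul_eq_mul_div (K * ξ + 2 : ℝ), le_div_iff₀ (by positivity)]
  have h1 := mul_le_mul_of_nonneg_left hwrong (abs_nonneg m)
  have h2 := mul_le_mul_of_nonneg_left hsum hξ.le
  set u := (C.roundLaw P Q).real W
  have h3 : |m| * (u * (K * ξ + 2)) ≤ |m| * ((∑ k, p k) * ξ + 1) := h1
  nlinarith

end CSCSystem

/-! ### Parameters along the rounds -/

section Independent

variable {Ω α E : Type*} [MeasurableSpace Ω] [MeasurableSpace α] {μ : Measure Ω}

/-- Mean of a function of a finitely valued variable and an independent one. -/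
lemma integral_comp_of_finite_range [DecidableEq E] {W : Ω → E} {Y : Ω → α} {T : Finset E}
    (hT : ∀ ω, W ω ∈ T) (hY : Measurable Y) (hW : ∀ w, MeasurableSet {ω | W ω = w})
    (hind : ∀ w s, MeasurableSet s → μ ({ω | W ω = w} ∩ Y ⁻¹' s) = μ {ω | W ω = w} * μ (Y ⁻¹' s))
    (φ : E → α → ℝ) (hφ : ∀ w, Integrable (φ w) (μ.map Y)) :
    Integrable (fun ω => φ (W ω) (Y ω)) μ ∧
      ∫ ω, φ (W ω) (Y ω) ∂μ = ∑ w ∈ T, μ.real {ω | W ω = w} * ∫ y, φ w y ∂(μ.map Y) := by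
  have hfun : (fun ω => φ (W ω) (Y ω))
      = fun ω => ∑ w ∈ T, {ω | W ω = w}.indicator (fun ω => φ w (Y ω)) ω := by
    ext ω
    simp only [Set.indicator_apply, Set.mem_ofPred_eq]
    rw [Finset.sum_ite_eq, if_pos (hT ω)]
  have hint : ∀ w ∈ T, Integrable ({ω | W ω = w}.indicator (fun ω => φ w (Y ω))) μ :=
    fun w _ => ((hφ w).comp_measurable hY).indicator (hW w)
  rw [hfun]
  refine ⟨integrable_finsetSum _ hint, ?_⟩
  rw [integral_finsetSum _ hint]
  refine Finset.sum_congr rfl fun w _ => ?_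
  -- Independence: restricting to W = w rescales the law of Y and does not change it otherwise.
  have hlaw : (μ.restrict {ω | W ω = w}).map Y = μ {ω | W ω = w} • μ.map Y := by
    ext s hs
    rw [Measure.map_apply hY hs, Measure.restrict_apply (hY hs), Measure.smul_apply,
      Measure.map_apply hY hs, Set.inter_comm, hind w s hs, smul_eq_mul]
  have hm : AEStronglyMeasurable (φ w) ((μ.restrict {ω | W ω = w}).map Y) := by
    rw [hlaw]
    exact (hφ w).aestronglyMeasurable.smul_measure _
  rw [integral_indicator (hW w), ← integral_map hY.aemeasurable hm, hlaw, integral_smul_measure]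
  rfl

end Independent

namespace CSCSystem

variable {q : ℕ} (C : CSCSystem q) {K : ℕ} {Θ : Type*}
  (G : Fin K → EuclideanSpace ℝ (Fin q) → Θ → EuclideanSpace ℝ (Fin q)) (η : ℝ)
  (w₀ : EuclideanSpace ℝ (Fin q))

lemma params_succ (x : ℕ → C.Round K Θ) (n : ℕ) :
    C.params G η w₀ x (n + 1)
      = C.params G η w₀ x n - η • C.roundVote G (C.params G η w₀ x n) (x n) := rfl

/-- Each update is η times a sign vector, so there are finitely many values after n rounds.
Expectations over the parameters become finite sums, and no measurability of F, of its gradient or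
of `G` in `w` is needed. -/
lemma finite_range_params (n : ℕ) :
    (Set.range fun x : ℕ → C.Round K Θ => C.params G η w₀ x n).Finite := by
  induction n with
  | zero => exact (Set.finite_singleton w₀).subset (by rintro _ ⟨x, rfl⟩; rfl)
  | succ n ih =>
    have hfin : (Set.range fun b : Fin q → Bool =>
        (WithLp.toLp 2 fun i => if b i then (1 : ℝ) else -1 : EuclideanSpace ℝ (Fin q))).Finite :=
      Set.finite_range _
    refine (Set.Finite.image2 (fun w v => w - η • v) ih hfin).subset ?_
    rintro _ ⟨x, rfl⟩
    refine ⟨_, ⟨x, rfl⟩, C.roundVote G (C.params G η w₀ x n) (x n), ?_, rfl⟩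
    refine ⟨fun i => decide (C.roundVote G (C.params G η w₀ x n) (x n) i = 1), ?_⟩
    ext i
    simp only [decide_eq_true_eq]
    rw [roundVote_apply]
    rcases sgn_eq_or (C.energyDiff (fun k i => sgn (G k (C.params G η w₀ x n) ((x n).1 k) i))
      (x n).2.1 i (x n).2.2) with h | h <;> rw [h] <;> norm_num

variable {G} [MeasurableSpace Θ]

lemma measurableSet_update_eq (hG : ∀ k w, Measurable (G k w)) (u w : EuclideanSpace ℝ (Fin q)) :
    MeasurableSet {x : C.Round K Θ | u - η • C.roundVote G u x = w} := by
  have : {x : C.Round K Θ | u - η • C.roundVote G u x = w}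
      = ⋂ i, {x | u i - η * C.roundVote G u x i = w i} := by
    ext x
    simp only [Set.mem_ofPred_eq, Set.mem_iInter]
    exact ⟨fun h i => by rw [← h]; rfl, fun h => by ext i; exact h i⟩
  rw [this]
  exact MeasurableSet.iInter fun i => measurableSet_eq_fun
    (measurable_const.sub (measurable_const.mul (C.measurable_roundVote_apply hG u i)))
    measurable_const

/-- The parameters are determined by the past rounds. -/
lemma measurableSet_params_eq (hG : ∀ k w, Measurable (G k w)) {Ω : Type*}
    (X : ℕ → Ω → C.Round K Θ) (n : ℕ) (w : EuclideanSpace ℝ (Fin q)) :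
    MeasurableSet[⨆ m ∈ Set.Iio n, MeasurableSpace.comap (X m) inferInstance]
      {ω | C.params G η w₀ (fun m => X m ω) n = w} := by
  induction n generalizing w with
  | zero =>
    have : {ω | C.params G η w₀ (fun m => X m ω) 0 = w} = {_ω : Ω | w₀ = w} := rfl
    rw [this]
    exact MeasurableSet.const _
  | succ n ih =>
    set 𝓕 : MeasurableSpace Ω :=
      ⨆ m ∈ Set.Iio (n + 1), MeasurableSpace.comap (X m) inferInstance with h𝓕
    have hle : (⨆ m ∈ Set.Iio n, MeasurableSpace.comap (X m) inferInstance) ≤ 𝓕 :=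
      biSup_mono fun m hm => Set.mem_Iio.2 ((Set.mem_Iio.1 hm).trans (Nat.lt_succ_self n))
    have hXn : MeasurableSpace.comap (X n) inferInstance ≤ 𝓕 :=
      le_biSup (fun m => MeasurableSpace.comap (X m) inferInstance)
        (Set.mem_Iio.2 (Nat.lt_succ_self n))
    -- The update is measurable only for a fixed parameter vector, so the event is split over the
    -- finitely many values of the previous parameters.
    have hset : {ω | C.params G η w₀ (fun m => X m ω) (n + 1) = w}
        = ⋃ u ∈ Set.range (fun x : ℕ → C.Round K Θ => C.params G η w₀ x n),
          ({ω | C.params G η w₀ (fun m => X m ω) n = u}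
            ∩ X n ⁻¹' {x | u - η • C.roundVote G u x = w}) := by
      ext ω
      simp only [Set.mem_ofPred_eq, params_succ, Set.mem_iUnion, Set.mem_inter_iff,
        Set.mem_preimage, exists_prop]
      constructor
      · exact fun h => ⟨_, ⟨_, rfl⟩, rfl, h⟩
      · rintro ⟨u, -, rfl, h⟩
        exact h
    rw [hset]
    refine (C.finite_range_params G η w₀ n).measurableSet_biUnion fun u _ => ?_
    exact (hle _ (ih u)).inter (hXn _ ⟨_, C.measurableSet_update_eq η hG u w, rfl⟩)

section Convergence

variable {P : Fin K → Measure Θ} {Q : Measure (Fin K → Fin q → ℂ)} {Ω : Type*} [MeasurableSpace Ω] {μ : Measure Ω} {X : ℕ → Ω → C.Round K Θ}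

lemma measure_params_inter (hG : ∀ k w, Measurable (G k w)) (hX : ∀ n, Measurable (X n))
    (hXindep : iIndepFun X μ) (n : ℕ) (w : EuclideanSpace ℝ (Fin q)) :
    MeasurableSet {ω | C.params G η w₀ (fun m => X m ω) n = w} ∧
    ∀ s, MeasurableSet s → μ ({ω | C.params G η w₀ (fun m => X m ω) n = w} ∩ X n ⁻¹' s)
      = μ {ω | C.params G η w₀ (fun m => X m ω) n = w} * μ (X n ⁻¹' s) := by
  have hle : ∀ m, MeasurableSpace.comap (X m) inferInstance ≤ (inferInstance : MeasurableSpace Ω) :=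
    fun m => (hX m).comap_le
  have hmeas := C.measurableSet_params_eq η w₀ hG X n w
  refine ⟨(iSup₂_le fun m _ => hle m) _ hmeas, fun s hs => ?_⟩
  have hind := indep_iSup_of_disjoint hle ((iIndepFun_iff_iIndep _ _ _).1 hXindep)
    (S := Set.Iio n) (T := {n}) (by simp)
  refine (Indep_iff _ _ _).1 hind _ _ hmeas ?_
  exact le_biSup (fun m => MeasurableSpace.comap (X m) inferInstance) (Set.mem_singleton n) _
    ⟨s, hs, rfl⟩

/-- Mean of a function of the current parameters and of the current round. -/
lemma exists_integral_params_eq (hG : ∀ k w, Measurable (G k w)) (hX : ∀ n, Measurable (X n))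
    (hXlaw : ∀ n, μ.map (X n) = C.roundLaw P Q) (hXindep : iIndepFun X μ) (n : ℕ) :
    ∃ (T : Finset (EuclideanSpace ℝ (Fin q))) (a : EuclideanSpace ℝ (Fin q) → ℝ),
      (∀ w, 0 ≤ a w) ∧
      ∀ φ : EuclideanSpace ℝ (Fin q) → C.Round K Θ → ℝ,
        (∀ w, Integrable (φ w) (C.roundLaw P Q)) →
        Integrable (fun ω => φ (C.params G η w₀ (fun m => X m ω) n) (X n ω)) μ ∧
        ∫ ω, φ (C.params G η w₀ (fun m => X m ω) n) (X n ω) ∂μ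
          = ∑ w ∈ T, a w * ∫ x, φ w x ∂(C.roundLaw P Q) := by
  classical
  -- Values and weights do not depend on `φ`, so expectations of different functions can be compared
  -- value by value.
  refine ⟨(C.finite_range_params G η w₀ n).toFinset,
    fun w => μ.real {ω | C.params G η w₀ (fun m => X m ω) n = w}, fun w => measureReal_nonneg,
    fun φ hφ => ?_⟩
  rw [← hXlaw n] at hφ ⊢
  have hT : ∀ ω, C.params G η w₀ (fun m => X m ω) n
      ∈ (C.finite_range_params G η w₀ n).toFinset :=
    fun ω => (Set.Finite.mem_toFinset _).2 ⟨fun m => X m ω, rfl⟩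
  exact integral_comp_of_finite_range hT (hX n)
    (fun w => (C.measure_params_inter η w₀ hG hX hXindep n w).1)
    (fun w => (C.measure_params_inter η w₀ hG hX hXindep n w).2) φ hφ

/-- The descent estimate summed over the rounds. -/
lemma sum_integral_gradient_le [∀ k, IsProbabilityMeasure (P k)] [IsProbabilityMeasure Q]
    [IsProbabilityMeasure μ] {F : EuclideanSpace ℝ (Fin q) → ℝ} {Fstar : ℝ} {L B : Fin q → ℝ}
    {r : ℝ} (hr : 0 ≤ r) (hη : 0 ≤ η) (hFstar : ∀ w, Fstar ≤ F w)
    (hsmooth : ∀ w w' : EuclideanSpace ℝ (Fin q),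
      |F w' - (F w + ∑ i, gradient F w i * (w' i - w i))|
        ≤ 1 / 2 * ∑ i, L i * (w' i - w i) ^ 2)
    (hG : ∀ k w, Measurable (G k w)) (hX : ∀ n, Measurable (X n))
    (hXlaw : ∀ n, μ.map (X n) = C.roundLaw P Q) (hXindep : iIndepFun X μ)
    (hdrift : ∀ w i, |gradient F w i| - B i
      ≤ r * ∫ x, gradient F w i * C.roundVote G w x i ∂(C.roundLaw P Q)) (N : ℕ) :
    (∀ n, Integrable (fun ω => ∑ i, |gradient F (C.params G η w₀ (fun m => X m ω) n) i|) μ) ∧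
    η * ∑ n ∈ Finset.range N, ∫ ω, ∑ i, |gradient F (C.params G η w₀ (fun m => X m ω) n) i| ∂μ
      ≤ r * (F w₀ - Fstar + N * (η ^ 2 / 2 * ∑ i, L i)) + N * (η * ∑ i, B i) := by
  have hconst : ∀ (ψ : EuclideanSpace ℝ (Fin q) → ℝ) n,
      Integrable (fun ω => ψ (C.params G η w₀ (fun m => X m ω) n)) μ := by
    intro ψ n
    obtain ⟨T, a, -, h⟩ := C.exists_integral_params_eq (P := P) (Q := Q) η w₀ hG hX hXlaw hXindep n
    exact (h (fun w _ => ψ w) fun w => integrable_const _).1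
  set S : ℕ → ℝ := fun n =>
    ∫ ω, ∑ i, |gradient F (C.params G η w₀ (fun m => X m ω) n) i| ∂μ with hS
  set f : ℕ → ℝ := fun n => ∫ ω, F (C.params G η w₀ (fun m => X m ω) n) ∂μ with hf
  -- Descent in one round: h1 is smoothness in expectation, h2 is the drift bound averaged over the
  -- current parameters; the correlation `D` is eliminated between them.
  have hstep : ∀ n, η * S n ≤ r * (f n - f (n + 1) + η ^ 2 / 2 * ∑ i, L i) + η * ∑ i, B i := by
    intro n
    obtain ⟨T, a, ha, h⟩ :=
      C.exists_integral_params_eq (P := P) (Q := Q) η w₀ hG hX hXlaw hXindep n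
    have hVint : ∀ w, Integrable (fun x => ∑ i, gradient F w i * C.roundVote G w x i)
        (C.roundLaw P Q) := fun w => integrable_finsetSum _ fun i _ =>
      (C.integrable_roundVote_apply hG w i).const_mul _
    obtain ⟨hV1, hV2⟩ := h (fun w x => ∑ i, gradient F w i * C.roundVote G w x i) hVint
    set D : ℝ := ∫ ω, ∑ i, gradient F (C.params G η w₀ (fun m => X m ω) n) i
      * C.roundVote G (C.params G η w₀ (fun m => X m ω) n) (X n ω) i ∂μ with hD
    have h1 : f (n + 1) ≤ f n - η * D + η ^ 2 / 2 * ∑ i, L i := by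
      have e : f n - η * D + η ^ 2 / 2 * ∑ i, L i
          = ∫ ω, (F (C.params G η w₀ (fun m => X m ω) n)
            - η * (∑ i, gradient F (C.params G η w₀ (fun m => X m ω) n) i
              * C.roundVote G (C.params G η w₀ (fun m => X m ω) n) (X n ω) i)
            + η ^ 2 / 2 * ∑ i, L i) ∂μ := by
        rw [integral_add (by exact (hconst F n).sub (hV1.const_mul η)) (integrable_const _),
          integral_sub (hconst F n) (hV1.const_mul η), integral_const_mul]
        simp [hD, hf]
      rw [e]
      refine integral_mono (hconst F (n + 1))
        (((hconst F n).sub (hV1.const_mul η)).add (integrable_const _)) fun ω => ?_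
      simp only [params_succ]
      set w := C.params G η w₀ (fun m => X m ω) n
      set v := C.roundVote G w (X n ω) with hv
      have hvsq : ∀ i, v i ^ 2 = 1 := by
        intro i
        rw [hv, roundVote_apply]
        rcases sgn_eq_or (C.energyDiff (fun k i => sgn (G k w ((X n ω).1 k) i))
          (X n ω).2.1 i (X n ω).2.2) with h | h <;> rw [h] <;> norm_num
      have hd : ∀ i, (w - η • v) i - w i = -(η * v i) := by
        intro i
        simp
      have h2 := (abs_le.1 (hsmooth w (w - η • v))).2
      simp_rw [hd] at h2
      have h3 : ∑ i, gradient F w i * -(η * v i) = -(η * ∑ i, gradient F w i * v i) := by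
        rw [Finset.mul_sum, ← Finset.sum_neg_distrib]
        exact Finset.sum_congr rfl fun i _ => by ring
      have h4 : ∑ i, L i * (-(η * v i)) ^ 2 = η ^ 2 * ∑ i, L i := by
        rw [Finset.mul_sum]
        exact Finset.sum_congr rfl fun i _ => by rw [neg_sq, mul_pow, hvsq]; ring
      rw [h3, h4] at h2
      linarith
    have h2 : S n ≤ r * D + ∑ i, B i := by
      have e1 := (h (fun w _ => ∑ i, |gradient F w i|) fun w => integrable_const _).2
      have e2 := (h (fun _ _ => ∑ i, B i) fun w => integrable_const _).2
      simp only [integral_const, probReal_univ, smul_eq_mul, one_mul] at e1 e2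
      have e3 : S n = ∑ w ∈ T, a w * ∑ i, |gradient F w i| := e1
      have e4 : D = ∑ w ∈ T, a w * ∫ x, ∑ i, gradient F w i * C.roundVote G w x i
          ∂(C.roundLaw P Q) := hV2
      rw [e3, e4, e2, Finset.mul_sum, ← Finset.sum_add_distrib]
      refine Finset.sum_le_sum fun w _ => ?_
      rw [integral_finsetSum _ fun i _ => (C.integrable_roundVote_apply hG w i).const_mul _]
      have h3 : ∑ i, |gradient F w i| ≤ r * ∑ i, ∫ x, gradient F w i * C.roundVote G w x i
          ∂(C.roundLaw P Q) + ∑ i, B i := by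
        rw [Finset.mul_sum, ← Finset.sum_add_distrib]
        exact Finset.sum_le_sum fun i _ => by have := hdrift w i; linarith
      have := mul_le_mul_of_nonneg_left h3 (ha w)
      linarith
    have h3 := mul_le_mul_of_nonneg_left h1 hr
    have h4 := mul_le_mul_of_nonneg_left h2 hη
    linarith
  refine ⟨fun n => hconst (fun w => ∑ i, |gradient F w i|) n, ?_⟩
  rw [Finset.mul_sum]
  refine (Finset.sum_le_sum fun n _ => hstep n).trans ?_
  -- The values of `f` telescope, leaving f 0 - f N, and f N is at least `Fstar`.
  rw [Finset.sum_add_distrib, ← Finset.mul_sum, Finset.sum_add_distrib, Finset.sum_range_sub']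
  simp only [Finset.sum_const, Finset.card_range, nsmul_eq_mul]
  have hf0 : f 0 = F w₀ := by simp [hf, params]
  have hfN : Fstar ≤ f N := by
    calc Fstar = ∫ _, Fstar ∂μ := by simp
      _ ≤ f N := integral_mono (integrable_const _) (hconst F N) fun ω => hFstar _
  rw [hf0]
  have := mul_le_mul_of_nonneg_left hfN hr
  linarith

end Convergence

end CSCSystem

/-! ### The convergence bound -/

theorem theorem1 {q K N nb : ℕ} (hK : 0 < K) (hN : 0 < N)
    (γ η : ℝ) (hγ : 0 < γ)
    -- the loss function: bounded from below and coordinate-wise smooth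
    (F : EuclideanSpace ℝ (Fin q) → ℝ) (Fstar : ℝ) (L : Fin q → ℝ)
    (hFstar : ∀ w, Fstar ≤ F w)
    (hFdiff : Differentiable ℝ F)
    (hL : ∀ i, 0 ≤ L i) (hLpos : 0 < ∑ i, L i)
    (hsmooth : ∀ w w' : EuclideanSpace ℝ (Fin q),
      |F w' - (F w + ∑ i, gradient F w i * (w' i - w i))|
        ≤ 1 / 2 * ∑ i, L i * (w' i - w i) ^ 2)
    -- batch size and learning rate
    (hnb : (nb : ℝ) = N / γ) (hη : η = 1 / Real.sqrt ((∑ i, L i) * nb))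
    -- the local stochastic gradients
    {Θ : Type*} [MeasurableSpace Θ] (P : Fin K → Measure Θ) [∀ k, IsProbabilityMeasure (P k)]
    (G : Fin K → EuclideanSpace ℝ (Fin q) → Θ → EuclideanSpace ℝ (Fin q))
    (hGmeas : ∀ k w, Measurable (G k w))
    (σ : Fin q → ℝ) (hσ : ∀ i, 0 ≤ σ i)
    (hGL2 : ∀ k w i, MemLp (fun θ => G k w θ i) 2 (P k))
    (hunbiased : ∀ k w i, ∫ θ, G k w θ i ∂(P k) = gradient F w i)
    (hvar : ∀ k w i, ∫ θ, (G k w θ i - gradient F w i) ^ 2 ∂(P k) ≤ σ i ^ 2 / nb)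
    (hunimodal : ∀ k w i,
      IsSymmetricUnimodal ((P k).map fun θ => G k w θ i) (gradient F w i))
    -- the air interface, with orthogonal chirps and random symbols on the unit circle
    (C : CSCSystem q) (hC : C.OrthogonalChirps)
    (Q : Measure (Fin K → Fin q → ℂ)) [IsProbabilityMeasure Q]
    (hQ : ∀ᵐ s ∂Q, ∀ k i, ‖s k i‖ = 1)
    -- the communication rounds: independent, each with the law of one round
    {Ω : Type*} [MeasurableSpace Ω] (μ : Measure Ω) [IsProbabilityMeasure μ]
    (X : ℕ → Ω → C.Round K Θ)
    (hXlaw : ∀ n, HasLaw (X n) (C.roundLaw P Q) μ)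
    (hXindep : iIndepFun X μ)
    (w₀ : EuclideanSpace ℝ (Fin q)) :
    Integrable (fun ω => 1 / (N : ℝ) * ∑ n ∈ Finset.range N,
        ∑ i, |gradient F (C.params G η w₀ (fun m => X m ω) n) i|) μ ∧
    ∫ ω, 1 / (N : ℝ) * ∑ n ∈ Finset.range N,
        ∑ i, |gradient F (C.params G η w₀ (fun m => X m ω) n) i| ∂μ
      ≤ 1 / Real.sqrt N *
        ((1 + 2 / (C.effectiveSNR * K)) * (1 / Real.sqrt γ) * Real.sqrt (∑ i, L i)
            * (F w₀ - Fstar + γ / 2)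
          + 2 * Real.sqrt (2 * γ) / 3 * ∑ i, σ i) := by
  have hNp : (0 : ℝ) < N := by exact_mod_cast hN
  have hnbp : (0 : ℝ) < nb := by rw [hnb]; positivity
  have hξ := C.effectiveSNR_pos
  have hKp : (0 : ℝ) < K := by exact_mod_cast hK
  have hηp : 0 < η := by rw [hη]; positivity
  have hr : 0 < 1 + 2 / (C.effectiveSNR * K) := by positivity
  have hdrift : ∀ w i, |gradient F w i| - 2 * Real.sqrt 2 / 3 * (σ i / Real.sqrt nb)
      ≤ (1 + 2 / (C.effectiveSNR * K)) *
        ∫ x, gradient F w i * C.roundVote G w x i ∂(C.roundLaw P Q) := by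
    intro w i
    refine C.le_integral_mul_roundVote hC hK hQ hGmeas w i (div_nonneg (hσ i) (Real.sqrt_nonneg _))
      (fun k => ?_) (fun k => ?_) (fun k => hunimodal k w i)
    · exact ((hGL2 k w i).sub (memLp_const _)).integrable_sq
    · rw [div_pow, Real.sq_sqrt hnbp.le]
      exact hvar k w i
  -- `HasLaw` only gives a.e. measurability. Measurable versions are used, which a.e. produce the
  -- same parameters in all rounds at once.
  set Y : ℕ → Ω → C.Round K Θ := fun n => (hXlaw n).aemeasurable.mk (X n) with hY
  have hYX : ∀ n, X n =ᵐ[μ] Y n := fun n => (hXlaw n).aemeasurable.ae_eq_mk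
  have hYmeas : ∀ n, Measurable (Y n) := fun n => (hXlaw n).aemeasurable.measurable_mk
  have hYlaw : ∀ n, μ.map (Y n) = C.roundLaw P Q := fun n => by
    rw [← Measure.map_congr (hYX n), (hXlaw n).map_eq]
  have hYindep : iIndepFun Y μ := hXindep.congr hYX
  obtain ⟨hint, hsum⟩ := C.sum_integral_gradient_le η w₀ hr.le hηp.le hFstar hsmooth hGmeas hYmeas
    hYlaw hYindep hdrift N
  have hae : (fun ω => 1 / (N : ℝ) * ∑ n ∈ Finset.range N,
        ∑ i, |gradient F (C.params G η w₀ (fun m => X m ω) n) i|)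
      =ᵐ[μ] fun ω => 1 / (N : ℝ) * ∑ n ∈ Finset.range N,
        ∑ i, |gradient F (C.params G η w₀ (fun m => Y m ω) n) i| := by
    filter_upwards [ae_all_iff.2 hYX] with ω hω
    simp only [hω]
  refine ⟨((integrable_finsetSum _ fun n _ => hint n).const_mul _).congr hae.symm, ?_⟩
  rw [integral_congr_ae hae, integral_const_mul, integral_finsetSum _ fun n _ => hint n]
  set S := ∑ n ∈ Finset.range N,
    ∫ ω, ∑ i, |gradient F (C.params G η w₀ (fun m => Y m ω) n) i| ∂μ
  set r := 1 + 2 / (C.effectiveSNR * K)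
  have hsL : 0 < Real.sqrt (∑ i, L i) := Real.sqrt_pos.2 hLpos
  have hsN : 0 < Real.sqrt N := Real.sqrt_pos.2 hNp
  have hsγ : 0 < Real.sqrt γ := Real.sqrt_pos.2 hγ
  have hsnb : Real.sqrt nb = Real.sqrt N / Real.sqrt γ := by rw [hnb, Real.sqrt_div hNp.le]
  have hη' : η = Real.sqrt γ / (Real.sqrt (∑ i, L i) * Real.sqrt N) := by
    rw [hη, Real.sqrt_mul hLpos.le, hsnb]
    field_simp
  have hB : ∑ i, 2 * Real.sqrt 2 / 3 * (σ i / Real.sqrt nb)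
      = 2 * Real.sqrt 2 / 3 * Real.sqrt γ / Real.sqrt N * ∑ i, σ i := by
    rw [Finset.mul_sum, hsnb]
    exact Finset.sum_congr rfl fun i _ => by field_simp
  rw [hB] at hsum
  have hS : S ≤ (r * (F w₀ - Fstar + N * (η ^ 2 / 2 * ∑ i, L i))
      + N * (η * (2 * Real.sqrt 2 / 3 * Real.sqrt γ / Real.sqrt N * ∑ i, σ i))) / η := by
    rw [le_div_iff₀ hηp]; linarith
  calc 1 / (N : ℝ) * S ≤ 1 / (N : ℝ) * ((r * (F w₀ - Fstar + N * (η ^ 2 / 2 * ∑ i, L i))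
      + N * (η * (2 * Real.sqrt 2 / 3 * Real.sqrt γ / Real.sqrt N * ∑ i, σ i))) / η) :=
        mul_le_mul_of_nonneg_left hS (by positivity)
    _ = _ := by
        -- The learning rate makes the quadratic terms of all N rounds add up to γ/2.
        have e1 : η ^ 2 / 2 * ∑ i, L i = γ / 2 / N := by
          rw [hη', div_pow, mul_pow, Real.sq_sqrt hγ.le, Real.sq_sqrt hLpos.le,
            Real.sq_sqrt hNp.le]
          field_simp
        have e2 : (N : ℝ) = Real.sqrt N * Real.sqrt N := (Real.mul_self_sqrt hNp.le).symm
        rw [e1, mul_div_cancel₀ _ hNp.ne', Real.sqrt_mul (by norm_num), add_div,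
          mul_div_assoc (N : ℝ), mul_div_cancel_left₀ _ hηp.ne', mul_add, mul_add]
        rw [hη']
        nth_rewrite 1 [e2]
        field_simp
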